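/- \textbf{Setting.} Let $m\in\mathbb{N}$, $L>0$ and $\Sigma=[0,L]$. Fix boundary data $D(0),D(L)\in\mathbb{R}^m$ and unit vectors $N(0),N(L)\in\mathbb{R}^m$. Derivatives are weak derivatives on $(0,L)$, elements of Sobolev spaces are classes of functions modulo equality almost everywhere, and point values are those of the continuous representative. For an integrable $f$ on $\Sigma$ let $\|f'\|_{TV^0}=\sup\{\int_\Sigma\langle f,\varphi'\rangle\,dt : \varphi\in C_c^\infty((0,L)),\ |\varphi|\le 1\}$ be its total variation. For $k\ge1$ put $\|u\|_{TV^k}=\|u\|_{W^{k-1,1}}+\|(u^{(k-1)})'\|_{TV^0}$, with value $\infty$ if $u\notin W^{k-1,1}$. Sobolev norms are sums of the $L^p$ norms of all derivatives up to the given order. A Lipschitz immersion is a curve $\gamma\in W^{1,\infty}(\Sigma;\mathbb{R}^m)$ with $\gamma'\neq0$ almost everywhere whose logarithmic strain $\sigma_\gamma=\log|\gamma'|$ lies in $L^\infty$. For $p\in[2,\infty]$ let $\tilde{\mathcal C}_p$ be the set of Lipschitz immersions in $W^{2,p}(\Sigma;\mathbb{R}^m)$. Put $\mathcal D_\gamma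 u=|\gamma'|^{-1}u'$, $ds_\gamma=|\gamma'|\,dt$, $\tau_\gamma=\mathcal D_\gamma\gamma$, $\kappa_\gamma=\mathcal D_\gamma\tau_\gamma$, $\mathcal L(\gamma)=\int_\Sigma ds_\gamma$ and $\mathcal E(\gamma)=\frac12\int_\Sigma|\kappa_\gamma|^2\,ds_\gamma$. The norm $\|\cdot\|_{W^{k,p}_\gamma}$ is the Sobolev norm formed with $\mathcal D_\gamma$ and $ds_\gamma$, and $|u|_{TV^2_\gamma}=\|(\mathcal D_\gamma u)'\|_{TV^0}$ is the total variation of $\mathcal D_\gamma u$ (equal to $\int_\Sigma|\mathcal D_\gamma^2u|\,ds_\gamma$ for regular $u$). The constraint map is $$\Phi(\gamma)=\bigl(\gamma(0)-D(0),\ \gamma(L)-D(L),\ \tau_\gamma(0)-N(0),\ \tau_\gamma(L)-N(L),\ \sigma_\gamma\bigr).$$ $\|\Phi(\gamma)\|_{TV^2}$ denotes the Euclidean norm of its first four entries plus $\|\sigma_\gamma\|_{TV^2}$. The feasible set is $\mathcal C=\{\gamma\in\tilde{\mathcal C}_\infty : \Phi(\gamma)=0\}$. For $\Lambda,K\ge0$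 and $\eta>0$ let $\tilde{\mathcal A}(\Lambda,K,\eta)$ be the set of all $\gamma\in\tilde{\mathcal C}_\infty$ with $$\|\sigma_\gamma\|_{W^{1,\infty}_\gamma}\le\Lambda,\quad \|\tau_\gamma\|_{W^{1,\infty}_\gamma}\le K,\quad \mathcal L(\gamma)\ge(1+\eta)\,|\gamma(L)-\gamma(0)|,\quad |\sigma_\gamma|_{TV^2_\gamma}\le\Lambda,\quad |\tau_\gamma|_{TV^2_\gamma}\le K .$$ \textbf{Proposition (Restoration Operator).} For all $m$, $L$, $D$, $N$, $\Lambda$, $K$, $\eta$ as above there exist $C>0$, $\varepsilon>0$ and a map $$\mathcal P:\{\gamma\in\tilde{\mathcal A}(\Lambda,K,\eta) : \|\Phi(\gamma)\|_{TV^2}<\varepsilon\}\to\mathcal C$$ such that for every $\gamma$ in its domain: \begin{enumerate} \item (Proximity) $\|\mathcal P(\gamma)-\gamma\|_{TV^3}\le C\,\|\Phi(\gamma)\|_{TV^2}$; \item (Energy consistency) $|\mathcal E(\mathcal P(\gamma))-\mathcal E(\gamma)|\le C\,\|\Phi(\gamma)\|_{TV^2}$. \end{enumerate} -/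

import Mathlib

open MeasureTheory Set
open scoped ENNReal Distributions

/-! ### Sobolev and total variation norms on the interval `[0, L]` -/

/-- Lebesgue measure on `[0, L]`. -/
noncomputable abbrev sigmaMeasure (L : ℝ) : Measure ℝ := volume.restrict (Icc 0 L)

/-- The open interval `(0, L)`, which carries the supports of the test functions. -/
def openInterval (L : ℝ) : TopologicalSpace.Opens ℝ := ⟨Ioo 0 L, isOpen_Ioo⟩

section Sobolev

variable {F : Type*} [NormedAddCommGroup F] [InnerProductSpace ℝ F]

/-- `g` is the weak derivative of `f` on `(0, L)`; both functions are required to be integrable. -/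
def HasWeakDeriv (L : ℝ) (f g : ℝ → F) : Prop :=
  Integrable f (sigmaMeasure L) ∧ Integrable g (sigmaMeasure L) ∧
    ∀ φ : 𝓓(openInterval L, ℝ),
      ∫ t, deriv φ t • f t ∂(sigmaMeasure L) = -∫ t, φ t • g t ∂(sigmaMeasure L)

def WeaklyDifferentiable (L : ℝ) (f : ℝ → F) : Prop := ∃ g, HasWeakDeriv L f g

open Classical in
/-- A representative of the weak derivative (and `0` if there is no integrable weak derivative). -/
noncomputable def weakDeriv (L : ℝ) (f : ℝ → F) : ℝ → F :=
  if h : WeaklyDifferentiable L f then h.choose else 0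

open Classical in
/-- The representative of `f` that is continuous on `[0, L]`, if there is one. It gives a meaning to
the values of a Sobolev function at the end points of the interval. -/
noncomputable def contRep (L : ℝ) (f : ℝ → F) : ℝ → F :=
  if h : ∃ g : ℝ → F, ContinuousOn g (Icc 0 L) ∧ f =ᵐ[sigmaMeasure L] g then h.choose else f

/-- Membership in the Sobolev space `W^{k,p}` of functions on `[0, L]`. -/
def MemSobolev (L : ℝ) : ℕ → ℝ≥0∞ → (ℝ → F) → Prop
  | 0, p, u => MemLp u p (sigmaMeasure L)
  | k + 1, p, u => MemLp u p (sigmaMeasure L) ∧ WeaklyDifferentiable L u ∧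
      MemSobolev L k p (weakDeriv L u)

open Classical in
/-- The `W^{k,p}` norm: the sum of the `L^p` norms of the weak derivatives of order at most `k`
(and `∞` outside of `W^{k,p}`). -/
noncomputable def sobolevNorm (L : ℝ) (k : ℕ) (p : ℝ≥0∞) (u : ℝ → F) : ℝ≥0∞ :=
  if MemSobolev L k p u then
    ∑ j ∈ Finset.range (k + 1), eLpNorm ((weakDeriv L)^[j] u) p (sigmaMeasure L)
  else ∞

/-- The total variation of the integrable function `f` on `(0, L)`: the norm of the distributional
derivative of `f` as a functional on continuous functions with the supremum norm. -/
noncomputable def totalVariation (L : ℝ) (f : ℝ → F) : ℝ≥0∞ :=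
  ⨆ (φ : 𝓓(openInterval L, F)) (_ : ∀ t, ‖φ t‖ ≤ 1),
    ENNReal.ofReal (∫ t, inner ℝ (f t) (deriv φ t) ∂(sigmaMeasure L))

/-- For `k ≥ 1`, the `TV^k` norm `‖u‖_{W^{k-1,1}} + |u|_{TV^k}`, where `|u|_{TV^k}` is the total
variation of the `(k-1)`-st weak derivative; it is `∞` outside of `BV^k`. -/
noncomputable def tvNorm (L : ℝ) (k : ℕ) (u : ℝ → F) : ℝ≥0∞ :=
  sobolevNorm L (k - 1) 1 u + totalVariation L ((weakDeriv L)^[k - 1] u)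

end Sobolev

/-! ### Curves -/

/-- Classes of functions `[0, L] → ℝ^m` modulo equality almost everywhere. -/
abbrev CurveClass (m : ℕ) (L : ℝ) : Type :=
  ℝ →ₘ[sigmaMeasure L] EuclideanSpace ℝ (Fin m)

section Curves

variable {m : ℕ} {L : ℝ}

/-- The speed `|γ'|`. -/
noncomputable def speed (γ : CurveClass m L) : ℝ → ℝ := fun t => ‖weakDeriv L γ t‖

/-- The line element `|γ'| dt` on `[0, L]`. -/
noncomputable def lineElement (γ : CurveClass m L) : Measure ℝ :=
  (sigmaMeasure L).withDensity fun t => ENNReal.ofReal (speed γ t)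

/-- The length of `γ`. -/
noncomputable def curveLength (γ : CurveClass m L) : ℝ := ∫ t, speed γ t ∂(sigmaMeasure L)

/-- The logarithmic strain `log |γ'|`. -/
noncomputable def logStrain (γ : CurveClass m L) : ℝ → ℝ := fun t => Real.log (speed γ t)

/-- The differential with respect to unit speed `|γ'|⁻¹ u'`. -/
noncomputable def unitSpeedDeriv {F : Type*} [NormedAddCommGroup F] [InnerProductSpace ℝ F]
    (γ : CurveClass m L) (u : ℝ → F) : ℝ → F := fun t => (speed γ t)⁻¹ • weakDeriv L u t

/-- The unit tangent `γ' / |γ'|`. -/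
noncomputable def unitTangent (γ : CurveClass m L) : ℝ → EuclideanSpace ℝ (Fin m) :=
  unitSpeedDeriv γ γ

/-- The curvature vector. -/
noncomputable def curvature (γ : CurveClass m L) : ℝ → EuclideanSpace ℝ (Fin m) :=
  unitSpeedDeriv γ (unitTangent γ)

/-- The Euler-Bernoulli bending energy, half the integral of the squared curvature with respect to
the line element. -/
noncomputable def bendingEnergy (γ : CurveClass m L) : ℝ :=
  1 / 2 * ∫ t, ‖curvature γ t‖ ^ 2 * speed γ t ∂(sigmaMeasure L)

section Along

variable {F : Type*} [NormedAddCommGroup F] [InnerProductSpace ℝ F]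

/-- Membership in `W^{k,p}_γ`: as `W^{k,p}`, with derivatives with respect to unit speed and with
the line element in place of `dt`. -/
def MemSobolevAlong (γ : CurveClass m L) : ℕ → ℝ≥0∞ → (ℝ → F) → Prop
  | 0, p, u => MemLp u p (lineElement γ)
  | k + 1, p, u => MemLp u p (lineElement γ) ∧ WeaklyDifferentiable L u ∧
      MemSobolevAlong γ k p (unitSpeedDeriv γ u)

open Classical in
/-- The `W^{k,p}_γ` norm (`∞` outside of `W^{k,p}_γ`). -/
noncomputable def sobolevNormAlong (γ : CurveClass m L) (k : ℕ) (p : ℝ≥0∞) (u : ℝ → F) : ℝ≥0∞ :=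
  if MemSobolevAlong γ k p u then
    ∑ j ∈ Finset.range (k + 1), eLpNorm ((unitSpeedDeriv γ)^[j] u) p (lineElement γ)
  else ∞

/-- For `k ≥ 1`, the `TV^k_γ` seminorm: the total variation of the `(k-1)`-st derivative with
respect to unit speed. It extends `∫ |D_γ^k u| |γ'| dt`. -/
noncomputable def tvSeminormAlong (γ : CurveClass m L) (k : ℕ) (u : ℝ → F) : ℝ≥0∞ :=
  totalVariation L ((unitSpeedDeriv γ)^[k - 1] u)

end Along

/-- Lipschitz immersions: `γ ∈ W^{1,∞}` with essentially bounded logarithmic strain. The strain is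
`-∞` where `γ'` vanishes, so that boundedness includes `γ' ≠ 0` almost everywhere. -/
def IsLipschitzImmersion (γ : CurveClass m L) : Prop :=
  MemSobolev L 1 ∞ (γ : ℝ → EuclideanSpace ℝ (Fin m)) ∧
    (∀ᵐ t ∂(sigmaMeasure L), weakDeriv L γ t ≠ 0) ∧
    MemLp (logStrain γ) ∞ (sigmaMeasure L)

variable (m L) in
/-- The configuration space of immersions of class `W^{2,p}`. -/
def configSpace (p : ℝ≥0∞) : Set (CurveClass m L) :=
  {γ | IsLipschitzImmersion γ ∧ MemSobolev L 2 p (γ : ℝ → EuclideanSpace ℝ (Fin m))}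

/-- The constraint map: the first component collects the deviations from the boundary positions
`D₀`, `D₁` and from the boundary tangents `N₀`, `N₁`, the second one is the logarithmic strain. -/
noncomputable def constraintMap (D₀ D₁ N₀ N₁ : EuclideanSpace ℝ (Fin m)) (γ : CurveClass m L) :
    PiLp 2 (fun _ : Fin 4 => EuclideanSpace ℝ (Fin m)) × (ℝ → ℝ) :=
  (WithLp.toLp 2 ![contRep L γ 0 - D₀, contRep L γ L - D₁,
    contRep L (unitTangent γ) 0 - N₀, contRep L (unitTangent γ) L - N₁], logStrain γ)

/-- The `TV^2` norm on the target space of the constraint map: the Euclidean norm of the boundary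
terms plus the `TV^2` norm of the strain. -/
noncomputable def constraintNorm (D₀ D₁ N₀ N₁ : EuclideanSpace ℝ (Fin m)) (γ : CurveClass m L) :
    ℝ≥0∞ :=
  ‖(constraintMap D₀ D₁ N₀ N₁ γ).1‖ₑ + tvNorm L 2 (constraintMap D₀ D₁ N₀ N₁ γ).2

variable (L) in
/-- The feasible set: the immersions of class `W^{2,p}` on which the constraint map vanishes. -/
def feasibleSet (p : ℝ≥0∞) (D₀ D₁ N₀ N₁ : EuclideanSpace ℝ (Fin m)) : Set (CurveClass m L) :=
  {γ ∈ configSpace m L p | (constraintMap D₀ D₁ N₀ N₁ γ).1 = 0 ∧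
    (constraintMap D₀ D₁ N₀ N₁ γ).2 =ᵐ[sigmaMeasure L] 0}

variable (m L) in
/-- For `k ≥ 2`, the set `B^{k,p}(Λ, K, η)` of tame immersions. -/
def tameImmersions (k : ℕ) (p : ℝ≥0∞) (Λ K η : ℝ) : Set (CurveClass m L) :=
  {γ ∈ configSpace m L p |
    sobolevNormAlong γ (k - 1) p (logStrain γ) ≤ ENNReal.ofReal Λ ∧
    sobolevNormAlong γ (k - 1) p (unitTangent γ) ≤ ENNReal.ofReal K ∧
    (1 + η) * ‖contRep L γ L - contRep L γ 0‖ ≤ curveLength γ}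

variable (m L) in
/-- The tame immersions whose strain and unit tangent also obey bounds in `TV^2_γ`. -/
def restorationPriors (Λ K η : ℝ) : Set (CurveClass m L) :=
  {γ ∈ tameImmersions m L 2 ∞ Λ K η |
    tvSeminormAlong γ 2 (logStrain γ) ≤ ENNReal.ofReal Λ ∧
    tvSeminormAlong γ 2 (unitTangent γ) ≤ ENNReal.ofReal K}

variable (L) in
/-- The domain of the restoration operator. -/
def restorationDomain (D₀ D₁ N₀ N₁ : EuclideanSpace ℝ (Fin m)) (Λ K η ε : ℝ) :
    Set (CurveClass m L) :=
  {γ ∈ restorationPriors m L Λ K η | constraintNorm D₀ D₁ N₀ N₁ γ < ENNReal.ofReal ε}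

end Curves

/-! ### Lipschitz functions on the line -/

section LipschitzLine

variable {F : Type*} [NormedAddCommGroup F] [NormedSpace ℝ F] [FiniteDimensional ℝ F]
  [CompleteSpace F]

open scoped NNReal

/-! Let `e` be the size of the constraint defect. The strain has a representative `S` of size
`O(e)`, and the unit tangent has a representative `T` with bounds depending only on `K` and `L`. A
feasible curve is nothing but the primitive, starting at `D₀`, of a Lipschitz field `X` of unit
vectors with `X 0 = N₀`, `X L = N₁` and `∫ X = D₁ - D₀` (`exists_feasible`). So it suffices to
correct `T` to such an `X` at cost `O(e)`.

The ansatz is `X = normalize (T + v + ψ w)`. Here `v` interpolates the errors of the two boundary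
tangents, `ψ` is the bubble `t (L - t)`, and the vector `w` is the only unknown. Near `w = 0` the
derivative of `w ↦ ∫ X` is close to `∫ ψ (1 - T Tᵀ)`, which is coercive unless `T` stays nearly
parallel to one direction. The length condition excludes this: at nearly unit speed it forces `|∫ T|
≤ L (1 - 2δ)` with `δ` depending only on `η` (`IsRegularRep.norm_integral_tangent_le`). Hence the
map is strongly monotone and Lipschitz, and a contraction argument finds `w` of size `O(e)`
(`exists_coercive`, `exists_eq_of_strongly_monotone`, `exists_steering`).

Regularity is tracked in the class `LipBV`. It is stable under products and smooth compositions,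
with constants linear in the small factor, so that `X - T` and `X - e^S T` are both `O(e)` in it
(`exists_correction`). The second field is the derivative of the displacement, and one integration
gives proximity in `TV^3` (`tvNorm_three_le`). The two energies are half the integrals of `|X'|²`
and of `e^{-S} |T'|²`, which differ by `O(e)` (`abs_bendingEnergy_sub_le`). -/

theorem LipschitzWith.locallyIntegrable_deriv {C : ℝ≥0} {f : ℝ → F} (hf : LipschitzWith C f) :
    LocallyIntegrable (deriv f) volume := by
  borelize F
  have h1 : AEStronglyMeasurable (deriv f) volume := (stronglyMeasurable_deriv f).aestronglyMeasurable
  refine (locallyIntegrable_const (C : ℝ)).mono h1 (Filter.Eventually.of_forall fun t => ?_)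
  simpa using norm_deriv_le_of_lipschitz hf

omit [FiniteDimensional ℝ F] [CompleteSpace F] in
theorem lipschitzWith_intervalIntegral {B : ℝ≥0} {g : ℝ → F} (hg : LocallyIntegrable g volume)
    (hB : ∀ᵐ t, ‖g t‖ ≤ B) (c : ℝ) : LipschitzWith B fun t => ∫ s in c..t, g s := by
  have hii : ∀ a b, IntervalIntegrable g volume a b := fun a b => intervalIntegrable_iff.mpr <|
      (hg.integrableOn_isCompact isCompact_uIcc).mono_set uIoc_subset_uIcc
  refine LipschitzWith.of_dist_le_mul fun s t => ?_
  rw [dist_eq_norm, intervalIntegral.integral_interval_sub_left (hii _ _) (hii _ _), Real.dist_eq]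
  exact intervalIntegral.norm_integral_le_of_norm_le_const_ae (hB.mono fun t ht _ => ht)

/-- `f` minus the primitive of its derivative is absolutely continuous with derivative zero almost
everywhere, hence constant. -/
theorem LipschitzWith.intervalIntegral_deriv_eq_sub {C : ℝ≥0} {f : ℝ → F} (hf : LipschitzWith C f)
    (a b : ℝ) : ∫ t in a..b, deriv f t = f b - f a := by
  have hi := hf.locallyIntegrable_deriv
  have hac : AbsolutelyContinuousOnInterval (f - fun x => ∫ (t : ℝ) in a..x, deriv f t) a b :=
    (hf.lipschitzOnWith (s := uIcc a b)).absolutelyContinuousOnInterval.sub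
      ((lipschitzWith_intervalIntegral hi (Filter.Eventually.of_forall fun t =>
        norm_deriv_le_of_lipschitz hf) a).lipschitzOnWith
        (s := uIcc a b)).absolutelyContinuousOnInterval
  have h0 : ∀ᵐ x, x ∈ uIcc a b →
      HasDerivAt (f - fun x => ∫ (t : ℝ) in a..x, deriv f t) 0 x := by
    filter_upwards [hf.ae_differentiableAt_real, _root_.LocallyIntegrable.ae_hasDerivAt_integral hi]
      with x h1 h2 _
    have := h1.hasDerivAt.sub (h2 a)
    rwa [sub_self] at this
  obtain ⟨c, hc⟩ := hac.const_of_ae_hasDerivAt_zero h0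
  have ha := hc a (by simp)
  have hb := hc b (by simp)
  simp only [Pi.sub_apply, intervalIntegral.integral_same, sub_zero] at ha hb
  rw [ha, ← hb]; abel

end LipschitzLine

/-! ### Weak derivatives and continuous representatives -/

section WeakDerivatives

variable {F : Type*} [NormedAddCommGroup F] [InnerProductSpace ℝ F] {L : ℝ}

theorem TestFunction.apply_eq_zero {φ : 𝓓(openInterval L, F)} {t : ℝ} (ht : t ∉ Ioo 0 L) :
    φ t = 0 := by
  by_contra h
  exact ht (φ.tsupport_subset (subset_tsupport _ h))

theorem TestFunction.integrable_smul_sigma {G : Type*} [NormedAddCommGroup G] [NormedSpace ℝ G]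
    {f : ℝ → G} (hf : Integrable f (sigmaMeasure L)) {p : ℝ → ℝ} (hp : Continuous p)
    (hc : HasCompactSupport p) : Integrable (fun t => p t • f t) (sigmaMeasure L) := by
  obtain ⟨C, hC⟩ := hp.bounded_above_of_compact_support hc
  exact hf.bdd_smul C hp.aestronglyMeasurable (Filter.Eventually.of_forall hC)

theorem TestFunction.continuous_deriv (φ : 𝓓(openInterval L, F)) : Continuous (deriv φ) :=
  φ.contDiff.continuous_deriv (by simp)

theorem setIntegral_eq_of_forall_notMem_Ioo {f : ℝ → F} (h : ∀ t, t ∉ Ioo 0 L → f t = 0) :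
    ∫ t, f t ∂(sigmaMeasure L) = ∫ t, f t := by
  apply setIntegral_eq_integral_of_forall_compl_eq_zero
  intro t ht
  exact h t fun h' => ht (Ioo_subset_Icc_self h')

theorem ae_sigmaMeasure_iff_Ioo {p : ℝ → Prop} :
    (∀ᵐ t ∂(sigmaMeasure L), p t) ↔ ∀ᵐ t, t ∈ Ioo 0 L → p t := by
  rw [sigmaMeasure, ← Measure.restrict_congr_set Ioo_ae_eq_Icc, ae_restrict_iff' measurableSet_Ioo]

theorem HasWeakDeriv.congr {f f' g g' : ℝ → F} (h : HasWeakDeriv L f g)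
    (hf : f =ᵐ[sigmaMeasure L] f') (hg : g =ᵐ[sigmaMeasure L] g') : HasWeakDeriv L f' g' := by
  refine ⟨h.1.congr hf, h.2.1.congr hg, fun φ => ?_⟩
  rw [← integral_congr_ae (hf.mono fun t ht => congrArg (deriv φ t • ·) ht), h.2.2 φ,
    integral_congr_ae (hg.mono fun t ht => congrArg (φ t • ·) ht)]

theorem ae_eq_zero_of_integral_testFunction_smul [FiniteDimensional ℝ F] [CompleteSpace F]
    {f : ℝ → F} (hf : Integrable f (sigmaMeasure L))
    (h : ∀ φ : 𝓓(openInterval L, ℝ), ∫ t, φ t • f t ∂(sigmaMeasure L) = 0) :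
    f =ᵐ[sigmaMeasure L] 0 := by
  refine ae_sigmaMeasure_iff_Ioo.2 ?_
  refine isOpen_Ioo.ae_eq_zero_of_integral_contDiff_smul_eq_zero
    ((IntegrableOn.mono_set (t := Icc 0 L) hf Ioo_subset_Icc_self).locallyIntegrableOn) ?_
  intro g hg hc hs
  let φ : 𝓓(openInterval L, ℝ) := ⟨g, by simpa using hg, hc, hs⟩
  rw [← h φ]
  refine (setIntegral_eq_of_forall_notMem_Ioo fun t ht => ?_).symm
  have : g t = 0 := TestFunction.apply_eq_zero (φ := φ) ht
  rw [this, zero_smul]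

/-- Uniqueness makes the choice hidden in `weakDeriv` harmless. -/
theorem HasWeakDeriv.ae_eq [FiniteDimensional ℝ F] [CompleteSpace F] {f g g' : ℝ → F}
    (h : HasWeakDeriv L f g) (h' : HasWeakDeriv L f g') : g =ᵐ[sigmaMeasure L] g' := by
  have : (fun t => g t - g' t) =ᵐ[sigmaMeasure L] 0 := by
    refine ae_eq_zero_of_integral_testFunction_smul (h.2.1.sub h'.2.1) fun φ => ?_
    simp only [smul_sub]
    rw [integral_sub (TestFunction.integrable_smul_sigma h.2.1 φ.continuous φ.hasCompactSupport)
      (TestFunction.integrable_smul_sigma h'.2.1 φ.continuous φ.hasCompactSupport)]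
    have h1 := h.2.2 φ
    rw [h'.2.2 φ] at h1
    rw [neg_inj.1 h1, sub_self]
  filter_upwards [this] with t ht
  exact sub_eq_zero.1 ht

theorem WeaklyDifferentiable.hasWeakDeriv {f : ℝ → F} (h : WeaklyDifferentiable L f) :
    HasWeakDeriv L f (weakDeriv L f) := by
  rw [weakDeriv, dif_pos h]
  exact h.choose_spec

theorem HasWeakDeriv.weakDeriv_ae_eq [FiniteDimensional ℝ F] [CompleteSpace F] {f g : ℝ → F}
    (h : HasWeakDeriv L f g) : weakDeriv L f =ᵐ[sigmaMeasure L] g :=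
  (WeaklyDifferentiable.hasWeakDeriv ⟨g, h⟩).ae_eq h

theorem HasWeakDeriv.sub {f f' g g' : ℝ → F} (h : HasWeakDeriv L f g) (h' : HasWeakDeriv L f' g') :
    HasWeakDeriv L (f - f') (g - g') := by
  refine ⟨h.1.sub h'.1, h.2.1.sub h'.2.1, fun φ => ?_⟩
  simp only [Pi.sub_apply, smul_sub]
  rw [integral_sub (TestFunction.integrable_smul_sigma h.1 φ.continuous_deriv
      φ.hasCompactSupport.deriv)
    (TestFunction.integrable_smul_sigma h'.1 φ.continuous_deriv φ.hasCompactSupport.deriv),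
    integral_sub (TestFunction.integrable_smul_sigma h.2.1 φ.continuous φ.hasCompactSupport)
      (TestFunction.integrable_smul_sigma h'.2.1 φ.continuous φ.hasCompactSupport),
    h.2.2 φ, h'.2.2 φ]
  abel

/-- A compact subset of `(0, L)` lies in a compact interval inside `(0, L)`. -/
theorem exists_Icc_superset_of_isCompact (hL : 0 < L) {s : Set ℝ} (hs : IsCompact s)
    (h : s ⊆ Ioo 0 L) : ∃ a b, 0 < a ∧ b < L ∧ s ⊆ Icc a b := by
  rcases s.eq_empty_or_nonempty with rfl | hne
  · exact ⟨L / 2, L / 2, by linarith, by linarith, empty_subset _⟩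
  · obtain ⟨a, ha⟩ := hs.exists_isLeast hne
    obtain ⟨b, hb⟩ := hs.exists_isGreatest hne
    exact ⟨a, b, (h ha.1).1, (h hb.1).2, fun t ht => ⟨ha.2 ht, hb.2 ht⟩⟩

/-- A smooth function with compact support in `(0, L)` and mean value zero is the derivative of a
test function. -/
theorem exists_testFunction_deriv_eq (hL : 0 < L) {χ : ℝ → ℝ} (hχ : ContDiff ℝ ((⊤ : ℕ∞) : WithTop ℕ∞) χ)
    (hc : HasCompactSupport χ) (hs : tsupport χ ⊆ Ioo 0 L) (h0 : ∫ t, χ t = 0) :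
    ∃ φ : 𝓓(openInterval L, ℝ), deriv φ = χ ∧ ∀ t, φ t = ∫ s in 0..t, χ s := by
  obtain ⟨a, b, ha, hb, hab⟩ := exists_Icc_superset_of_isCompact hL hc hs
  have hz : ∀ t, t ∉ Icc a b → χ t = 0 := fun t ht =>
    image_eq_zero_of_notMem_tsupport fun h => ht (hab h)
  have hd : ∀ t, HasDerivAt (fun t => ∫ s in 0..t, χ s) (χ t) t := fun t =>
    (hχ.continuous.integral_hasStrictDerivAt 0 t).hasDerivAt
  have hdd : deriv (fun t => ∫ s in 0..t, χ s) = χ := funext fun t => (hd t).deriv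
  -- To the left of `a` nothing has been integrated yet; to the right of `b` the primitive has
  -- collected the whole integral, which is zero.
  have hsupp : ∀ t, t ∉ Icc a b → ∫ s in 0..t, χ s = 0 := by
    intro t ht
    by_cases hta : t < a
    · rw [intervalIntegral.integral_congr (g := fun _ => 0) fun s hs => ?_]
      · simp
      · apply hz
        rintro ⟨h1, h2⟩
        rcases le_max_iff.1 hs.2 with h | h <;> linarith
    · have htb : b < t := by
        by_contra h; exact ht ⟨not_lt.1 hta, not_lt.1 h⟩
      have h1 : ∫ s in Ioc 0 t, χ s = ∫ s, χ s := by
        apply setIntegral_eq_integral_of_forall_compl_eq_zero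
        intro s hs
        apply hz
        rintro ⟨h1, h2⟩
        exact hs ⟨by linarith, by linarith⟩
      by_cases h0t : 0 ≤ t
      · rw [intervalIntegral.integral_of_le h0t, h1, h0]
      · exact absurd hta (by push Not; linarith)
  refine ⟨⟨fun t => ∫ s in 0..t, χ s, ?_, ?_, ?_⟩, hdd, fun t => rfl⟩
  · have : ContDiff ℝ ((⊤ : ℕ∞) : WithTop ℕ∞) (fun t => ∫ s in 0..t, χ s) := by
      rw [contDiff_infty_iff_deriv]
      refine ⟨fun t => (hd t).differentiableAt, ?_⟩
      rw [hdd]; exact hχ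
    exact this
  · exact HasCompactSupport.intro isCompact_Icc hsupp
  · refine (closure_minimal (fun t ht => ?_) isClosed_Icc : tsupport _ ⊆ Icc a b).trans
      fun t ht => ⟨ha.trans_le ht.1, ht.2.trans_lt hb⟩
    by_contra h
    exact ht (hsupp t h)

/-- Du Bois-Reymond's argument: a test function minus its integral times a normalized bump has mean
zero, so it is the derivative of a test function and `f` annihilates it. Thus `f` pairs with every
test function like the constant `c`, its average against the bump. -/
theorem HasWeakDeriv.ae_eq_const_of_zero [FiniteDimensional ℝ F] [CompleteSpace F] (hL : 0 < L)
    {f : ℝ → F} (h : HasWeakDeriv L f 0) : ∃ c, f =ᵐ[sigmaMeasure L] fun _ => c := by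
  let η : ContDiffBump (L / 2) := ⟨L / 8, L / 4, by linarith, by linarith⟩
  have hηs : tsupport (η.normed volume) ⊆ Ioo 0 L := by
    rw [η.tsupport_normed_eq, Real.closedBall_eq_Icc]
    exact fun t ht => ⟨by linarith [ht.1, show η.rOut = L / 4 from rfl],
      by linarith [ht.2, show η.rOut = L / 4 from rfl]⟩
  have hηc : HasCompactSupport (η.normed volume) := η.hasCompactSupport_normed
  have hηd : ContDiff ℝ ((⊤ : ℕ∞) : WithTop ℕ∞) (η.normed volume) := η.contDiff_normed
  refine ⟨∫ t, η.normed volume t • f t ∂(sigmaMeasure L), ?_⟩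
  set c := ∫ t, η.normed volume t • f t ∂(sigmaMeasure L) with hc
  have hconst : Integrable (fun _ : ℝ => c) (sigmaMeasure L) := integrable_const _
  have : (fun t => f t - c) =ᵐ[sigmaMeasure L] 0 := by
    refine ae_eq_zero_of_integral_testFunction_smul (h.1.sub hconst) fun φ => ?_
    set A := ∫ t, φ t with hA
    have hφi : Integrable φ volume := φ.continuous.integrable_of_hasCompactSupport φ.hasCompactSupport
    have hηi : Integrable (η.normed volume) volume := η.integrable_normed
    obtain ⟨ψ, hψ, -⟩ := exists_testFunction_deriv_eq hL
      (χ := fun t => φ t - A * η.normed volume t)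
      ((show ContDiff ℝ ((⊤ : ℕ∞) : WithTop ℕ∞) φ from φ.contDiff).sub (contDiff_const.mul hηd))
      (φ.hasCompactSupport.sub (hηc.mul_left))
      (by
        refine (tsupport_sub _ _).trans (union_subset φ.tsupport_subset ?_)
        exact (tsupport_mul_subset_right).trans hηs)
      (by
        rw [integral_sub hφi (hηi.const_mul A), integral_const_mul, η.integral_normed]
        simp [hA])
    have h1 := h.2.2 ψ
    rw [hψ] at h1
    simp only [Pi.zero_apply, smul_zero, integral_zero, neg_zero, sub_smul, mul_smul] at h1
    have i1 := TestFunction.integrable_smul_sigma h.1 φ.continuous φ.hasCompactSupport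
    have i2 := TestFunction.integrable_smul_sigma h.1 hηd.continuous hηc
    have i3 := TestFunction.integrable_smul_sigma hconst φ.continuous φ.hasCompactSupport
    rw [integral_sub i1 (show Integrable (fun t => A • η.normed volume t • f t) _ from i2.smul A),
      integral_smul] at h1
    simp only [smul_sub]
    rw [integral_sub i1 i3, integral_smul_const, setIntegral_eq_of_forall_notMem_Ioo
      fun t ht => TestFunction.apply_eq_zero ht]
    exact h1
  filter_upwards [this] with t ht
  exact sub_eq_zero.1 ht

open scoped NNReal

theorem TestFunction.exists_lipschitzWith_smul (φ : 𝓓(openInterval L, ℝ)) {C : ℝ≥0} {f : ℝ → F}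
    (hf : LipschitzWith C f) : ∃ C' : ℝ≥0, LipschitzWith C' fun t => φ t • f t := by
  obtain ⟨M, hM⟩ := (isCompact_Icc (a := (0 : ℝ)) (b := L)).exists_bound_of_continuousOn
    hf.continuous.continuousOn
  obtain ⟨D, hD⟩ := φ.continuous_deriv.bounded_above_of_compact_support φ.hasCompactSupport.deriv
  obtain ⟨P, hP⟩ := φ.continuous.bounded_above_of_compact_support φ.hasCompactSupport
  have h0 : ∀ t, t ∉ Icc 0 L → φ t = 0 := fun t ht =>
    TestFunction.apply_eq_zero fun h => ht (Ioo_subset_Icc_self h)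
  have hφl : ∀ s t, ‖φ s - φ t‖ ≤ D * |s - t| := fun s t =>
    Convex.norm_image_sub_le_of_norm_deriv_le (s := univ)
      (fun x _ => (φ.contDiff.differentiable (by simp)).differentiableAt) (fun x _ => hD x)
      convex_univ (mem_univ _) (mem_univ _)
  have hD0 : 0 ≤ D := (norm_nonneg _).trans (hD 0)
  have hP0 : 0 ≤ P := (norm_nonneg _).trans (hP 0)
  -- `f` may be unbounded on the line, so one of the two points has to lie in `[0, L]`. If neither
  -- does, the product vanishes at both.
  have key : ∀ s t, s ∈ Icc 0 L → ‖φ s • f s - φ t • f t‖ ≤ (D * M + P * C) * |s - t| := by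
    intro s t hs
    have : φ s • f s - φ t • f t = (φ s - φ t) • f s + φ t • (f s - f t) := by
      simp only [sub_smul, smul_sub]; abel
    rw [this]
    refine (norm_add_le _ _).trans ?_
    rw [norm_smul, norm_smul, add_mul]
    have hl := hf.dist_le_mul s t
    rw [dist_eq_norm, Real.dist_eq] at hl
    gcongr ?_ + ?_
    · calc ‖φ s - φ t‖ * ‖f s‖ ≤ (D * |s - t|) * M :=
            mul_le_mul (hφl s t) (hM s hs) (norm_nonneg _) (by positivity)
        _ = D * M * |s - t| := by ring
    · calc ‖φ t‖ * ‖f s - f t‖ ≤ P * (C * |s - t|) :=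
            mul_le_mul (hP t) hl (norm_nonneg _) hP0
        _ = P * C * |s - t| := by ring
  refine ⟨(D * M + P * C).toNNReal, LipschitzWith.of_dist_le_mul fun s t => ?_⟩
  rw [dist_eq_norm, Real.dist_eq]
  by_cases hs : s ∈ Icc 0 L
  · exact (key s t hs).trans (by gcongr; exact Real.le_coe_toNNReal _)
  · by_cases ht : t ∈ Icc 0 L
    · rw [norm_sub_rev, abs_sub_comm]
      exact (key t s ht).trans (by gcongr; exact Real.le_coe_toNNReal _)
    · rw [h0 s hs, h0 t ht]; simp; positivity

/-- The product `φ f` is Lipschitz and vanishes at both end points, so its derivative has integral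
zero; the product rule holds almost everywhere. -/
theorem LipschitzWith.hasWeakDeriv [FiniteDimensional ℝ F] [CompleteSpace F] (hL : 0 < L) {C : ℝ≥0}
    {f : ℝ → F} (hf : LipschitzWith C f) : HasWeakDeriv L f (deriv f) := by
  have hfi : Integrable f (sigmaMeasure L) := hf.continuous.continuousOn.integrableOn_Icc
  have hdi : Integrable (deriv f) (sigmaMeasure L) :=
    hf.locallyIntegrable_deriv.integrableOn_isCompact isCompact_Icc
  refine ⟨hfi, hdi, fun φ => ?_⟩
  have i1 := TestFunction.integrable_smul_sigma hfi φ.continuous_deriv φ.hasCompactSupport.deriv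
  have i2 := TestFunction.integrable_smul_sigma hdi φ.continuous φ.hasCompactSupport
  rw [eq_neg_iff_add_eq_zero, ← integral_add i1 i2]
  have h0 : ∀ t, t ∉ Ioo 0 L → φ t = 0 := fun t => TestFunction.apply_eq_zero
  obtain ⟨C', hC'⟩ := TestFunction.exists_lipschitzWith_smul φ hf
  have := hC'.intervalIntegral_deriv_eq_sub 0 L
  rw [h0 0 (by simp), h0 L (by simp), zero_smul, zero_smul, sub_zero,
    intervalIntegral.integral_of_le hL.le, ← integral_Icc_eq_integral_Ioc] at this
  rw [← this]
  refine integral_congr_ae (ae_restrict_of_ae ?_)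
  filter_upwards [hf.ae_differentiableAt_real] with t ht
  have h3 : HasDerivAt φ (deriv φ t) t := ((φ.contDiff.differentiable (by simp)) t).hasDerivAt
  rw [add_comm]
  exact (h3.smul ht.hasDerivAt).deriv.symm

/-- A function with a bounded weak derivative has a Lipschitz representative, which is constant to
the left and to the right of `[0, L]`. -/
theorem HasWeakDeriv.exists_lipschitz [FiniteDimensional ℝ F] [CompleteSpace F] (hL : 0 < L)
    {f g : ℝ → F} (h : HasWeakDeriv L f g) {B : ℝ≥0} (hB : ∀ᵐ t ∂(sigmaMeasure L), ‖g t‖ ≤ B) :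
    ∃ f' : ℝ → F, LipschitzWith B f' ∧ f =ᵐ[sigmaMeasure L] f' ∧
      deriv f' =ᵐ[sigmaMeasure L] g ∧ ∀ t, f' (max 0 (min L t)) = f' t := by
  -- Extension by zero makes the primitive constant outside `[0, L]`, so that bounds on `[0, L]`
  -- carry over to the whole line.
  set G := (Icc 0 L).indicator g with hG
  have hGi : Integrable G volume := (integrable_indicator_iff measurableSet_Icc).2 h.2.1
  have hGB : ∀ᵐ t, ‖G t‖ ≤ B := by
    filter_upwards [(ae_restrict_iff' measurableSet_Icc).1 hB] with t ht
    by_cases h : t ∈ Icc 0 L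
    · rw [hG, indicator_of_mem h]; exact ht h
    · rw [hG, indicator_of_notMem h]; simp
  have hii : ∀ a b, IntervalIntegrable G volume a b := fun a b => hGi.intervalIntegrable
  set p : ℝ → F := fun t => ∫ s in 0..t, G s with hp
  have hlip : LipschitzWith B p := lipschitzWith_intervalIntegral hGi.locallyIntegrable hGB 0
  have hder : deriv p =ᵐ[sigmaMeasure L] g := by
    filter_upwards [ae_restrict_of_ae 
      (_root_.LocallyIntegrable.ae_hasDerivAt_integral hGi.locallyIntegrable),
      ae_restrict_mem measurableSet_Icc] with t ht htI
    rw [(ht 0).deriv, hG, indicator_of_mem htI]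
  have hw := h.sub ((hlip.hasWeakDeriv hL).congr Filter.EventuallyEq.rfl hder)
  rw [sub_self] at hw
  obtain ⟨c, hc⟩ := hw.ae_eq_const_of_zero hL
  refine ⟨fun t => c + p t, ?_, ?_, ?_, ?_⟩
  · refine LipschitzWith.of_dist_le_mul fun s t => ?_
    rw [dist_add_left]
    exact hlip.dist_le_mul s t
  · filter_upwards [hc] with t ht
    rw [← ht]; simp
  · filter_upwards [hder] with t ht
    rw [deriv_const_add, ht]
  · intro t
    refine congrArg (c + ·) ?_
    rw [← sub_eq_zero, hp]
    simp only
    rw [intervalIntegral.integral_interval_sub_left (hii _ _) (hii _ _)]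
    apply intervalIntegral.integral_zero_ae
    have hne : ∀ᵐ s : ℝ, s ≠ 0 := by simp [ae_iff, measure_singleton]
    have hne' : ∀ᵐ s : ℝ, s ≠ L := by simp [ae_iff, measure_singleton]
    filter_upwards [hne, hne'] with s hs hs' hst
    rw [hG, indicator_of_notMem]
    rintro ⟨h1, h2⟩
    have h1' : 0 < s := lt_of_le_of_ne h1 (Ne.symm hs)
    have h2' : s < L := lt_of_le_of_ne h2 hs'
    rw [mem_uIoc] at hst
    rcases le_total L t with h | h <;> rcases le_total t 0 with h' | h' <;>
      simp_all <;> grind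

omit [InnerProductSpace ℝ F] in
theorem eqOn_of_ae_eq_of_continuousOn (hL : 0 < L) {f g : ℝ → F} (hf : ContinuousOn f (Icc 0 L))
    (hg : ContinuousOn g (Icc 0 L)) (h : f =ᵐ[sigmaMeasure L] g) : EqOn f g (Icc 0 L) :=
  Measure.eqOn_Icc_of_ae_eq volume hL.ne h hf hg

omit [InnerProductSpace ℝ F] in
theorem contRep_eqOn (hL : 0 < L) {f g : ℝ → F} (hg : ContinuousOn g (Icc 0 L))
    (h : f =ᵐ[sigmaMeasure L] g) : EqOn (contRep L f) g (Icc 0 L) := by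
  have hex : ∃ g : ℝ → F, ContinuousOn g (Icc 0 L) ∧ f =ᵐ[sigmaMeasure L] g := ⟨g, hg, h⟩
  rw [contRep, dif_pos hex]
  exact eqOn_of_ae_eq_of_continuousOn hL hex.choose_spec.1 hg (hex.choose_spec.2.symm.trans h)

end WeakDerivatives

/-! ### Total variation -/

section TotalVariation

open scoped NNReal Topology Convolution
open Filter

variable {L : ℝ}

theorem totalVariation_le_iff {F : Type*} [NormedAddCommGroup F] [InnerProductSpace ℝ F]
    {f : ℝ → F} {V : ℝ} (hV : 0 ≤ V) : totalVariation L f ≤ ENNReal.ofReal V ↔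
      ∀ φ : 𝓓(openInterval L, F), (∀ t, ‖φ t‖ ≤ 1) →
        ∫ t, inner ℝ (f t) (deriv φ t) ∂(sigmaMeasure L) ≤ V := by
  simp only [totalVariation, iSup_le_iff, ENNReal.ofReal_le_ofReal_iff hV]

theorem totalVariation_real_le_iff {f : ℝ → ℝ} {V : ℝ} (hV : 0 ≤ V) :
    totalVariation L f ≤ ENNReal.ofReal V ↔ ∀ φ : 𝓓(openInterval L, ℝ), (∀ t, |φ t| ≤ 1) →
      ∫ t, f t * deriv φ t ∂(sigmaMeasure L) ≤ V := by
  rw [totalVariation_le_iff hV]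
  have : ∀ (φ : 𝓓(openInterval L, ℝ)) t, inner ℝ (f t) (deriv φ t) = f t * deriv φ t := by
    intro φ t; simp [mul_comm]
  simp only [this, Real.norm_eq_abs]

theorem totalVariation_congr {F : Type*} [NormedAddCommGroup F] [InnerProductSpace ℝ F]
    {f g : ℝ → F} (h : f =ᵐ[sigmaMeasure L] g) : totalVariation L f = totalVariation L g := by
  unfold totalVariation
  congr! 4 with φ
  exact integral_congr_ae (h.mono fun t ht => by simp only [ht])

theorem TestFunction.integrable_mul_deriv {g : ℝ → ℝ} (hg : Integrable g (sigmaMeasure L))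
    (φ : 𝓓(openInterval L, ℝ)) : Integrable (fun t => g t * deriv φ t) (sigmaMeasure L) := by
  simpa [mul_comm] using TestFunction.integrable_smul_sigma hg φ.continuous_deriv
    φ.hasCompactSupport.deriv

theorem totalVariation_add_le {f g : ℝ → ℝ} (hf : Integrable f (sigmaMeasure L))
    (hg : Integrable g (sigmaMeasure L)) {V W : ℝ} (hV0 : 0 ≤ V) (hW0 : 0 ≤ W)
    (hV : totalVariation L f ≤ ENNReal.ofReal V) (hW : totalVariation L g ≤ ENNReal.ofReal W) :
    totalVariation L (fun t => f t + g t) ≤ ENNReal.ofReal (V + W) := by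
  rw [totalVariation_real_le_iff (by positivity)]
  intro φ hφ
  simp only [add_mul]
  rw [integral_add (TestFunction.integrable_mul_deriv hf φ) (TestFunction.integrable_mul_deriv hg φ)]
  exact add_le_add ((totalVariation_real_le_iff hV0).1 hV φ hφ)
    ((totalVariation_real_le_iff hW0).1 hW φ hφ)

theorem totalVariation_const_le (hL : 0 < L) (c : ℝ) {V : ℝ} (hV : 0 ≤ V) :
    totalVariation L (fun _ => c) ≤ ENNReal.ofReal V := by
  rw [totalVariation_real_le_iff hV]
  intro φ _
  have h := (LipschitzWith.const (α := ℝ) c).hasWeakDeriv hL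
  have h2 := h.2.2 φ
  simp only [deriv_const', smul_eq_mul, mul_zero, integral_zero, neg_zero] at h2
  simp only [mul_comm c, h2, hV]

theorem integral_mul_deriv_testFunction_le {g : ℝ → ℝ} {V : ℝ} (hV0 : 0 ≤ V)
    (hV : totalVariation L g ≤ ENNReal.ofReal V) {c : ℝ} (φ : 𝓓(openInterval L, ℝ))
    (hφ : ∀ t, |φ t| ≤ c) : ∫ t, g t * deriv φ t ∂(sigmaMeasure L) ≤ V * c := by
  have hc0 : 0 ≤ c := (abs_nonneg _).trans (hφ 0)
  rcases hc0.eq_or_lt with rfl | hc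
  · have : (φ : ℝ → ℝ) = fun _ => 0 := funext fun t => abs_nonpos_iff.1 (hφ t)
    simp [this]
  · have h := (totalVariation_real_le_iff hV0).1 hV (c⁻¹ • φ) fun t => by
      show |c⁻¹ * φ t| ≤ 1
      rw [abs_mul, abs_of_pos (inv_pos.2 hc), inv_mul_le_iff₀ hc, mul_one]
      exact hφ t
    have hd : deriv (c⁻¹ • φ : 𝓓(openInterval L, ℝ)) = fun t => c⁻¹ * deriv φ t := by
      funext t
      exact deriv_const_mul c⁻¹ ((φ.contDiff.differentiable (by simp)) t)
    rw [hd] at h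
    have e : ∀ t, g t * (c⁻¹ * deriv φ t) = c⁻¹ * (g t * deriv φ t) := fun t => by ring
    simp only [e, integral_const_mul] at h
    rw [inv_mul_le_iff₀ hc] at h
    linarith

/-- Bump functions with radii tending to zero. -/
noncomputable def shrinkingBump {δ : ℝ} (hδ : 0 < δ) (n : ℕ) : ContDiffBump (0 : ℝ) :=
  ⟨δ / (n + 1) / 2, δ / (n + 1), by positivity, by
    have : 0 < δ / (n + 1) := by positivity
    linarith⟩

theorem shrinkingBump_rOut {δ : ℝ} (hδ : 0 < δ) (n : ℕ) :
    (shrinkingBump hδ n).rOut = δ / (n + 1) := rfl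

theorem shrinkingBump_rOut_le {δ : ℝ} (hδ : 0 < δ) (n : ℕ) : (shrinkingBump hδ n).rOut ≤ δ := by
  rw [shrinkingBump_rOut]
  exact div_le_self hδ.le (by linarith [(Nat.cast_nonneg n : (0 : ℝ) ≤ n)])

theorem tendsto_shrinkingBump_rOut {δ : ℝ} (hδ : 0 < δ) :
    Tendsto (fun n => (shrinkingBump hδ n).rOut) atTop (𝓝 0) := by
  have := (tendsto_one_div_add_atTop_nhds_zero_nat (𝕜 := ℝ)).const_mul δ
  simpa [shrinkingBump_rOut, div_eq_mul_inv] using this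

theorem ae_tendsto_shrinkingBump_convolution {δ : ℝ} (hδ : 0 < δ) {g : ℝ → ℝ}
    (hg : LocallyIntegrable g volume) : ∀ᵐ t, Tendsto (fun n =>
      ∫ s, (shrinkingBump hδ n).normed volume s * g (t - s)) atTop (𝓝 (g t)) := by
  have := ContDiffBump.ae_convolution_tendsto_right_of_locallyIntegrable (K := 2) (μ := volume)
    (tendsto_shrinkingBump_rOut hδ)
    (Eventually.of_forall fun n => by
      have : (shrinkingBump hδ n).rIn = (shrinkingBump hδ n).rOut / 2 := rfl
      rw [this]; linarith) hg
  exact this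

/-- The derivative is put on `ζ` rather than on the kernel: for a normalized bump it then inherits
the bound `C` and converges to `deriv ζ` almost everywhere as the bump shrinks. -/
theorem LipschitzWith.hasDerivAt_convolution_left {ρ : ℝ → ℝ} (hρ : Continuous ρ)
    (hρc : HasCompactSupport ρ) {C : ℝ≥0} {ζ : ℝ → ℝ} (hζ : LipschitzWith C ζ) (t : ℝ) :
    HasDerivAt (fun t => ∫ s, ρ s * ζ (t - s)) (∫ s, ρ s * deriv ζ (t - s)) t := by
  have hρi : Integrable ρ volume := hρ.integrable_of_hasCompactSupport hρc
  have hcont : ∀ x, Continuous fun s => ρ s * ζ (x - s) := fun x =>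
    hρ.mul (hζ.continuous.comp (continuous_const.sub continuous_id))
  refine (hasDerivAt_integral_of_dominated_loc_of_lip (F := fun x s => ρ s * ζ (x - s))
    (F' := fun s => ρ s * deriv ζ (t - s)) (s := univ) (bound := fun s => C * |ρ s|) univ_mem
    (Eventually.of_forall fun x => (hcont x).aestronglyMeasurable)
    ((hcont t).integrable_of_hasCompactSupport hρc.mul_right)
    (hρ.aestronglyMeasurable.mul
      ((measurable_deriv ζ).comp (measurable_const.sub measurable_id)).aestronglyMeasurable)
    ?_ (hρi.abs.const_mul _) ?_).2
  · refine Eventually.of_forall fun s => LipschitzOnWith.of_dist_le_mul fun x _ y _ => ?_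
    have h := hζ.dist_le_mul (x - s) (y - s)
    rw [dist_sub_right] at h
    rw [Real.dist_eq, ← mul_sub, abs_mul, ← Real.dist_eq]
    have : ((Real.nnabs (C * |ρ s|) : ℝ≥0) : ℝ) = C * |ρ s| := by
      simp
    rw [this]
    calc |ρ s| * dist (ζ (x - s)) (ζ (y - s)) ≤ |ρ s| * (C * dist x y) := by gcongr
      _ = _ := by ring
  · have h1 : ∀ᵐ s, DifferentiableAt ℝ ζ (t - s) :=
      (Measure.measurePreserving_sub_left volume t).quasiMeasurePreserving.ae hζ.ae_differentiableAt_real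
    filter_upwards [h1] with s hs
    have h2 : HasDerivAt (fun x => ζ (x - s)) (deriv ζ (t - s)) t := by
      simpa using hs.hasDerivAt.comp_sub_const t s
    exact h2.const_mul (ρ s)

theorem ContDiffBump.abs_integral_normed_mul_le (ρ : ContDiffBump (0 : ℝ)) {f : ℝ → ℝ} {c : ℝ}
    (hf : ∀ t, |f t| ≤ c) (t : ℝ) : |∫ s, ρ.normed volume s * f (t - s)| ≤ c := by
  have h : ‖∫ s, ρ.normed volume s * f (t - s)‖ ≤ ∫ s, ρ.normed volume s * c := by
    refine norm_integral_le_of_norm_le (ρ.integrable_normed.mul_const c)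
      (Eventually.of_forall fun s => ?_)
    rw [norm_mul, Real.norm_of_nonneg (ρ.nonneg_normed s)]
    exact mul_le_mul_of_nonneg_left (hf _) (ρ.nonneg_normed s)
  rwa [integral_mul_const, ρ.integral_normed, one_mul] at h

/-- The duality estimate defining the total variation holds for Lipschitz test functions. -/
theorem integral_mul_deriv_lipschitz_le (hL : 0 < L) {g : ℝ → ℝ} {V : ℝ}
    (hg : Integrable g (sigmaMeasure L)) (hV0 : 0 ≤ V)
    (hV : totalVariation L g ≤ ENNReal.ofReal V) {ζ : ℝ → ℝ} {C : ℝ≥0} (hζ : LipschitzWith C ζ)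
    (hζs : HasCompactSupport ζ) (hζt : tsupport ζ ⊆ Ioo 0 L) {c : ℝ} (hc : ∀ t, |ζ t| ≤ c) :
    ∫ t, g t * deriv ζ t ∂(sigmaMeasure L) ≤ V * c := by
  obtain ⟨a, b, ha, hb, hab⟩ := exists_Icc_superset_of_isCompact hL hζs hζt
  -- The mollification radius stays below the distance of the support to the end points, so that the
  -- mollified functions are admissible test functions.
  obtain ⟨δ, hδ, hδa, hδb⟩ : ∃ δ, 0 < δ ∧ δ < a ∧ δ < L - b :=
    ⟨min a (L - b) / 2, by have : 0 < min a (L - b) := lt_min ha (by linarith)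
                           linarith,
      by have : 0 < min a (L - b) := lt_min ha (by linarith)
         linarith [min_le_left a (L - b)],
      by have : 0 < min a (L - b) := lt_min ha (by linarith)
         linarith [min_le_right a (L - b)]⟩
  set ρ := shrinkingBump hδ with hρ
  have hsupp : ∀ n t, t ∉ Icc (a - δ) (b + δ) →
      ∫ s, (ρ n).normed volume s * ζ (t - s) = 0 := by
    intro n t ht
    have : ∀ s, (ρ n).normed volume s * ζ (t - s) = 0 := by
      intro s
      by_contra h
      have h1 : s ∈ Function.support ((ρ n).normed volume) := left_ne_zero_of_mul h
      rw [(ρ n).support_normed_eq, Metric.mem_ball, dist_zero_right, Real.norm_eq_abs] at h1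
      have h2 := hab (subset_tsupport _ (right_ne_zero_of_mul h))
      have h3 := abs_lt.1 (h1.trans_le (shrinkingBump_rOut_le hδ n))
      exact ht ⟨by linarith [h2.1, h3.1], by linarith [h2.2, h3.2]⟩
    simp [this]
  let φ : ℕ → 𝓓(openInterval L, ℝ) := fun n =>
    { toFun := fun t => ∫ s, (ρ n).normed volume s * ζ (t - s)
      contDiff' := HasCompactSupport.contDiff_convolution_left
        (ContinuousLinearMap.lsmul ℝ ℝ) (μ := volume) (ρ n).hasCompactSupport_normed
        (ρ n).contDiff_normed hζ.continuous.locallyIntegrable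
      hasCompactSupport' := HasCompactSupport.intro isCompact_Icc (hsupp n)
      tsupport_subset' := by
        refine (closure_minimal (fun t ht => ?_) isClosed_Icc :
          tsupport _ ⊆ Icc (a - δ) (b + δ)).trans
          fun t ht => ⟨by linarith [ht.1], by linarith [ht.2]⟩
        by_contra h
        exact ht (hsupp n t h) }
  have hφd : ∀ n, deriv (φ n) = fun t => ∫ s, (ρ n).normed volume s * deriv ζ (t - s) := fun n =>
    funext fun t => (hζ.hasDerivAt_convolution_left ((ρ n).contDiff_normed (n := 0)).continuous
      (ρ n).hasCompactSupport_normed t).deriv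
  have hle : ∀ n, ∫ t, g t * deriv (φ n) t ∂(sigmaMeasure L) ≤ V * c := fun n =>
    integral_mul_deriv_testFunction_le hV0 hV (φ n)
      fun t => (ρ n).abs_integral_normed_mul_le hc t
  have hC : ∀ t, |deriv ζ t| ≤ C := fun t => norm_deriv_le_of_lipschitz hζ
  -- Mollification preserves the bound `c`, so each approximation obeys the estimate; dominated
  -- convergence with majorant `|g| C` passes to the limit.
  refine le_of_tendsto' (tendsto_integral_of_dominated_convergence (fun t => |g t| * C)
    (fun n => (TestFunction.integrable_mul_deriv hg (φ n)).1) (hg.abs.mul_const _)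
    (fun n => Eventually.of_forall fun t => ?_) ?_) hle
  · rw [norm_mul, Real.norm_eq_abs, hφd]
    exact mul_le_mul_of_nonneg_left ((ρ n).abs_integral_normed_mul_le hC t) (abs_nonneg _)
  · refine ae_restrict_of_ae ?_
    filter_upwards [ae_tendsto_shrinkingBump_convolution hδ hζ.locallyIntegrable_deriv] with t ht
    simp only [hφd]
    exact ht.const_mul (g t)

/-- The product rule for a Lipschitz function and a bounded function of bounded variation. -/
theorem totalVariation_mul_le (hL : 0 < L) {f g : ℝ → ℝ} {A G V : ℝ} {C : ℝ≥0}
    (hf : LipschitzWith C f) (hA : ∀ t, |f t| ≤ A) (hg : Integrable g (sigmaMeasure L))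
    (hG : ∀ᵐ t ∂(sigmaMeasure L), |g t| ≤ G) (hV0 : 0 ≤ V)
    (hV : totalVariation L g ≤ ENNReal.ofReal V) :
    totalVariation L (fun t => f t * g t) ≤ ENNReal.ofReal (V * A + L * (C * G)) := by
  have hA0 : 0 ≤ A := (abs_nonneg _).trans (hA 0)
  have hG0 : 0 ≤ G := by
    have hne : (sigmaMeasure L) ≠ 0 := by
      rw [Ne, Measure.restrict_eq_zero]; simp [hL]
    have := ae_neBot.2 hne
    obtain ⟨t, ht⟩ := hG.exists
    exact (abs_nonneg _).trans ht
  rw [totalVariation_real_le_iff (by positivity)]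
  intro φ hφ
  obtain ⟨C', hC'⟩ := TestFunction.exists_lipschitzWith_smul φ hf
  have h1 := integral_mul_deriv_lipschitz_le hL hg hV0 hV hC' (φ.hasCompactSupport.mul_right)
    ((tsupport_mul_subset_left).trans φ.tsupport_subset) (c := A) fun t => by
      rw [smul_eq_mul, abs_mul, ← one_mul A]
      exact mul_le_mul (hφ t) (hA t) (abs_nonneg _) zero_le_one
  have hCf : ∀ t, |deriv f t| ≤ C := fun t => norm_deriv_le_of_lipschitz hf
  have hfd : AEStronglyMeasurable (deriv f) (sigmaMeasure L) :=
    (measurable_deriv f).aestronglyMeasurable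
  have i1 : Integrable (fun t => g t * deriv (fun t => φ t • f t) t) (sigmaMeasure L) :=
    hg.mul_bdd (c := C') (measurable_deriv _).aestronglyMeasurable
      (Eventually.of_forall fun t => norm_deriv_le_of_lipschitz hC')
  have i2' : Integrable (fun t => φ t * g t) (sigmaMeasure L) :=
    TestFunction.integrable_smul_sigma hg φ.continuous φ.hasCompactSupport
  have i2 : Integrable (fun t => φ t * g t * deriv f t) (sigmaMeasure L) :=
    i2'.mul_bdd (c := C) hfd (Eventually.of_forall hCf)
  -- Integration by parts in disguise: `φ f` is a Lipschitz test function bounded by `A`, which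
  -- brings in `V * A`, and the remainder `φ g f'` is bounded pointwise.
  have heq : ∫ t, f t * g t * deriv φ t ∂(sigmaMeasure L) =
      (∫ t, g t * deriv (fun t => φ t • f t) t ∂(sigmaMeasure L)) -
        ∫ t, φ t * g t * deriv f t ∂(sigmaMeasure L) := by
    rw [← integral_sub i1 i2]
    refine integral_congr_ae (ae_restrict_of_ae ?_)
    filter_upwards [hf.ae_differentiableAt_real] with t ht
    have h3 : HasDerivAt φ (deriv φ t) t := ((φ.contDiff.differentiable (by simp)) t).hasDerivAt
    have h4 : deriv (fun t => φ t • f t) t = φ t • deriv f t + deriv φ t • f t :=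
      (h3.smul ht.hasDerivAt).deriv
    rw [h4]
    simp only [smul_eq_mul]
    ring
  have h2 : ‖∫ t, φ t * g t * deriv f t ∂(sigmaMeasure L)‖ ≤ L * (C * G) := by
    have := norm_integral_le_of_norm_le_const (μ := sigmaMeasure L) (C := C * G)
      (f := fun t => φ t * g t * deriv f t) (hG.mono fun t ht => by
        rw [norm_mul, norm_mul, Real.norm_eq_abs, Real.norm_eq_abs, Real.norm_eq_abs]
        calc |φ t| * |g t| * |deriv f t| ≤ 1 * G * C := by
              gcongr
              · exact hφ t
              · exact hCf t
          _ = C * G := by ring)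
    rw [mul_comm L]
    refine this.trans (le_of_eq ?_)
    simp [Measure.real, hL.le]
  rw [heq]
  have := abs_le.1 h2
  linarith [this.1]

/-- A function of bounded variation is bounded by its mean plus its total variation. -/
theorem ae_abs_le_of_totalVariation_le (hL : 0 < L) {g : ℝ → ℝ} {V : ℝ}
    (hg : Integrable g (sigmaMeasure L)) (hV0 : 0 ≤ V)
    (hV : totalVariation L g ≤ ENNReal.ofReal V) :
    ∀ᵐ t ∂(sigmaMeasure L), |g t| ≤ (∫ s, |g s| ∂(sigmaMeasure L)) / L + V := by
  set G := (Icc 0 L).indicator g with hG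
  have hGi : Integrable G volume := (integrable_indicator_iff measurableSet_Icc).2 hg
  have hGg : ∀ t ∈ Icc 0 L, G t = g t := fun t ht => indicator_of_mem ht g
  set ρ := shrinkingBump hL with hρ
  have hconv := ae_tendsto_shrinkingBump_convolution hL hGi.locallyIntegrable
  -- The difference of the mollified values at `s` and `t` is the pairing of `g` with `ρ (s - ·) - ρ
  -- (t - ·)`. This is the derivative of a smoothed signed indicator of the interval between the
  -- points, a test function bounded by one.
  have hpair : ∀ s t, s ∈ Ioo 0 L → t ∈ Ioo 0 L →
      Tendsto (fun n => ∫ r, (ρ n).normed volume r * G (s - r)) atTop (𝓝 (G s)) →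
      Tendsto (fun n => ∫ r, (ρ n).normed volume r * G (t - r)) atTop (𝓝 (G t)) →
      G s - G t ≤ V := by
    intro s t hs ht hcs hct
    refine le_of_tendsto (hcs.sub hct) ?_
    have hev : ∀ x ∈ Ioo 0 L, ∀ᶠ n in atTop, Metric.closedBall x (ρ n).rOut ⊆ Ioo 0 L := by
      intro x hx
      obtain ⟨ε, hε, hεs⟩ := Metric.isOpen_iff.1 isOpen_Ioo x hx
      filter_upwards [(tendsto_shrinkingBump_rOut hL).eventually_lt_const hε] with n hn
      exact (Metric.closedBall_subset_ball hn).trans hεs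
    filter_upwards [hev s hs, hev t ht] with n hns hnt
    have hswap : ∀ x, ∫ r, (ρ n).normed volume r * G (x - r) =
        ∫ r, (ρ n).normed volume (x - r) * G r := by
      intro x
      rw [← integral_sub_left_eq_self _ volume x]
      simp
    have hball : ∀ x r, (ρ n).normed volume (x - r) ≠ 0 → r ∈ Metric.closedBall x (ρ n).rOut := by
      intro x r h
      have h1 : x - r ∈ Function.support ((ρ n).normed volume) := h
      rw [(ρ n).support_normed_eq, Metric.mem_ball, dist_zero_right] at h1
      rw [Metric.mem_closedBall, dist_comm, dist_eq_norm]
      exact h1.le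
    have hcs : ∀ x, HasCompactSupport fun r => (ρ n).normed volume (x - r) := fun x =>
      HasCompactSupport.intro (isCompact_closedBall x (ρ n).rOut) fun r hr => by
        by_contra h; exact hr (hball x r h)
    have hts : ∀ x, tsupport (fun r => (ρ n).normed volume (x - r)) ⊆
        Metric.closedBall x (ρ n).rOut := fun x =>
      closure_minimal (fun r hr => hball x r hr) Metric.isClosed_closedBall
    have hcd : ∀ x, ContDiff ℝ ((⊤ : ℕ∞) : WithTop ℕ∞) fun r => (ρ n).normed volume (x - r) :=
      fun x => (ρ n).contDiff_normed.comp (contDiff_const.sub contDiff_id)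
    have hint : ∀ x, Integrable (fun r => (ρ n).normed volume (x - r)) volume := fun x =>
      (hcd x).continuous.integrable_of_hasCompactSupport (hcs x)
    have hone : ∀ x, ∫ r, (ρ n).normed volume (x - r) = 1 := fun x => by
      rw [integral_sub_left_eq_self (fun r => (ρ n).normed volume r) volume x, (ρ n).integral_normed]
    obtain ⟨φ, hφd, hφ⟩ := exists_testFunction_deriv_eq hL
      (χ := fun r => (ρ n).normed volume (s - r) - (ρ n).normed volume (t - r))
      ((hcd s).sub (hcd t)) ((hcs s).sub (hcs t))
      ((tsupport_sub _ _).trans (union_subset ((hts s).trans hns) ((hts t).trans hnt)))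
      (by rw [integral_sub (hint s) (hint t), hone, hone, sub_self])
    -- Each bump has partial integrals in `[0, 1]`, so their difference lies in `[-1, 1]`.
    have hbd : ∀ r, |φ r| ≤ 1 := by
      intro r
      by_cases hr : r ∈ Ioo 0 L
      · rw [hφ, intervalIntegral.integral_sub (hint s).intervalIntegrable
          (hint t).intervalIntegrable]
        have hb : ∀ x, (∫ q in 0..r, (ρ n).normed volume (x - q)) ∈ Icc (0 : ℝ) 1 := by
          intro x
          rw [intervalIntegral.integral_of_le hr.1.le]
          refine ⟨integral_nonneg fun q => (ρ n).nonneg_normed _, ?_⟩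
          rw [← hone x]
          exact setIntegral_le_integral (hint x)
            (Eventually.of_forall fun q => (ρ n).nonneg_normed _)
        have h1 := hb s
        have h2 := hb t
        rw [abs_le]
        constructor <;> linarith [h1.1, h1.2, h2.1, h2.2]
      · rw [TestFunction.apply_eq_zero hr]; simp
    have hfin := (totalVariation_real_le_iff hV0).1 hV φ hbd
    rw [hswap, hswap, ← integral_sub]
    · refine le_trans (le_of_eq ?_) hfin
      rw [hφd, ← integral_indicator measurableSet_Icc]
      congr 1
      funext r
      by_cases hr : r ∈ Icc 0 L
      · rw [indicator_of_mem hr, hGg r hr]; ring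
      · rw [indicator_of_notMem hr, hG, indicator_of_notMem hr]; ring
    · obtain ⟨M, hM⟩ := (hcd s).continuous.bounded_above_of_compact_support (hcs s)
      exact hGi.bdd_mul (c := M) (hcd s).continuous.aestronglyMeasurable (Eventually.of_forall hM)
    · obtain ⟨M, hM⟩ := (hcd t).continuous.bounded_above_of_compact_support (hcs t)
      exact hGi.bdd_mul (c := M) (hcd t).continuous.aestronglyMeasurable (Eventually.of_forall hM)
  have hae : ∀ᵐ t ∂(sigmaMeasure L), t ∈ Ioo 0 L ∧ G t = g t ∧
      Tendsto (fun n => ∫ r, (ρ n).normed volume r * G (t - r)) atTop (𝓝 (G t)) := by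
    rw [ae_sigmaMeasure_iff_Ioo]
    filter_upwards [hconv] with t ht htI
    exact ⟨htI, hGg t (Ioo_subset_Icc_self htI), ht⟩
  filter_upwards [hae] with s hs
  -- With `s` fixed, averaging this inequality over `t` replaces `|g t|` by the mean of `|g|`.
  have hst : ∀ᵐ t ∂(sigmaMeasure L), |g s| - V ≤ |g t| := by
    filter_upwards [hae] with t ht
    have h1 := hpair s t hs.1 ht.1 hs.2.2 ht.2.2
    have h2 := hpair t s ht.1 hs.1 ht.2.2 hs.2.2
    rw [hs.2.1, ht.2.1] at h1 h2
    have : |g s - g t| ≤ V := abs_le.2 ⟨by linarith, h1⟩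
    linarith [abs_sub_abs_le_abs_sub (g s) (g t)]
  have := integral_mono_ae (integrable_const _) hg.abs hst
  rw [integral_const, smul_eq_mul] at this
  have hreal : (sigmaMeasure L).real univ = L := by simp [Measure.real, hL.le]
  rw [hreal] at this
  rw [← sub_le_iff_le_add, le_div_iff₀ hL]
  linarith

end TotalVariation

/-! ### Total variation of vector fields through their components -/

section Components

variable {L : ℝ} {m : ℕ}

theorem totalVariation_component_le {g : ℝ → EuclideanSpace ℝ (Fin m)} {V : ℝ} (hV0 : 0 ≤ V)
    (hV : totalVariation L g ≤ ENNReal.ofReal V) (i : Fin m) :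
    totalVariation L (fun t => g t i) ≤ ENNReal.ofReal V := by
  rw [totalVariation_real_le_iff hV0]
  intro φ hφ
  have hd : ∀ t, HasDerivAt (fun t => φ t • EuclideanSpace.single i (1 : ℝ))
      (deriv φ t • EuclideanSpace.single i (1 : ℝ)) t := fun t =>
    (((φ.contDiff.differentiable (by simp)) t).hasDerivAt).smul_const _
  let ψ : 𝓓(openInterval L, EuclideanSpace ℝ (Fin m)) :=
    { toFun := fun t => φ t • EuclideanSpace.single i (1 : ℝ)
      contDiff' := φ.contDiff.smul contDiff_const
      hasCompactSupport' := φ.hasCompactSupport.smul_right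
      tsupport_subset' := (tsupport_smul_subset_left _ _).trans φ.tsupport_subset }
  have h := (totalVariation_le_iff hV0).1 hV ψ fun t => by
    show ‖φ t • EuclideanSpace.single i (1 : ℝ)‖ ≤ 1
    rw [norm_smul]; simpa using hφ t
  have hψ : ∀ t, deriv ψ t = deriv φ t • EuclideanSpace.single i (1 : ℝ) := fun t => (hd t).deriv
  refine le_trans (le_of_eq ?_) h
  congr 1
  funext t
  rw [hψ, inner_smul_right, EuclideanSpace.inner_single_right]
  simp [mul_comm]

theorem totalVariation_le_sum {g : ℝ → EuclideanSpace ℝ (Fin m)}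
    (hg : ∀ i, Integrable (fun t => g t i) (sigmaMeasure L)) {V : Fin m → ℝ} (hV0 : ∀ i, 0 ≤ V i)
    (hV : ∀ i, totalVariation L (fun t => g t i) ≤ ENNReal.ofReal (V i)) :
    totalVariation L g ≤ ENNReal.ofReal (∑ i, V i) := by
  rw [totalVariation_le_iff (Finset.sum_nonneg fun i _ => hV0 i)]
  intro φ hφ
  let ψ : Fin m → 𝓓(openInterval L, ℝ) := fun i =>
    { toFun := fun t => φ t i
      contDiff' := (EuclideanSpace.proj (𝕜 := ℝ) i).contDiff.comp φ.contDiff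
      hasCompactSupport' :=
        φ.hasCompactSupport.comp_left (g := fun v : EuclideanSpace ℝ (Fin m) => v i) rfl
      tsupport_subset' := (tsupport_comp_subset (g := fun v : EuclideanSpace ℝ (Fin m) => v i) rfl φ).trans
        φ.tsupport_subset }
  have hψ : ∀ i t, deriv (ψ i) t = deriv φ t i := fun i t =>
    ((EuclideanSpace.proj (𝕜 := ℝ) i).hasFDerivAt.comp_hasDerivAt t
      ((φ.contDiff.differentiable (by simp)) t).hasDerivAt).deriv
  have : ∀ t, inner ℝ (g t) (deriv φ t) = ∑ i, g t i * deriv (ψ i) t := fun t => by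
    simp [PiLp.inner_apply, hψ, mul_comm]
  simp only [this]
  rw [integral_finsetSum _ fun i _ => TestFunction.integrable_mul_deriv (hg i) (ψ i)]
  exact Finset.sum_le_sum fun i _ => (totalVariation_real_le_iff (hV0 i)).1 (hV i) (ψ i) fun t =>
    (PiLp.norm_apply_le (φ t) i).trans (hφ t)

end Components

/-! ### Lipschitz functions whose derivative has bounded variation -/

/-- `f` is bounded by `a`, Lipschitz with constant `a`, and the total variation of its derivative on
`(0, L)` is at most `a`. -/
structure LipBV (L a : ℝ) (f : ℝ → ℝ) : Prop where
  abs_le : ∀ t, |f t| ≤ a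
  lip : LipschitzWith a.toNNReal f
  tv : totalVariation L (deriv f) ≤ ENNReal.ofReal a

namespace LipBV

open scoped NNReal

variable {L a b : ℝ} {f g : ℝ → ℝ}

theorem nonneg (hf : LipBV L a f) : 0 ≤ a := (abs_nonneg _).trans (hf.abs_le 0)

theorem dist_le (hf : LipBV L a f) (s t : ℝ) : |f s - f t| ≤ a * |s - t| := by
  have := hf.lip.dist_le_mul s t
  rwa [Real.coe_toNNReal _ hf.nonneg] at this

theorem of_dist_le (h1 : ∀ t, |f t| ≤ a) (h2 : ∀ s t, |f s - f t| ≤ a * |s - t|)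
    (h3 : totalVariation L (deriv f) ≤ ENNReal.ofReal a) : LipBV L a f := by
  refine ⟨h1, LipschitzWith.of_dist_le_mul fun s t => ?_, h3⟩
  rw [Real.coe_toNNReal _ ((abs_nonneg _).trans (h1 0))]
  exact h2 s t

theorem mono (hf : LipBV L a f) (h : a ≤ b) : LipBV L b f :=
  ⟨fun t => (hf.abs_le t).trans h, hf.lip.weaken (Real.toNNReal_le_toNNReal h),
    hf.tv.trans (ENNReal.ofReal_le_ofReal h)⟩

theorem abs_deriv_le (hf : LipBV L a f) (t : ℝ) : |deriv f t| ≤ a := by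
  have := norm_deriv_le_of_lipschitz hf.lip (x₀ := t)
  rwa [Real.coe_toNNReal _ hf.nonneg] at this

theorem integrable_deriv (hf : LipBV L a f) : Integrable (deriv f) (sigmaMeasure L) :=
  hf.lip.locallyIntegrable_deriv.integrableOn_isCompact isCompact_Icc

theorem const (hL : 0 < L) (c : ℝ) : LipBV L |c| fun _ => c := by
  refine of_dist_le (fun t => le_rfl) (fun s t => by simp; positivity) ?_
  rw [deriv_const']
  exact totalVariation_const_le hL 0 (abs_nonneg c)

theorem add (hf : LipBV L a f) (hg : LipBV L b g) : LipBV L (a + b) fun t => f t + g t := by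
  refine of_dist_le (fun t => (abs_add_le _ _).trans (add_le_add (hf.abs_le t) (hg.abs_le t)))
    (fun s t => ?_) ?_
  · rw [add_sub_add_comm, add_mul]
    exact (abs_add_le _ _).trans (add_le_add (hf.dist_le s t) (hg.dist_le s t))
  · refine (totalVariation_congr (ae_restrict_of_ae ?_)).le.trans
      (totalVariation_add_le hf.integrable_deriv hg.integrable_deriv hf.nonneg hg.nonneg hf.tv hg.tv)
    filter_upwards [hf.lip.ae_differentiableAt_real, hg.lip.ae_differentiableAt_real] with t h1 h2
    exact (h1.hasDerivAt.add h2.hasDerivAt).deriv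

/-- Both `f g'` and `g f'` have variation at most `a b + L a b` by the product rule
`totalVariation_mul_le`; their sum gives the factor `2 + 2 L`, which also covers the Lipschitz
constant `2 a b`. -/
theorem mul (hL : 0 < L) (hf : LipBV L a f) (hg : LipBV L b g) :
    LipBV L ((2 + 2 * L) * (a * b)) fun t => f t * g t := by
  have ha := hf.nonneg
  have hb := hg.nonneg
  have hab : 0 ≤ a * b := by positivity
  have hLab : 0 ≤ L * (a * b) := by positivity
  refine of_dist_le (fun t => ?_) (fun s t => ?_) ?_
  · rw [abs_mul]
    exact (mul_le_mul (hf.abs_le t) (hg.abs_le t) (abs_nonneg _) ha).trans (by nlinarith)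
  · have e : f s * g s - f t * g t = f s * (g s - g t) + (f s - f t) * g t := by ring
    rw [e]
    refine (abs_add_le _ _).trans ?_
    rw [abs_mul, abs_mul]
    calc |f s| * |g s - g t| + |f s - f t| * |g t| ≤ a * (b * |s - t|) + (a * |s - t|) * b := by
          gcongr
          · exact hf.abs_le s
          · exact hg.dist_le s t
          · exact hf.dist_le s t
          · exact hg.abs_le t
      _ = 2 * (a * b) * |s - t| := by ring
      _ ≤ (2 + 2 * L) * (a * b) * |s - t| := by
          gcongr; linarith
  · have i1 : Integrable (fun t => f t * deriv g t) (sigmaMeasure L) :=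
      hg.integrable_deriv.bdd_mul (c := a) hf.lip.continuous.aestronglyMeasurable
        (Filter.Eventually.of_forall hf.abs_le)
    have i2 : Integrable (fun t => g t * deriv f t) (sigmaMeasure L) :=
      hf.integrable_deriv.bdd_mul (c := b) hg.lip.continuous.aestronglyMeasurable
        (Filter.Eventually.of_forall hg.abs_le)
    have t1 := totalVariation_mul_le hL hf.lip hf.abs_le hg.integrable_deriv
      (Filter.Eventually.of_forall hg.abs_deriv_le) hb hg.tv
    have t2 := totalVariation_mul_le hL hg.lip hg.abs_le hf.integrable_deriv
      (Filter.Eventually.of_forall hf.abs_deriv_le) ha hf.tv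
    rw [Real.coe_toNNReal _ ha] at t1
    rw [Real.coe_toNNReal _ hb] at t2
    refine (totalVariation_congr (ae_restrict_of_ae ?_)).le.trans
      ((totalVariation_add_le i1 i2 (by positivity) (by positivity) t1 t2).trans
        (ENNReal.ofReal_le_ofReal (by linarith)))
    filter_upwards [hf.lip.ae_differentiableAt_real, hg.lip.ae_differentiableAt_real] with t h1 h2
    exact (h1.hasDerivAt.mul h2.hasDerivAt).deriv.trans (by ring)

theorem const_mul (hL : 0 < L) (hf : LipBV L a f) (c : ℝ) :
    LipBV L ((2 + 2 * L) * (|c| * a)) fun t => c * f t := (const hL c).mul hL hf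

theorem neg (hL : 0 < L) (hf : LipBV L a f) : LipBV L ((2 + 2 * L) * a) fun t => -f t := by
  have := hf.const_mul hL (-1)
  simpa using this

theorem sub (hL : 0 < L) (hf : LipBV L a f) (hg : LipBV L b g) :
    LipBV L (a + (2 + 2 * L) * b) fun t => f t - g t := by
  simpa [sub_eq_add_neg] using hf.add (hg.neg hL)

theorem sum (hL : 0 < L) {ι : Type*} (s : Finset ι) {f : ι → ℝ → ℝ} (hf : ∀ i, LipBV L a (f i)) :
    LipBV L (s.card * a) fun t => ∑ i ∈ s, f i t := by
  classical
  induction s using Finset.induction_on with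
  | empty => simpa using const hL 0
  | insert i s his ih =>
    have := (hf i).add ih
    simp only [Finset.sum_insert his, Finset.card_insert_of_notMem his]
    refine this.mono (le_of_eq ?_)
    push_cast; ring

/-- The clamping of the real line to `[0, L]`. -/
theorem clamp (hL : 0 < L) : LipBV L (L + 1) fun t => max 0 (min L t) := by
  refine of_dist_le (fun t => ?_) (fun s t => ?_) ?_
  · rw [abs_of_nonneg (le_max_left _ _)]
    exact max_le (by linarith) ((min_le_left _ _).trans (by linarith))
  · have h1 : |max 0 (min L s) - max 0 (min L t)| ≤ |s - t| := by
      refine (abs_max_sub_max_le_max _ _ _ _).trans (max_le (by simp) ?_)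
      exact (abs_min_sub_min_le_max _ _ _ _).trans (max_le (by simp) le_rfl)
    nlinarith [abs_nonneg (s - t)]
  · refine (totalVariation_congr (g := fun _ => 1) ?_).le.trans
      (totalVariation_const_le hL 1 (by positivity))
    rw [Filter.EventuallyEq, ae_sigmaMeasure_iff_Ioo]
    refine Filter.Eventually.of_forall fun t ht => ?_
    have : (fun t => max 0 (min L t)) =ᶠ[nhds t] id := by
      filter_upwards [isOpen_Ioo.mem_nhds ht] with s hs
      rw [min_eq_right hs.2.le, max_eq_right hs.1.le]; rfl
    rw [this.deriv_eq]; simp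

/-- Composition with a twice differentiable function that vanishes at the origin. -/
theorem comp (hL : 0 < L) {r H : ℝ} {h h' h'' : ℝ → ℝ}
    (hh : ∀ x, |x| ≤ r → HasDerivAt h (h' x) x) (hh' : ∀ x, |x| ≤ r → HasDerivAt h' (h'' x) x)
    (hH : ∀ x, |x| ≤ r → |h' x| ≤ H) (hH' : ∀ x, |x| ≤ r → |h'' x| ≤ H) (h0 : h 0 = 0)
    (hr : r ≤ 1) (hf : LipBV L a f) (ha : a ≤ r) :
    LipBV L ((1 + L) * H * a) fun t => h (f t) := by
  have ha0 := hf.nonneg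
  have hr0 : 0 ≤ r := ha0.trans ha
  have hH0 : 0 ≤ H := (abs_nonneg _).trans (hH 0 (by simpa using hr0))
  have hfr : ∀ t, |f t| ≤ r := fun t => (hf.abs_le t).trans ha
  have hconv : Convex ℝ {x : ℝ | |x| ≤ r} := by
    have : {x : ℝ | |x| ≤ r} = Icc (-r) r := by ext x; simp [_root_.abs_le]
    rw [this]; exact convex_Icc _ _
  have hlip : ∀ x y, |x| ≤ r → |y| ≤ r → |h x - h y| ≤ H * |x - y| := fun x y hx hy =>
    hconv.norm_image_sub_le_of_norm_hasDerivWithin_le (fun z hz => (hh z hz).hasDerivWithinAt) hH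
      hy hx
  have hlip' : ∀ x y, |x| ≤ r → |y| ≤ r → |h' x - h' y| ≤ H * |x - y| := fun x y hx hy =>
    hconv.norm_image_sub_le_of_norm_hasDerivWithin_le (fun z hz => (hh' z hz).hasDerivWithinAt) hH'
      hy hx
  have hHa : 0 ≤ H * a := by positivity
  have hLHa : 0 ≤ L * (H * a) := by positivity
  refine of_dist_le (fun t => ?_) (fun s t => ?_) ?_
  · have := hlip (f t) 0 (hfr t) (by simpa using hr0)
    rw [h0, sub_zero, sub_zero] at this
    nlinarith [hf.abs_le t]
  · calc |h (f s) - h (f t)| ≤ H * |f s - f t| := hlip _ _ (hfr s) (hfr t)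
      _ ≤ H * (a * |s - t|) := by gcongr; exact hf.dist_le s t
      _ ≤ (1 + L) * H * a * |s - t| := by
          have : 0 ≤ L * (H * a) * |s - t| := by positivity
          nlinarith
  · have hl : LipschitzWith (H * a).toNNReal fun t => h' (f t) := by
      refine LipschitzWith.of_dist_le_mul fun s t => ?_
      rw [Real.coe_toNNReal _ hHa]
      calc |h' (f s) - h' (f t)| ≤ H * |f s - f t| := hlip' _ _ (hfr s) (hfr t)
        _ ≤ H * (a * |s - t|) := by gcongr; exact hf.dist_le s t
        _ = _ := (mul_assoc _ _ _).symm
    have t1 := totalVariation_mul_le hL hl (fun t => hH _ (hfr t)) hf.integrable_deriv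
      (Filter.Eventually.of_forall hf.abs_deriv_le) ha0 hf.tv
    rw [Real.coe_toNNReal _ hHa] at t1
    refine (totalVariation_congr (ae_restrict_of_ae ?_)).le.trans
      (t1.trans (ENNReal.ofReal_le_ofReal ?_))
    · filter_upwards [hf.lip.ae_differentiableAt_real] with t ht
      exact ((hh _ (hfr t)).comp t ht.hasDerivAt).deriv
    -- The product rule yields `a H + L (H a) a`; the bound `a ≤ 1` keeps the estimate linear in
    -- `a`, as the proximity estimate needs.
    · have : a ≤ 1 := ha.trans hr
      nlinarith

theorem exp_sub_one (hL : 0 < L) (hf : LipBV L a f) (ha : a ≤ 1) :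
    LipBV L ((1 + L) * 3 * a) fun t => Real.exp (f t) - 1 := by
  have hb : ∀ x : ℝ, |x| ≤ 1 → |Real.exp x| ≤ 3 := fun x hx => by
    rw [abs_of_pos (Real.exp_pos x)]
    exact (Real.exp_le_exp.2 ((le_abs_self x).trans hx)).trans (by linarith [Real.exp_one_lt_d9])
  exact comp hL (h := fun x => Real.exp x - 1) (fun x _ => (Real.hasDerivAt_exp x).sub_const 1)
    (fun x _ => Real.hasDerivAt_exp x) hb hb (by simp) le_rfl hf ha

theorem inv_sqrt_sub_one (hL : 0 < L) (hf : LipBV L a f) (ha : a ≤ 1 / 2) :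
    LipBV L ((1 + L) * 8 * a) fun t => (Real.sqrt (1 + f t))⁻¹ - 1 := by
  have h1 : ∀ x : ℝ, |x| ≤ 1 / 2 → (1 : ℝ) / 2 ≤ 1 + x := fun x hx => by linarith [(_root_.abs_le.1 hx).1]
  have h2 : ∀ p x : ℝ, |x| ≤ 1 / 2 → HasDerivAt (fun x : ℝ => (1 + x) ^ p) (p * (1 + x) ^ (p - 1)) x :=
    fun p x hx => by
      have hx0 : 1 + x ≠ 0 := by linarith [h1 x hx]
      have := ((hasDerivAt_id x).const_add 1).rpow_const (p := p) (Or.inl hx0)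
      simpa using this
  -- The value `8 = (1/2)^(-3)` serves both exponents `-3/2` and `-5/2` of the derivatives of `(1 +
  -- x)^(-1/2)`, whose coefficients `1/2` and `3/4` are below one.
  have h3 : ∀ p x : ℝ, -3 ≤ p → p ≤ 0 → |x| ≤ 1 / 2 → |(1 + x) ^ p| ≤ 8 := fun p x hp hp0 hx => by
    have hpos : (0 : ℝ) < 1 + x := by linarith [h1 x hx]
    rw [abs_of_nonneg (Real.rpow_nonneg hpos.le _)]
    calc (1 + x) ^ p ≤ (1 / 2 : ℝ) ^ p :=
          Real.rpow_le_rpow_of_nonpos (by norm_num) (h1 x hx) hp0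
      _ ≤ (1 / 2 : ℝ) ^ (-3 : ℝ) :=
          Real.rpow_le_rpow_of_exponent_ge (by norm_num) (by norm_num) hp
      _ = 8 := by
          rw [Real.rpow_neg (by norm_num)]; norm_num
  have := comp hL (r := 1 / 2) (H := 8) (h := fun x => (1 + x) ^ (-(1 / 2) : ℝ) - 1)
    (h' := fun x => (-(1 / 2)) * (1 + x) ^ (-(1 / 2) - 1 : ℝ))
    (h'' := fun x => (-(1 / 2)) * ((-(1 / 2) - 1) * (1 + x) ^ (-(1 / 2) - 1 - 1 : ℝ)))
    (fun x hx => (h2 _ x hx).sub_const 1) (fun x hx => (h2 _ x hx).const_mul _)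
    (fun x hx => by
      rw [abs_mul]
      have := h3 (-(1 / 2) - 1) x (by norm_num) (by norm_num) hx
      norm_num at this ⊢
      linarith)
    (fun x hx => by
      rw [abs_mul, abs_mul]
      have := h3 (-(1 / 2) - 1 - 1) x (by norm_num) (by norm_num) hx
      norm_num at this ⊢
      linarith)
    (by simp) (by norm_num) hf ha
  convert this using 3 with t
  have hpos : (0 : ℝ) ≤ 1 + f t := by linarith [h1 _ ((hf.abs_le t).trans ha)]
  rw [Real.rpow_neg hpos, Real.sqrt_eq_rpow]

end LipBV

/-! ### Steering the mean value of a field of unit vectors -/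

section Normalize

open NormedSpace

variable {E : Type*} [NormedAddCommGroup E] [InnerProductSpace ℝ E]

/-- Scaled by `‖x‖`, the difference splits into `x - y` and a multiple of a unit vector of length at
most `‖x - y‖`; dividing by `‖x‖ ≥ 1/2` gives the factor `4`. -/
theorem norm_normalize_sub_normalize_le {x y : E} (hx : 1 / 2 ≤ ‖x‖) (hy : y ≠ 0) :
    ‖normalize x - normalize y‖ ≤ 4 * ‖x - y‖ := by
  have hx0 : 0 < ‖x‖ := by linarith
  have e : ‖x‖ • (normalize x - normalize y) = (x - y) + (‖y‖ - ‖x‖) • normalize y := by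
    rw [smul_sub, norm_smul_normalize, sub_smul, norm_smul_normalize]; abel
  have h1 : ‖x‖ * ‖normalize x - normalize y‖ ≤ 2 * ‖x - y‖ := by
    have h2 := norm_smul ‖x‖ (normalize x - normalize y)
    rw [norm_norm] at h2
    rw [← h2, e]
    refine (norm_add_le _ _).trans ?_
    rw [norm_smul, norm_normalize hy, mul_one, Real.norm_eq_abs, abs_sub_comm]
    linarith [abs_norm_sub_norm_le x y]
  nlinarith [norm_nonneg (normalize x - normalize y)]

/-- Together with `norm_sub_sq_sub_inner_sq` this expresses the monotonicity of normalization and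
the part of `x - y` orthogonal to `y` through the cosine of the angle, so that the two can be
compared. -/
theorem inner_sub_normalize_sub {x y : E} (hx : x ≠ 0) (hy : y ≠ 0) :
    inner ℝ (x - y) (normalize x - normalize y) =
      (‖x‖ + ‖y‖) * (1 - inner ℝ (normalize x) (normalize y)) := by
  have ex := norm_smul_normalize x
  have ey := norm_smul_normalize y
  have nx : inner ℝ (normalize x) (normalize x) = (1 : ℝ) := by
    rw [real_inner_self_eq_norm_sq, norm_normalize hx]; norm_num
  have ny : inner ℝ (normalize y) (normalize y) = (1 : ℝ) := by
    rw [real_inner_self_eq_norm_sq, norm_normalize hy]; norm_num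
  have hxy := real_inner_comm (normalize x) (normalize y)
  calc inner ℝ (x - y) (normalize x - normalize y)
      = inner ℝ (‖x‖ • normalize x - ‖y‖ • normalize y) (normalize x - normalize y) := by
        rw [ex, ey]
    _ = _ := by
        simp only [inner_sub_left, inner_sub_right, real_inner_smul_left, nx, ny, hxy]
        ring

theorem norm_sub_sq_sub_inner_sq {x y : E} (hx : x ≠ 0) (hy : y ≠ 0) :
    ‖x - y‖ ^ 2 - (inner ℝ (normalize y) (x - y)) ^ 2 =
      ‖x‖ ^ 2 * (1 - (inner ℝ (normalize x) (normalize y)) ^ 2) := by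
  have ex := norm_smul_normalize x
  have ey := norm_smul_normalize y
  have nx : inner ℝ (normalize x) (normalize x) = (1 : ℝ) := by
    rw [real_inner_self_eq_norm_sq, norm_normalize hx]; norm_num
  have ny : inner ℝ (normalize y) (normalize y) = (1 : ℝ) := by
    rw [real_inner_self_eq_norm_sq, norm_normalize hy]; norm_num
  have hxy := real_inner_comm (normalize x) (normalize y)
  have h : x - y = ‖x‖ • normalize x - ‖y‖ • normalize y := by rw [ex, ey]
  rw [← real_inner_self_eq_norm_sq, h]
  simp only [inner_sub_left, inner_sub_right, real_inner_smul_left, real_inner_smul_right, nx, ny,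
    hxy]
  ring

/-- A strong monotonicity estimate for the projection to the unit sphere near a unit vector `e`. -/
theorem inner_sub_normalize_sub_ge {x y e : E} {d : ℝ} (he : ‖e‖ = 1) (hd : d ≤ 1 / 2)
    (hx : ‖x - e‖ ≤ d) (hy : ‖y - e‖ ≤ d) :
    2 / 9 * (‖x - y‖ ^ 2 - (inner ℝ e (x - y)) ^ 2 - 8 * d * ‖x - y‖ ^ 2) ≤
      inner ℝ (x - y) (normalize x - normalize y) := by
  have hrx := abs_le.1 ((abs_norm_sub_norm_le x e).trans hx)
  have hry := abs_le.1 ((abs_norm_sub_norm_le y e).trans hy)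
  rw [he] at hrx hry
  have hx0 : x ≠ 0 := fun h => by rw [h, norm_zero] at hrx; linarith [hrx.1]
  have hy0 : y ≠ 0 := fun h => by rw [h, norm_zero] at hry; linarith [hry.1]
  have he0 : e ≠ 0 := fun h => by rw [h, norm_zero] at he; linarith
  set a := inner ℝ (normalize x) (normalize y) with ha
  have ha1 : |a| ≤ 1 := by
    have := abs_real_inner_le_norm (normalize x) (normalize y)
    rwa [norm_normalize hx0, norm_normalize hy0, one_mul] at this
  obtain ⟨ha2, ha3⟩ := abs_le.1 ha1
  have hny : ‖normalize y - e‖ ≤ 4 * d := by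
    have h1 : 1 / 2 ≤ ‖y‖ := by linarith [hry.1]
    have := norm_normalize_sub_normalize_le h1 he0
    rw [normalize_eq_self_of_norm_eq_one he] at this
    linarith
  -- Replacing the direction of `y` by `e` costs a difference of squares, with factors at most `4 d
  -- ‖x - y‖` and `2 ‖x - y‖`.
  have hi : (inner ℝ (normalize y) (x - y)) ^ 2 ≤
      (inner ℝ e (x - y)) ^ 2 + 8 * d * ‖x - y‖ ^ 2 := by
    have h1 : |inner ℝ (normalize y - e) (x - y)| ≤ 4 * d * ‖x - y‖ :=
      (abs_real_inner_le_norm _ _).trans (by gcongr)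
    have h2 : |inner ℝ (normalize y + e) (x - y)| ≤ 2 * ‖x - y‖ := by
      refine (abs_real_inner_le_norm _ _).trans ?_
      gcongr
      refine (norm_add_le _ _).trans ?_
      rw [norm_normalize hy0, he]; norm_num
    rw [inner_sub_left] at h1
    rw [inner_add_left] at h2
    have h3 := mul_le_mul h1 h2 (abs_nonneg _) ((abs_nonneg _).trans h1)
    rw [← abs_mul] at h3
    nlinarith [le_abs_self ((inner ℝ (normalize y) (x - y) - inner ℝ e (x - y)) *
      (inner ℝ (normalize y) (x - y) + inner ℝ e (x - y)))]
  rw [inner_sub_normalize_sub hx0 hy0, ← ha]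
  have h4 := norm_sub_sq_sub_inner_sq hx0 hy0
  rw [← ha] at h4
  -- Since `1 - a² ≤ 2 (1 - a)` and `‖x‖ ≤ 3/2`, the orthogonal part is at most `9/2 (1 - a)`; this
  -- is the origin of `2/9`.
  have h5 : ‖x‖ ^ 2 * (1 - a ^ 2) ≤ 9 / 4 * (1 - a ^ 2) := by
    gcongr
    · nlinarith
    · nlinarith [hrx.1, hrx.2]
  have h6 : (1 - a) ≤ (‖x‖ + ‖y‖) * (1 - a) := by
    nlinarith [hrx.1, hry.1]
  nlinarith

end Normalize

section Steering

open NormedSpace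
open scoped NNReal

variable {E : Type*} [NormedAddCommGroup E] [InnerProductSpace ℝ E] [CompleteSpace E]

/-- A Lipschitz field of unit vectors whose mean is shorter than one is not nearly parallel to any
fixed direction. -/
theorem exists_inner_le_of_norm_integral_le {L δ : ℝ} (hL : 0 < L) (hδ : 0 < δ) {τ : ℝ → E}
    (hc : Continuous τ) (hmean : ‖∫ t, τ t ∂(sigmaMeasure L)‖ ≤ L * (1 - 2 * δ)) (hδ1 : δ ≤ 1)
    {w : E} (hw : w ≠ 0) :
    ∃ t ∈ Icc 0 L, |inner ℝ w (τ t)| ≤ (1 - δ) * ‖w‖ := by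
  by_contra! hcon
  have hN : 0 < ‖w‖ := norm_pos_iff.2 hw
  have hf : Continuous fun t => inner ℝ w (τ t) := continuous_const.inner hc
  have hτi : Integrable τ (sigmaMeasure L) := hc.continuousOn.integrableOn_Icc
  have hfi : Integrable (fun t => inner ℝ w (τ t)) (sigmaMeasure L) :=
    hf.continuousOn.integrableOn_Icc
  have hint : ∫ t, inner ℝ w (τ t) ∂(sigmaMeasure L) = inner ℝ w (∫ t, τ t ∂(sigmaMeasure L)) :=
    integral_inner hτi w
  have hreal : (sigmaMeasure L).real univ = L := by simp [Measure.real, hL.le]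
  have hup : |inner ℝ w (∫ t, τ t ∂(sigmaMeasure L))| ≤ ‖w‖ * (L * (1 - 2 * δ)) :=
    (abs_real_inner_le_norm _ _).trans (by gcongr)
  have hpos : 0 ≤ (1 - δ) * ‖w‖ := by
    have : 0 ≤ 1 - δ := by linarith
    positivity
  have hne : ∀ t ∈ Icc 0 L, inner ℝ w (τ t) ≠ 0 := fun t ht h => by
    have := hcon t ht
    rw [h, abs_zero] at this
    linarith
  have hlt : L * (1 - 2 * δ) * ‖w‖ < L * ((1 - δ) * ‖w‖) := by
    have : 0 < L * ‖w‖ * δ := by positivity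
    nlinarith
  -- If `|⟨w, τ⟩|` stayed above `(1 - δ) ‖w‖`, continuity would fix the sign of `⟨w, τ⟩`. Its
  -- integral would then be at least `L (1 - δ) ‖w‖` in modulus, against the bound `L (1 - 2δ) ‖w‖`.
  have hsign : (∀ t ∈ Icc 0 L, 0 < inner ℝ w (τ t)) ∨ ∀ t ∈ Icc 0 L, inner ℝ w (τ t) < 0 := by
    by_contra! h
    obtain ⟨⟨s, hs, hs'⟩, t, ht, ht'⟩ := h
    obtain ⟨r, hr, hr'⟩ := (isPreconnected_Icc (a := (0 : ℝ)) (b := L)).intermediate_value hs ht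
      hf.continuousOn ⟨hs', ht'⟩
    exact hne r hr hr'
  rcases hsign with h | h
  · have h1 : ∀ᵐ t ∂(sigmaMeasure L), (1 - δ) * ‖w‖ ≤ inner ℝ w (τ t) := by
      filter_upwards [ae_restrict_mem measurableSet_Icc] with t ht
      have := hcon t ht
      rw [abs_of_pos (h t ht)] at this
      exact this.le
    have h2 := integral_mono_ae (integrable_const _) hfi h1
    rw [integral_const, hreal, smul_eq_mul, hint] at h2
    linarith [(abs_le.1 hup).2]
  · have h1 : ∀ᵐ t ∂(sigmaMeasure L), inner ℝ w (τ t) ≤ -((1 - δ) * ‖w‖) := by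
      filter_upwards [ae_restrict_mem measurableSet_Icc] with t ht
      have := hcon t ht
      rw [abs_of_neg (h t ht)] at this
      linarith
    have h2 := integral_mono_ae hfi (integrable_const _) h1
    rw [integral_const, hreal, smul_eq_mul, hint] at h2
    linarith [(abs_le.1 hup).1]

/-- A weight on `[0, L]` that vanishes at the end points, extended by zero. -/
noncomputable def bubble (L t : ℝ) : ℝ := max 0 (min L t) * (L - max 0 (min L t))

theorem bubble_of_mem {L t : ℝ} (ht : t ∈ Icc 0 L) : bubble L t = t * (L - t) := by
  rw [bubble, min_eq_right ht.2, max_eq_right ht.1]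

theorem continuous_bubble (L : ℝ) : Continuous (bubble L) := by
  unfold bubble; fun_prop

theorem bubble_nonneg {L : ℝ} (hL : 0 < L) (t : ℝ) : 0 ≤ bubble L t :=
  mul_nonneg (le_max_left _ _) (sub_nonneg.2 (max_le hL.le (min_le_left _ _)))

theorem bubble_le {L : ℝ} (hL : 0 < L) (t : ℝ) : bubble L t ≤ L ^ 2 := by
  have h1 : 0 ≤ max 0 (min L t) := le_max_left _ _
  have h2 : max 0 (min L t) ≤ L := max_le hL.le (min_le_left _ _)
  unfold bubble
  nlinarith

/-- Coercivity of the weighted integral of the projections orthogonal to a field of unit vectors. -/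
theorem exists_coercive {L δ M : ℝ} (hL : 0 < L) (hδ : 0 < δ) (hδ1 : δ ≤ 1) (hM : 0 ≤ M) :
    ∃ c : ℝ, 0 < c ∧ ∀ τ : ℝ → E, (∀ t, ‖τ t‖ = 1) → (∀ s t, ‖τ s - τ t‖ ≤ M * |s - t|) →
      ‖∫ t, τ t ∂(sigmaMeasure L)‖ ≤ L * (1 - 2 * δ) → ∀ w : E,
        c * ‖w‖ ^ 2 ≤
          ∫ t, bubble L t * (‖w‖ ^ 2 - (inner ℝ (τ t) w) ^ 2) ∂(sigmaMeasure L) := by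
  -- Over a distance `r` the field turns by at most `δ / 4`, and an interval of length `r` with end
  -- point `s` fits into `[0, L]` on one side of `s`.
  set r := min (δ / (4 * (M + 1))) (L / 2) with hr
  have hr0 : 0 < r := lt_min (by positivity) (by linarith)
  have hrL : r ≤ L / 2 := min_le_right _ _
  have hrM : M * r ≤ δ / 4 := by
    have h1 : r * (4 * (M + 1)) ≤ δ := (le_div_iff₀ (by positivity)).1 (min_le_left _ _)
    nlinarith
  refine ⟨(r / 3) ^ 3 * (δ / 2), by positivity, fun τ hτ hlip hmean w => ?_⟩
  have hc : Continuous τ := (LipschitzWith.of_dist_le_mul (K := M.toNNReal) fun s t => by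
    rw [dist_eq_norm, Real.dist_eq, Real.coe_toNNReal _ hM]; exact hlip s t).continuous
  by_cases hw : w = 0
  · simp [hw]
  set N := ‖w‖ with hN
  have hN0 : 0 < N := norm_pos_iff.2 hw
  obtain ⟨s, hs, hsw⟩ := exists_inner_le_of_norm_integral_le hL hδ hc hmean hδ1 hw
  have hle : ∀ t, |inner ℝ w (τ t)| ≤ N := fun t => by
    have := abs_real_inner_le_norm w (τ t)
    rwa [hτ t, mul_one] at this
  obtain ⟨a, ha0, haL, has⟩ : ∃ a, 0 ≤ a ∧ a + r ≤ L ∧ ∀ t ∈ Icc a (a + r), |t - s| ≤ r := by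
    rcases le_total s (L / 2) with h | h
    · refine ⟨s, hs.1, by linarith, fun t ht => abs_le.2 ⟨by linarith [ht.1], by linarith [ht.2]⟩⟩
    · refine ⟨s - r, by linarith, by linarith [hs.2], fun t ht =>
        abs_le.2 ⟨by linarith [ht.1], by linarith [ht.2]⟩⟩
  have hlow : ∀ t ∈ Icc a (a + r), δ / 2 * N ^ 2 ≤ N ^ 2 - (inner ℝ w (τ t)) ^ 2 := by
    intro t ht
    have h1 : |inner ℝ w (τ t) - inner ℝ w (τ s)| ≤ N * (M * r) := by
      rw [← inner_sub_right]
      refine (abs_real_inner_le_norm _ _).trans ?_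
      gcongr
      exact (hlip t s).trans (by gcongr; exact has t ht)
    have h2 : |inner ℝ w (τ t)| ≤ (1 - δ * 3 / 4) * N := by
      have := abs_sub_abs_le_abs_sub (inner ℝ w (τ t)) (inner ℝ w (τ s))
      nlinarith
    have h3 : (inner ℝ w (τ t)) ^ 2 ≤ ((1 - δ * 3 / 4) * N) ^ 2 := by
      rw [← sq_abs]; gcongr
    have h4 : ((1 - δ * 3 / 4) * N) ^ 2 ≤ (1 - δ / 2) * N ^ 2 := by
      rw [mul_pow]
      gcongr
      nlinarith
    linarith
  have hcont : Continuous fun t => bubble L t * (N ^ 2 - (inner ℝ (τ t) w) ^ 2) :=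
    (continuous_bubble L).mul (continuous_const.sub ((hc.inner continuous_const).pow 2))
  have hnn : ∀ t, 0 ≤ bubble L t * (N ^ 2 - (inner ℝ (τ t) w) ^ 2) := fun t => by
    refine mul_nonneg (bubble_nonneg hL t) (sub_nonneg.2 ?_)
    rw [real_inner_comm, ← sq_abs]
    exact pow_le_pow_left₀ (abs_nonneg _) (hle t) 2
  -- The middle third keeps distance `r / 3` from both ends of `[0, L]`, so the bubble is at least
  -- `(r / 3)²` there. Times the length `r / 3` and the lower bound `δ / 2`, this is the coercivity
  -- constant.
  have hsub : Icc (a + r / 3) (a + 2 * r / 3) ⊆ Icc 0 L := fun t ht =>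
    ⟨by linarith [ht.1], by linarith [ht.2]⟩
  have hmono : ∫ t in Icc (a + r / 3) (a + 2 * r / 3),
      bubble L t * (N ^ 2 - (inner ℝ (τ t) w) ^ 2) ≤
      ∫ t, bubble L t * (N ^ 2 - (inner ℝ (τ t) w) ^ 2) ∂(sigmaMeasure L) :=
    setIntegral_mono_set hcont.continuousOn.integrableOn_Icc
      (Filter.Eventually.of_forall hnn) hsub.eventuallyLE
  refine le_trans ?_ hmono
  have hconst := setIntegral_mono_on (μ := volume) (s := Icc (a + r / 3) (a + 2 * r / 3))
    (f := fun _ => (r / 3) ^ 2 * (δ / 2 * N ^ 2)) (integrableOn_const (by simp))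
    hcont.continuousOn.integrableOn_Icc measurableSet_Icc fun t ht => by
      rw [bubble_of_mem (hsub ht), real_inner_comm]
      have h1 := hlow t ⟨by linarith [ht.1], by linarith [ht.2]⟩
      have h2 : (r / 3) ^ 2 ≤ t * (L - t) := by
        have h3 : r / 3 ≤ t := by linarith [ht.1]
        have h4 : r / 3 ≤ L - t := by linarith [ht.2]
        rw [sq]
        exact mul_le_mul h3 h4 (by positivity) (by linarith)
      exact mul_le_mul h2 h1 (by positivity) (by nlinarith)
  refine le_trans (le_of_eq ?_) hconst
  rw [setIntegral_const, Measure.real, Real.volume_Icc, ENNReal.toReal_ofReal (by linarith),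
    smul_eq_mul]
  ring

/-- A strongly monotone Lipschitz map on a ball attains all values near its value at the centre. -/
theorem exists_eq_of_strongly_monotone {c ℓ : ℝ} (hc : 0 < c) (hcl : c ≤ ℓ) :
    ∃ q : ℝ, 0 < q ∧ ∀ (G : E → E) (R : ℝ),
      (∀ x y, ‖x‖ ≤ R → ‖y‖ ≤ R → c * ‖x - y‖ ^ 2 ≤ inner ℝ (x - y) (G x - G y)) →
      (∀ x y, ‖x‖ ≤ R → ‖y‖ ≤ R → ‖G x - G y‖ ≤ ℓ * ‖x - y‖) →
      ∀ y : E, ‖G 0 - y‖ ≤ q * R → ∃ x, ‖x‖ ≤ R ∧ G x = y := by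
  have hℓ : 0 < ℓ := hc.trans_le hcl
  -- This step size minimizes `1 - 2 s c + s² ℓ²`, the bound for the squared contraction factor of
  -- `x ↦ x - s (G x - y)`; the minimum is `θ²`.
  set s := c / ℓ ^ 2 with hs
  have hs0 : 0 < s := by positivity
  set θ := Real.sqrt (1 - c ^ 2 / ℓ ^ 2) with hθ
  have hθ1 : θ < 1 := by
    rw [hθ, Real.sqrt_lt' one_pos]
    have : 0 < c ^ 2 / ℓ ^ 2 := by positivity
    linarith
  have hθ0 : 0 ≤ θ := Real.sqrt_nonneg _
  have hθsq : θ ^ 2 = 1 - c ^ 2 / ℓ ^ 2 := by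
    refine Real.sq_sqrt (sub_nonneg.2 ?_)
    rw [div_le_one (by positivity)]
    gcongr
  -- With this `q` the iteration maps the ball of radius `R` to itself. As `q` does not depend on
  -- `G` or `R`, the radius can later be taken proportional to the residual, which makes the
  -- solution `O(e)`.
  refine ⟨(1 - θ) / s, div_pos (by linarith) hs0, fun G R hmon hlip y hy => ?_⟩
  have hR : 0 ≤ R := by
    have h1 : 0 < (1 - θ) / s := div_pos (by linarith) hs0
    by_contra h
    have := (norm_nonneg _).trans hy
    nlinarith
  let H : E → E := fun x => x - s • (G x - y)
  have hcontr : ∀ x x', ‖x‖ ≤ R → ‖x'‖ ≤ R → ‖H x - H x'‖ ≤ θ * ‖x - x'‖ := by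
    intro x x' hx hx'
    have e : H x - H x' = (x - x') - s • (G x - G x') := by
      simp only [H, smul_sub]; abel
    refine le_of_sq_le_sq ?_ (by positivity)
    rw [e, norm_sub_sq_real, inner_smul_right, norm_smul, mul_pow, mul_pow, hθsq,
      Real.norm_of_nonneg hs0.le]
    have h1 := hmon x x' hx hx'
    have h2 : ‖G x - G x'‖ ^ 2 ≤ (ℓ * ‖x - x'‖) ^ 2 := by
      gcongr; exact hlip x x' hx hx'
    have h3 : s ^ 2 * ‖G x - G x'‖ ^ 2 ≤ s ^ 2 * (ℓ * ‖x - x'‖) ^ 2 := by gcongr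
    have h4 : s * (c * ‖x - x'‖ ^ 2) ≤ s * inner ℝ (x - x') (G x - G x') := by gcongr
    have h5 : s ^ 2 * (ℓ * ‖x - x'‖) ^ 2 = c ^ 2 / ℓ ^ 2 * ‖x - x'‖ ^ 2 := by
      rw [hs]; field_simp
    have h6 : s * (c * ‖x - x'‖ ^ 2) = c ^ 2 / ℓ ^ 2 * ‖x - x'‖ ^ 2 := by
      rw [hs]; field_simp
    nlinarith
  have hmaps : MapsTo H (Metric.closedBall 0 R) (Metric.closedBall 0 R) := by
    intro x hx
    rw [mem_closedBall_zero_iff] at hx ⊢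
    have h0 : ‖H 0‖ ≤ (1 - θ) * R := by
      simp only [H, zero_sub, norm_neg, norm_smul, Real.norm_of_nonneg hs0.le]
      calc s * ‖G 0 - y‖ ≤ s * ((1 - θ) / s * R) := by gcongr
        _ = (1 - θ) * R := by field_simp
    have h1 := hcontr x 0 hx (by simpa using hR)
    rw [sub_zero] at h1
    have h2 : ‖H x‖ ≤ ‖H x - H 0‖ + ‖H 0‖ := by
      simpa using norm_add_le (H x - H 0) (H 0)
    nlinarith
  have hct : ContractingWith ⟨θ, hθ0⟩ (hmaps.restrict H _ _) := by
    refine ⟨hθ1, LipschitzWith.of_dist_le_mul fun x x' => ?_⟩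
    have := hcontr x x' (mem_closedBall_zero_iff.1 x.2) (mem_closedBall_zero_iff.1 x'.2)
    rw [← dist_eq_norm, ← dist_eq_norm] at this
    exact this
  obtain ⟨x, hx, hfix, -⟩ := hct.exists_fixedPoint' Metric.isClosed_closedBall.isComplete hmaps
    (x := 0) (by simpa using hR) (edist_ne_top _ _)
  refine ⟨x, by simpa using hx, ?_⟩
  have h1 : x - s • (G x - y) = x := hfix
  rw [sub_eq_self, smul_eq_zero] at h1
  exact sub_eq_zero.1 (h1.resolve_left hs0.ne')

/-- The mean of the normalization of `τ + v` can be corrected by adding a small multiple of the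
bubble function. -/
theorem exists_steering {L δ M : ℝ} (hL : 0 < L) (hδ : 0 < δ) (hδ1 : δ ≤ 1) (hM : 0 ≤ M) :
    ∃ d q R : ℝ, 0 < d ∧ d ≤ 1 / 2 ∧ 0 < q ∧ 0 < R ∧ ∀ τ v : ℝ → E, (∀ t, ‖τ t‖ = 1) →
      (∀ s t, ‖τ s - τ t‖ ≤ M * |s - t|) →
      ‖∫ t, τ t ∂(sigmaMeasure L)‖ ≤ L * (1 - 2 * δ) → Continuous v → (∀ t, ‖v t‖ ≤ d) →
      ∀ (y : E) (ρ : ℝ), ‖(∫ t, normalize (τ t + v t) ∂(sigmaMeasure L)) - y‖ ≤ q * ρ → ρ ≤ R →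
        ∃ w : E, ‖w‖ ≤ ρ ∧
          ∫ t, normalize (τ t + (v t + bubble L t • w)) ∂(sigmaMeasure L) = y := by
  obtain ⟨c, hc, hcoer⟩ := exists_coercive (E := E) hL hδ hδ1 hM
  -- The error term of the monotonicity estimate, `8 D` times the integral of the bubble, then uses
  -- at most half of the coercivity `c`. Half of the budget `D` goes to `v`, the other half to the
  -- bubble term, whence the radius `D / (2 L²)`.
  set D := min (1 / 2) (c / (16 * L ^ 3)) with hD
  have hD0 : 0 < D := lt_min (by norm_num) (by positivity)
  have hD2 : D ≤ 1 / 2 := min_le_left _ _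
  have hDc : 8 * D * L ^ 3 ≤ c / 2 := by
    have := (le_div_iff₀ (by positivity)).1 (min_le_right (1 / 2) (c / (16 * L ^ 3)))
    rw [← hD] at this
    linarith
  -- The monotonicity constant is `2/9 (c - c/2)`. The Lipschitz constant combines the factor `4` of
  -- normalization with the integral of the bubble, at most `L³`; the maximum only ensures that it
  -- dominates `c / 9`.
  obtain ⟨q, hq, hsolve⟩ := exists_eq_of_strongly_monotone (E := E) (c := c / 9)
    (ℓ := max (c / 9) (4 * L ^ 3)) (by positivity) (le_max_left _ _)
  refine ⟨D / 2, q, D / (2 * L ^ 2), by positivity, by linarith, hq, by positivity,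
    fun τ v hτ hlip hmean hv hvd y ρ hy hρ => ?_⟩
  have hτc : Continuous τ := (LipschitzWith.of_dist_le_mul (K := M.toNNReal) fun s t => by
    rw [dist_eq_norm, Real.dist_eq, Real.coe_toNNReal _ hM]; exact hlip s t).continuous
  have hψ0 := bubble_nonneg hL
  have hnear : ∀ w : E, ‖w‖ ≤ ρ → ∀ t, ‖(τ t + (v t + bubble L t • w)) - τ t‖ ≤ D := by
    intro w hw t
    rw [add_sub_cancel_left]
    refine (norm_add_le _ _).trans ?_
    rw [norm_smul, Real.norm_of_nonneg (hψ0 t)]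
    have h1 : bubble L t * ‖w‖ ≤ L ^ 2 * (D / (2 * L ^ 2)) :=
      mul_le_mul (bubble_le hL t) (hw.trans hρ) (norm_nonneg _) (by positivity)
    have h2 : L ^ 2 * (D / (2 * L ^ 2)) = D / 2 := by field_simp
    linarith [hvd t]
  have hlower : ∀ w : E, ‖w‖ ≤ ρ → ∀ t, 1 / 2 ≤ ‖τ t + (v t + bubble L t • w)‖ := by
    intro w hw t
    have h1 := (abs_le.1 ((abs_norm_sub_norm_le _ _).trans (hnear w hw t))).1
    rw [hτ t] at h1
    linarith
  have hne : ∀ w : E, ‖w‖ ≤ ρ → ∀ t, τ t + (v t + bubble L t • w) ≠ 0 := fun w hw t h => by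
    have := hlower w hw t
    rw [h, norm_zero] at this
    linarith
  have hcont : ∀ w : E, ‖w‖ ≤ ρ →
      Continuous fun t => normalize (τ t + (v t + bubble L t • w)) := by
    intro w hw
    have h1 : Continuous fun t => τ t + (v t + bubble L t • w) :=
      hτc.add (hv.add ((continuous_bubble L).smul continuous_const))
    exact (h1.norm.inv₀ fun t => norm_ne_zero_iff.2 (hne w hw t)).smul h1
  have hint : ∀ w : E, ‖w‖ ≤ ρ →
      Integrable (fun t => normalize (τ t + (v t + bubble L t • w))) (sigmaMeasure L) :=
    fun w hw => (hcont w hw).continuousOn.integrableOn_Icc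
  have hdiff : ∀ w w' : E, ∀ t, (τ t + (v t + bubble L t • w)) - (τ t + (v t + bubble L t • w')) =
      bubble L t • (w - w') := fun w w' t => by rw [smul_sub]; abel
  have hψint : ∫ t, bubble L t ∂(sigmaMeasure L) ≤ L ^ 3 := by
    have := integral_mono (μ := sigmaMeasure L) (continuous_bubble L).continuousOn.integrableOn_Icc
      (integrable_const (L ^ 2)) (bubble_le hL)
    refine this.trans (le_of_eq ?_)
    simp [Measure.real, hL.le]
    ring
  have hmon : ∀ w w' : E, ‖w‖ ≤ ρ → ‖w'‖ ≤ ρ → c / 9 * ‖w - w'‖ ^ 2 ≤ inner ℝ (w - w')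
      ((∫ t, normalize (τ t + (v t + bubble L t • w)) ∂(sigmaMeasure L)) -
        ∫ t, normalize (τ t + (v t + bubble L t • w')) ∂(sigmaMeasure L)) := by
    intro w w' hw hw'
    have isub : Integrable (fun t => normalize (τ t + (v t + bubble L t • w)) -
        normalize (τ t + (v t + bubble L t • w'))) (sigmaMeasure L) :=
      (hint w hw).sub (hint w' hw')
    rw [← integral_sub (hint w hw) (hint w' hw'), ← integral_inner isub]
    have hpt : ∀ t, 2 / 9 * (bubble L t * (‖w - w'‖ ^ 2 - (inner ℝ (τ t) (w - w')) ^ 2) -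
        8 * D * ‖w - w'‖ ^ 2 * bubble L t) ≤
        inner ℝ (w - w') (normalize (τ t + (v t + bubble L t • w)) -
          normalize (τ t + (v t + bubble L t • w'))) := by
      intro t
      have h := inner_sub_normalize_sub_ge (hτ t) hD2 (hnear w hw t) (hnear w' hw' t)
      rw [hdiff, norm_smul, Real.norm_of_nonneg (hψ0 t), inner_smul_right,
        real_inner_smul_left] at h
      -- The arguments differ by `bubble L t • (w - w')`, so the estimate carries one superfluous
      -- factor of the bubble, to be divided out where it is positive.
      rcases (hψ0 t).eq_or_lt with h0 | h0
      · rw [← h0]; simp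
      · refine le_of_mul_le_mul_left ?_ h0
        refine le_trans (le_of_eq ?_) h
        ring
    have c1 : Continuous fun t => bubble L t * (‖w - w'‖ ^ 2 - (inner ℝ (τ t) (w - w')) ^ 2) :=
      (continuous_bubble L).mul (continuous_const.sub ((hτc.inner continuous_const).pow 2))
    have i1 : Integrable (fun t => bubble L t * (‖w - w'‖ ^ 2 - (inner ℝ (τ t) (w - w')) ^ 2))
      (sigmaMeasure L) := c1.continuousOn.integrableOn_Icc
    have i2 : Integrable (bubble L) (sigmaMeasure L) :=
      (continuous_bubble L).continuousOn.integrableOn_Icc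
    have hmono := integral_mono (μ := sigmaMeasure L)
      ((i1.sub (i2.const_mul (8 * D * ‖w - w'‖ ^ 2))).const_mul (2 / 9))
      (continuous_const.inner ((hcont w hw).sub (hcont w' hw'))).continuousOn.integrableOn_Icc hpt
    refine le_trans ?_ hmono
    simp only [Pi.sub_apply]
    rw [integral_const_mul, integral_sub i1 (i2.const_mul _), integral_const_mul]
    have h1 := hcoer τ hτ hlip hmean (w - w')
    have h2 : 8 * D * ‖w - w'‖ ^ 2 * ∫ t, bubble L t ∂(sigmaMeasure L) ≤
        8 * D * ‖w - w'‖ ^ 2 * L ^ 3 := by gcongr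
    have h3 : 8 * D * L ^ 3 * ‖w - w'‖ ^ 2 ≤ c / 2 * ‖w - w'‖ ^ 2 := by gcongr
    linarith
  have hlip' : ∀ w w' : E, ‖w‖ ≤ ρ → ‖w'‖ ≤ ρ →
      ‖(∫ t, normalize (τ t + (v t + bubble L t • w)) ∂(sigmaMeasure L)) -
        ∫ t, normalize (τ t + (v t + bubble L t • w')) ∂(sigmaMeasure L)‖ ≤
        max (c / 9) (4 * L ^ 3) * ‖w - w'‖ := by
    intro w w' hw hw'
    rw [← integral_sub (hint w hw) (hint w' hw')]
    have h1 : ‖∫ t, (normalize (τ t + (v t + bubble L t • w)) -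
        normalize (τ t + (v t + bubble L t • w'))) ∂(sigmaMeasure L)‖ ≤
        ∫ t, bubble L t * (4 * ‖w - w'‖) ∂(sigmaMeasure L) := by
      refine norm_integral_le_of_norm_le
        (((continuous_bubble L).continuousOn.integrableOn_Icc).mul_const _)
        (Filter.Eventually.of_forall fun t => ?_)
      refine (norm_normalize_sub_normalize_le (hlower w hw t) (hne w' hw' t)).trans (le_of_eq ?_)
      rw [hdiff, norm_smul, Real.norm_of_nonneg (hψ0 t)]; ring
    rw [integral_mul_const] at h1
    calc _ ≤ _ := h1
      _ ≤ L ^ 3 * (4 * ‖w - w'‖) := by gcongr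
      _ = 4 * L ^ 3 * ‖w - w'‖ := by ring
      _ ≤ _ := by gcongr; exact le_max_right _ _
  obtain ⟨w, hw, hwy⟩ := hsolve
    (fun w => ∫ t, normalize (τ t + (v t + bubble L t • w)) ∂(sigmaMeasure L)) ρ hmon hlip' y
    (by simpa using hy)
  exact ⟨w, hw, hwy⟩

end Steering

/-! ### Correction of the unit tangent field -/

section Correction

open NormedSpace

variable {m : ℕ}

theorem EuclideanSpace.norm_le_sum_abs (x : EuclideanSpace ℝ (Fin m)) : ‖x‖ ≤ ∑ i, |x i| := by
  rw [EuclideanSpace.norm_eq]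
  refine Real.sqrt_le_iff.2 ⟨Finset.sum_nonneg fun i _ => abs_nonneg _, ?_⟩
  simp only [Real.norm_eq_abs]
  exact Finset.sum_sq_le_sq_sum_of_nonneg fun i _ => abs_nonneg _

theorem continuous_of_lipBV_components {L a : ℝ} {T : ℝ → EuclideanSpace ℝ (Fin m)}
    (hT : ∀ i, LipBV L a fun t => T t i) : Continuous T :=
  (PiLp.continuous_toLp 2 _).comp (continuous_pi fun i => (hT i).lip.continuous)

theorem norm_sub_le_of_lipBV_components {L a : ℝ} {T : ℝ → EuclideanSpace ℝ (Fin m)}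
    (hT : ∀ i, LipBV L a fun t => T t i) (s t : ℝ) : ‖T s - T t‖ ≤ m * a * |s - t| := by
  refine (EuclideanSpace.norm_le_sum_abs (T s - T t)).trans ((Finset.sum_le_sum fun i _ => (hT i).dist_le s t).trans (le_of_eq ?_))
  simp
  ring

theorem LipBV.exists_bubble {L : ℝ} (hL : 0 < L) : ∃ B, 0 ≤ B ∧ LipBV L B (bubble L) :=
  have h := (LipBV.clamp hL).mul hL ((LipBV.const hL L).sub hL (LipBV.clamp hL))
  ⟨_, h.nonneg, h⟩

/-- The interpolation of the vectors `a₀` at `0` and `a₁` at `L`, plus a multiple of the bubble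
function. -/
noncomputable def endpointShift {E : Type*} [NormedAddCommGroup E] [NormedSpace ℝ E] (L : ℝ)
    (a₀ a₁ : E) (t : ℝ) : E :=
  a₀ + (max 0 (min L t) / L) • (a₁ - a₀)

theorem endpointShift_zero {E : Type*} [NormedAddCommGroup E] [NormedSpace ℝ E] {L : ℝ}
    (hL : 0 < L) (a₀ a₁ : E) : endpointShift L a₀ a₁ 0 = a₀ := by
  simp [endpointShift, hL.le]

theorem endpointShift_right {E : Type*} [NormedAddCommGroup E] [NormedSpace ℝ E] {L : ℝ}
    (hL : 0 < L) (a₀ a₁ : E) : endpointShift L a₀ a₁ L = a₁ := by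
  simp [endpointShift, hL.le, hL.ne']

theorem continuous_endpointShift {E : Type*} [NormedAddCommGroup E] [NormedSpace ℝ E] (L : ℝ)
    (a₀ a₁ : E) : Continuous (endpointShift L a₀ a₁) := by
  unfold endpointShift; fun_prop

theorem norm_endpointShift_le {E : Type*} [NormedAddCommGroup E] [NormedSpace ℝ E] {L e : ℝ}
    (hL : 0 < L) {a₀ a₁ : E} (h₀ : ‖a₀‖ ≤ e) (h₁ : ‖a₁‖ ≤ e) (t : ℝ) :
    ‖endpointShift L a₀ a₁ t‖ ≤ e := by
  have e1 : endpointShift L a₀ a₁ t =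
      (1 - max 0 (min L t) / L) • a₀ + (max 0 (min L t) / L) • a₁ := by
    simp only [endpointShift, smul_sub, sub_smul, one_smul]; abel
  have h2 : 0 ≤ max 0 (min L t) / L := div_nonneg (le_max_left _ _) hL.le
  have h3 : max 0 (min L t) / L ≤ 1 := (div_le_one hL).2 (max_le hL.le (min_le_left _ _))
  rw [e1]
  refine (norm_add_le _ _).trans ?_
  rw [norm_smul, norm_smul, Real.norm_of_nonneg h2, Real.norm_of_nonneg (sub_nonneg.2 h3)]
  nlinarith

theorem exists_lipBV_endpointShift {L : ℝ} (hL : 0 < L) : ∃ C : ℝ, 0 < C ∧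
    ∀ (a₀ a₁ w : EuclideanSpace ℝ (Fin m)) (e : ℝ), ‖a₀‖ ≤ e → ‖a₁‖ ≤ e → ‖w‖ ≤ e →
      ∀ i, LipBV L (C * e) fun t => (endpointShift L a₀ a₁ t + bubble L t • w) i := by
  obtain ⟨B, hB0, hB⟩ := LipBV.exists_bubble hL
  refine ⟨1 + (2 + 2 * L) * (2 / L * (L + 1)) + (2 + 2 * L) * B, by positivity,
    fun a₀ a₁ w e h₀ h₁ hw i => ?_⟩
  have hcomp : ∀ x : EuclideanSpace ℝ (Fin m), |x i| ≤ ‖x‖ := fun x => PiLp.norm_apply_le x i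
  have hx : |a₀ i| ≤ e := (hcomp _).trans h₀
  have hy : |(a₁ i - a₀ i) / L| ≤ 2 / L * e := by
    rw [abs_div, abs_of_pos hL, div_mul_eq_mul_div]
    gcongr
    refine (abs_sub _ _).trans ?_
    linarith [(hcomp a₁).trans h₁]
  have hz : |w i| ≤ e := (hcomp _).trans hw
  have e1 : (fun t => (endpointShift L a₀ a₁ t + bubble L t • w) i) =
      fun t => a₀ i + (a₁ i - a₀ i) / L * max 0 (min L t) + w i * bubble L t := by
    funext t
    simp [endpointShift]
    ring
  rw [e1]
  generalize a₀ i = x at *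
  generalize (a₁ i - x) / L = y at *
  generalize w i = z at *
  refine (((LipBV.const hL x).add ((LipBV.clamp hL).const_mul hL y)).add
    (hB.const_mul hL z)).mono ?_
  calc |x| + (2 + 2 * L) * (|y| * (L + 1)) + (2 + 2 * L) * (|z| * B)
      ≤ e + (2 + 2 * L) * (2 / L * e * (L + 1)) + (2 + 2 * L) * (e * B) := by gcongr
    _ = _ := by ring

theorem norm_add_sq_eq_of_norm_eq_one {T u : EuclideanSpace ℝ (Fin m)} (hT : ‖T‖ = 1) :
    ‖T + u‖ = Real.sqrt (1 + ∑ i, (T i * u i + T i * u i + u i * u i)) := by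
  rw [EuclideanSpace.norm_eq]
  congr 1
  have h2 : ∑ i, ‖T i‖ ^ 2 = 1 := by
    rw [← EuclideanSpace.norm_sq_eq, hT]; norm_num
  rw [← h2, ← Finset.sum_add_distrib]
  refine Finset.sum_congr rfl fun i _ => ?_
  simp only [PiLp.add_apply, Real.norm_eq_abs, sq_abs]
  ring

/-- As `|T| = 1`, `|T + u|² = 1 + Q` with `Q = ∑ (2 T u + u²)` of order `b` in `LipBV`. Then `|T +
u|⁻¹ - 1` is of order `b` too, and the difference of fields is this factor times `T + u`, plus `u`.
The threshold `b₀` gives `b² ≤ b` and `Q ≤ 1/2`. -/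
theorem exists_lipBV_normalize {L M : ℝ} (hL : 0 < L) (hM : 0 ≤ M) : ∃ C b₀ : ℝ, 0 < C ∧ 0 < b₀ ∧
    ∀ (T u : ℝ → EuclideanSpace ℝ (Fin m)) (b : ℝ), b ≤ b₀ → (∀ t, ‖T t‖ = 1) →
      (∀ i, LipBV L M fun t => T t i) → (∀ i, LipBV L b fun t => u t i) → 0 ≤ b →
      (∀ t, T t + u t ≠ 0) ∧
        ∀ i, LipBV L (C * b) fun t => normalize (T t + u t) i - T t i := by
  obtain ⟨k, hk⟩ : ∃ k : ℝ, k = 2 + 2 * L := ⟨_, rfl⟩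
  have hk0 : 0 < k := by rw [hk]; positivity
  obtain ⟨C3, hC3⟩ : ∃ c : ℝ, c = m * (k * M + k * M + k) := ⟨_, rfl⟩
  have hC30 : 0 ≤ C3 := by rw [hC3]; positivity
  refine ⟨k * ((1 + L) * 8 * C3 * (M + 1)) + 1, min 1 (1 / (2 * (C3 + 1))), by positivity,
    by positivity, fun T u b hb hT1 hT hu hb0 => ?_⟩
  have hb1 : b ≤ 1 := hb.trans (min_le_left _ _)
  have hbC : C3 * b ≤ 1 / 2 := by
    have := hb.trans (min_le_right _ _)
    rw [le_div_iff₀ (by positivity)] at this; nlinarith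
  have hQB : LipBV L (C3 * b) fun t => ∑ i, (T t i * u t i + T t i * u t i + u t i * u t i) := by
    have b1 := LipBV.sum hL (Finset.univ : Finset (Fin m))
      (f := fun i t => T t i * u t i + T t i * u t i + u t i * u t i)
      fun i => (((hT i).mul hL (hu i)).add ((hT i).mul hL (hu i))).add ((hu i).mul hL (hu i))
    refine b1.mono ?_
    rw [Finset.card_univ, Fintype.card_fin, ← hk]
    have hbb : b * b ≤ b := by nlinarith
    calc (m : ℝ) * (k * (M * b) + k * (M * b) + k * (b * b))
        ≤ m * (k * (M * b) + k * (M * b) + k * b) := by gcongr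
      _ = C3 * b := by rw [hC3]; ring
  have hnorm := fun t => norm_add_sq_eq_of_norm_eq_one (u := u t) (hT1 t)
  generalize hQ : (fun t => ∑ i, (T t i * u t i + T t i * u t i + u t i * u t i)) = Q at hQB
  have hQt : ∀ t, ∑ i, (T t i * u t i + T t i * u t i + u t i * u t i) = Q t := fun t =>
    congrFun hQ t
  simp only [hQt] at hnorm
  have hg := hQB.inv_sqrt_sub_one hL hbC
  have hpos : ∀ t, 0 < 1 + Q t := fun t => by
    linarith [(abs_le.1 ((hQB.abs_le t).trans hbC)).1]
  refine ⟨fun t h => ?_, fun i => ?_⟩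
  · have h2 := hnorm t
    rw [h, norm_zero] at h2
    exact (Real.sqrt_pos.2 (hpos t)).ne h2
  · have e1 : (fun t => normalize (T t + u t) i - T t i) =
        fun t => ((Real.sqrt (1 + Q t))⁻¹ - 1) * (T t i + u t i) + u t i := by
      funext t
      have : normalize (T t + u t) i = (Real.sqrt (1 + Q t))⁻¹ * (T t i + u t i) := by
        rw [NormedSpace.normalize, hnorm]
        simp [mul_add]
      rw [this]; ring
    rw [e1]
    refine ((hg.mul hL (((hT i).add (hu i)).mono (b := M + 1) (by linarith))).add (hu i)).mono
      (le_of_eq ?_)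
    rw [hk]; ring

theorem norm_integral_exp_smul_sub_le {L s : ℝ} (hL : 0 < L) {S : ℝ → ℝ} (hSc : Continuous S)
    {T : ℝ → EuclideanSpace ℝ (Fin m)} (hTc : Continuous T) (hT1 : ∀ t, ‖T t‖ = 1)
    (hS : ∀ t, |Real.exp (S t) - 1| ≤ s) :
    ‖(∫ t, Real.exp (S t) • T t ∂(sigmaMeasure L)) - ∫ t, T t ∂(sigmaMeasure L)‖ ≤ s * L := by
  have hSi : Integrable (fun t => Real.exp (S t) • T t) (sigmaMeasure L) :=
    (show Continuous fun t => Real.exp (S t) • T t from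
      (Real.continuous_exp.comp hSc).smul hTc).continuousOn.integrableOn_Icc
  rw [← integral_sub hSi hTc.continuousOn.integrableOn_Icc]
  have := norm_integral_le_of_norm_le_const (μ := sigmaMeasure L) (C := s)
    (f := fun t => Real.exp (S t) • T t - T t) (Filter.Eventually.of_forall fun t => by
      have h2 : Real.exp (S t) • T t - T t = (Real.exp (S t) - 1) • T t := by
        rw [sub_smul, one_smul]
      rw [h2, norm_smul, hT1, mul_one]
      exact hS t)
  rwa [show (sigmaMeasure L).real univ = L by simp [Measure.real, hL.le]] at this

theorem norm_integral_normalize_add_sub_le {L e : ℝ} (hL : 0 < L)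
    {T v : ℝ → EuclideanSpace ℝ (Fin m)} (hTc : Continuous T) (hvc : Continuous v)
    (hT1 : ∀ t, ‖T t‖ = 1) (hv : ∀ t, ‖v t‖ ≤ e) (he : e ≤ 1 / 2) :
    ‖(∫ t, normalize (T t + v t) ∂(sigmaMeasure L)) - ∫ t, T t ∂(sigmaMeasure L)‖ ≤
      4 * e * L := by
  have hlow : ∀ t, 1 / 2 ≤ ‖T t + v t‖ := by
    intro t
    have h2 := norm_sub_norm_le (T t) (-v t)
    rw [sub_neg_eq_add, norm_neg, hT1] at h2
    linarith [hv t]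
  have hT0 : ∀ t, T t ≠ 0 := fun t h => by
    have := hT1 t; rw [h, norm_zero] at this; linarith
  have hc1 : Continuous fun t => normalize (T t + v t) := by
    have h1 : Continuous fun t => T t + v t := hTc.add hvc
    exact (h1.norm.inv₀ fun t h => by have := hlow t; rw [h] at this; linarith).smul h1
  have i1 : Integrable (fun t => normalize (T t + v t)) (sigmaMeasure L) :=
    hc1.continuousOn.integrableOn_Icc
  rw [← integral_sub i1 hTc.continuousOn.integrableOn_Icc]
  have := norm_integral_le_of_norm_le_const (μ := sigmaMeasure L) (C := 4 * e)
    (f := fun t => normalize (T t + v t) - T t) (Filter.Eventually.of_forall fun t => by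
      have h2 := norm_normalize_sub_normalize_le (hlow t) (hT0 t)
      rw [normalize_eq_self_of_norm_eq_one (hT1 t), add_sub_cancel_left] at h2
      linarith [hv t])
  rwa [show (sigmaMeasure L).real univ = L by simp [Measure.real, hL.le]] at this

/-- A field of unit vectors `T` together with a small strain `S` can be corrected to a field of unit
vectors with prescribed boundary values and prescribed integral. -/
theorem exists_correction {L M δ : ℝ} (hL : 0 < L) (hδ : 0 < δ) (hδ1 : δ ≤ 1) (hM : 0 ≤ M) :
    ∃ C e₀ : ℝ, 0 < C ∧ 0 < e₀ ∧ ∀ (S : ℝ → ℝ) (T : ℝ → EuclideanSpace ℝ (Fin m))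
      (N₀ N₁ D : EuclideanSpace ℝ (Fin m)) (e : ℝ), e ≤ e₀ → LipBV L e S →
      (∀ i, LipBV L M fun t => T t i) → (∀ t, ‖T t‖ = 1) →
      ‖∫ t, T t ∂(sigmaMeasure L)‖ ≤ L * (1 - 2 * δ) → ‖N₀‖ = 1 → ‖N₁‖ = 1 →
      ‖T 0 - N₀‖ ≤ e → ‖T L - N₁‖ ≤ e →
      ‖(∫ t, Real.exp (S t) • T t ∂(sigmaMeasure L)) - D‖ ≤ e →
      ∃ X : ℝ → EuclideanSpace ℝ (Fin m), (∀ t, ‖X t‖ = 1) ∧ X 0 = N₀ ∧ X L = N₁ ∧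
        ∫ t, X t ∂(sigmaMeasure L) = D ∧ (∀ i, LipBV L (C * e) fun t => X t i - T t i) ∧
        ∀ i, LipBV L (C * e) fun t => X t i - Real.exp (S t) * T t i := by
  obtain ⟨d, q, R, hd, hd2, hq, hR, hsteer⟩ :=
    exists_steering (E := EuclideanSpace ℝ (Fin m)) hL hδ hδ1 (M := m * M) (by positivity)
  obtain ⟨C1, hC1, hshift⟩ := exists_lipBV_endpointShift (m := m) hL
  obtain ⟨C2, b₀, hC2, hb₀, hnormalize⟩ := exists_lipBV_normalize (m := m) hL hM
  -- `A e` bounds the residual at `w = 0`: normalizing the shifted field costs `4 e L`, replacing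
  -- `e^S T` by `T` costs `3 (1 + L) e L`, and the integral of `e^S T` misses `D` by at most `e`.
  obtain ⟨A, hA⟩ : ∃ A : ℝ, A = 4 * L + (1 + L) * 3 * L + 1 := ⟨_, rfl⟩
  have hA0 : 0 < A := by rw [hA]; positivity
  -- `Q e` dominates both the boundary shifts, at most `e`, and the steering vector, at most `A e /
  -- q`.
  obtain ⟨Q, hQ⟩ : ∃ Q : ℝ, Q = max 1 (A / q) := ⟨_, rfl⟩
  have hQ1 : 1 ≤ Q := by rw [hQ]; exact le_max_left _ _
  have hQA : A / q ≤ Q := by rw [hQ]; exact le_max_right _ _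
  obtain ⟨C5, hC5⟩ : ∃ c : ℝ, c = C2 * (C1 * Q) := ⟨_, rfl⟩
  have hC50 : 0 < C5 := by rw [hC5]; positivity
  obtain ⟨C6, hC6⟩ : ∃ c : ℝ, c = C5 + (2 + 2 * L) * ((2 + 2 * L) * ((1 + L) * 3 * M)) := ⟨_, rfl⟩
  have hC56 : C5 ≤ C6 := by
    have : 0 ≤ (2 + 2 * L) * ((2 + 2 * L) * ((1 + L) * 3 * M)) := by positivity
    linarith
  have hC60 : 0 < C6 := hC50.trans_le hC56
  -- The four caps on `e` serve, in order, the elementary normalization bounds, the smallness of the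
  -- shift in the steering lemma, the steering radius, and the threshold of the regularity estimate.
  refine ⟨C6, min (min (1 / 2) d) (min (q * R / A) (b₀ / (C1 * Q))), hC60, by positivity,
    fun S T N₀ N₁ D e he hS hT hT1 hmean hN₀ hN₁ h0 h1 hD => ?_⟩
  have he0 : 0 ≤ e := hS.nonneg
  have he1 : e ≤ 1 / 2 := he.trans ((min_le_left _ _).trans (min_le_left _ _))
  have hed : e ≤ d := he.trans ((min_le_left _ _).trans (min_le_right _ _))
  have heR : A * e ≤ q * R := by
    have := he.trans ((min_le_right _ _).trans (min_le_left _ _))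
    rw [le_div_iff₀ hA0] at this; linarith
  have heC : C1 * (Q * e) ≤ b₀ := by
    have := he.trans ((min_le_right _ _).trans (min_le_right _ _))
    rw [le_div_iff₀ (by positivity)] at this; linarith
  have ha₀e : ‖N₀ - T 0‖ ≤ e := by rw [norm_sub_rev]; exact h0
  have ha₁e : ‖N₁ - T L‖ ≤ e := by rw [norm_sub_rev]; exact h1
  have hvc := continuous_endpointShift L (N₀ - T 0) (N₁ - T L)
  have hvd := norm_endpointShift_le hL ha₀e ha₁e
  have hTc : Continuous T := continuous_of_lipBV_components hT
  have hE := hS.exp_sub_one hL (by linarith)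
  have hstart : ‖(∫ t, normalize (T t + endpointShift L (N₀ - T 0) (N₁ - T L) t)
      ∂(sigmaMeasure L)) - D‖ ≤ q * (A * e / q) := by
    have n1 := norm_integral_normalize_add_sub_le hL hTc hvc hT1 hvd he1
    have n2 := norm_integral_exp_smul_sub_le hL hS.lip.continuous hTc hT1 hE.abs_le
    have e2 : q * (A * e / q) = 4 * e * L + (1 + L) * 3 * e * L + e := by
      rw [hA]; field_simp
    rw [e2]
    generalize (∫ t, normalize (T t + endpointShift L (N₀ - T 0) (N₁ - T L) t)
      ∂(sigmaMeasure L)) = I1 at *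
    generalize ∫ t, T t ∂(sigmaMeasure L) = I2 at *
    generalize ∫ t, Real.exp (S t) • T t ∂(sigmaMeasure L) = I3 at *
    have e3 : I1 - D = (I1 - I2) + (-(I3 - I2)) + (I3 - D) := by abel
    rw [e3]
    refine (norm_add₃_le).trans ?_
    rw [norm_neg]
    linarith
  obtain ⟨w, hw, hwD⟩ := hsteer T _ hT1 (norm_sub_le_of_lipBV_components hT) hmean hvc
    (fun t => (hvd t).trans hed) D (A * e / q) hstart (by
      rw [div_le_iff₀ hq]; linarith)
  have hQe : e ≤ Q * e := by nlinarith
  have huB := hshift (N₀ - T 0) (N₁ - T L) w (Q * e) (ha₀e.trans hQe) (ha₁e.trans hQe)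
    (hw.trans (by rw [mul_div_right_comm]; gcongr))
  -- The bubble vanishes at the end points, so steering does not spoil the boundary tangents fixed
  -- by the shift.
  have hb0 : bubble L 0 = 0 := by rw [bubble_of_mem ⟨le_rfl, hL.le⟩]; ring
  have hbL : bubble L L = 0 := by rw [bubble_of_mem ⟨hL.le, le_rfl⟩]; ring
  have hu0 : T 0 + (endpointShift L (N₀ - T 0) (N₁ - T L) 0 + bubble L 0 • w) = N₀ := by
    rw [endpointShift_zero hL, hb0]; simp
  have huL : T L + (endpointShift L (N₀ - T 0) (N₁ - T L) L + bubble L L • w) = N₁ := by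
    rw [endpointShift_right hL, hbL]; simp
  obtain ⟨u, hu⟩ : ∃ u : ℝ → EuclideanSpace ℝ (Fin m),
    ∀ t, endpointShift L (N₀ - T 0) (N₁ - T L) t + bubble L t • w = u t := ⟨_, fun t => rfl⟩
  simp only [hu] at huB hu0 huL hwD
  obtain ⟨hne, hX5⟩ := hnormalize T u (C1 * (Q * e)) heC hT1 hT huB (by positivity)
  have hC5e : C2 * (C1 * (Q * e)) = C5 * e := by rw [hC5]; ring
  rw [hC5e] at hX5
  refine ⟨fun t => normalize (T t + u t), fun t => norm_normalize (hne t), ?_, ?_, hwD,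
    fun i => (hX5 i).mono (by gcongr), fun i => ?_⟩
  · simp only [hu0]
    exact normalize_eq_self_of_norm_eq_one hN₀
  · simp only [huL]
    exact normalize_eq_self_of_norm_eq_one hN₁
  · have e1 : (fun t => normalize (T t + u t) i - Real.exp (S t) * T t i) =
        fun t => (normalize (T t + u t) i - T t i) - (Real.exp (S t) - 1) * T t i := by
      funext t; ring
    rw [e1]
    refine ((hX5 i).sub hL (hE.mul hL (hT i))).mono (le_of_eq ?_)
    rw [hC6]; ring

end Correction

/-! ### Regular representatives of the curve, its tangent and its strain -/

section Representatives

open scoped NNReal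

theorem ae_norm_le_of_eLpNorm_top_le {α F : Type*} [MeasurableSpace α] {μ : Measure α}
    [NormedAddCommGroup F] {f : α → F} {B : ℝ} (hB : 0 ≤ B)
    (h : eLpNorm f ∞ μ ≤ ENNReal.ofReal B) : ∀ᵐ t ∂μ, ‖f t‖ ≤ B := by
  rw [eLpNorm_exponent_top] at h
  filter_upwards [ae_le_eLpNormEssSup (f := f) (μ := μ)] with t ht
  have h1 := ht.trans h
  rw [← ofReal_norm, ENNReal.ofReal_le_ofReal_iff hB] at h1
  exact h1

theorem integral_norm_le_of_eLpNorm_one_le {α F : Type*} [MeasurableSpace α] {μ : Measure α}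
    [NormedAddCommGroup F] {f : α → F} (hf : AEStronglyMeasurable f μ) {B : ℝ} (hB : 0 ≤ B)
    (h : eLpNorm f 1 μ ≤ ENNReal.ofReal B) : ∫ t, ‖f t‖ ∂μ ≤ B := by
  rw [eLpNorm_one_eq_lintegral_enorm] at h
  rw [integral_norm_eq_lintegral_enorm hf]
  exact ENNReal.toReal_le_of_le_ofReal hB h

variable {F : Type*} [NormedAddCommGroup F] [InnerProductSpace ℝ F] {L : ℝ}

theorem memSobolev_of_sobolevNorm_lt_top {k : ℕ} {p : ℝ≥0∞} {u : ℝ → F}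
    (h : sobolevNorm L k p u < ∞) : MemSobolev L k p u := by
  by_contra hn
  rw [sobolevNorm, if_neg hn] at h
  exact lt_irrefl _ h

/-- The derivative has bounded variation, so it is bounded by its mean plus its variation, `e / L +
e`, and the strain is Lipschitz. Mean `e / L` plus oscillation `L (e / L + e)` bounds the strain and
gives the factor `1 / L + 1 + L`. -/
theorem exists_strain_rep (hL : 0 < L) {σ : ℝ → ℝ} {e : ℝ} (he : 0 ≤ e)
    (h : tvNorm L 2 σ ≤ ENNReal.ofReal e) :
    ∃ S, LipBV L ((1 / L + 1 + L) * e) S ∧ σ =ᵐ[sigmaMeasure L] S := by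
  have h1 : sobolevNorm L 1 1 σ ≤ ENNReal.ofReal e := le_self_add.trans h
  have h2 : totalVariation L (weakDeriv L σ) ≤ ENNReal.ofReal e := le_add_self.trans h
  have hmem := memSobolev_of_sobolevNorm_lt_top (h1.trans_lt ENNReal.ofReal_lt_top)
  rw [sobolevNorm, if_pos hmem, Finset.sum_range_succ, Finset.sum_range_one] at h1
  obtain ⟨hm0, hwd, hm1⟩ := hmem
  have hw := hwd.hasWeakDeriv
  have i0 : ∫ t, ‖σ t‖ ∂(sigmaMeasure L) ≤ e :=
    integral_norm_le_of_eLpNorm_one_le hm0.1 he (le_self_add.trans h1)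
  have i1 : ∫ t, ‖weakDeriv L σ t‖ ∂(sigmaMeasure L) ≤ e :=
    integral_norm_le_of_eLpNorm_one_le hw.2.1.1 he (le_add_self.trans h1)
  have hB0 : 0 ≤ e / L + e := by positivity
  obtain ⟨S, hS, hσS, hdS, hclamp⟩ := hw.exists_lipschitz hL (B := (e / L + e).toNNReal) (by
    filter_upwards [ae_abs_le_of_totalVariation_le hL hw.2.1 he h2] with t ht
    rw [Real.coe_toNNReal _ hB0]
    refine ht.trans ?_
    gcongr
    exact i1)
  have hdist : ∀ s t, |S s - S t| ≤ (e / L + e) * |s - t| := fun s t => by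
    have := hS.dist_le_mul s t
    rwa [Real.coe_toNNReal _ hB0] at this
  have hSi : Integrable S (sigmaMeasure L) := hw.1.congr hσS
  have iS : ∫ t, |S t| ∂(sigmaMeasure L) ≤ e := by
    rw [← integral_congr_ae (hσS.mono fun t ht => congrArg abs ht)]
    exact i0
  have hbd : ∀ t ∈ Icc 0 L, |S t| ≤ (1 / L + 1 + L) * e := by
    intro t ht
    have h3 : ∀ᵐ s ∂(sigmaMeasure L), |S t| - (e / L + e) * L ≤ |S s| := by
      filter_upwards [ae_restrict_mem measurableSet_Icc] with s hs
      have h4 : |t - s| ≤ L := abs_le.2 ⟨by linarith [ht.1, hs.2], by linarith [ht.2, hs.1]⟩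
      have h5 : |S t - S s| ≤ (e / L + e) * L := (hdist t s).trans (by gcongr)
      linarith [abs_sub_abs_le_abs_sub (S t) (S s)]
    have h4 := integral_mono_ae (integrable_const _) hSi.abs h3
    rw [integral_const, smul_eq_mul,
      show (sigmaMeasure L).real univ = L by simp [Measure.real, hL.le]] at h4
    have h5 : L * (|S t| - (e / L + e) * L) ≤ e := h4.trans iS
    have h6 : |S t| - (e / L + e) * L ≤ e / L := by
      rw [le_div_iff₀ hL]; linarith
    have h7 : (e / L + e) * L = e + e * L := by field_simp
    have h8 : (1 / L + 1 + L) * e = e / L + e + e * L := by ring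
    linarith
  refine ⟨S, LipBV.of_dist_le (fun t => ?_) (fun s t => (hdist s t).trans ?_) ?_, hσS⟩
  · rw [← hclamp t]
    exact hbd _ ⟨le_max_left _ _, max_le hL.le (min_le_left _ _)⟩
  · gcongr
    have : 0 ≤ L * e := by positivity
    have h8 : (1 / L + 1 + L) * e = e / L + e + L * e := by ring
    linarith
  · rw [totalVariation_congr hdS]
    refine h2.trans (ENNReal.ofReal_le_ofReal ?_)
    have : 0 ≤ 1 / L * e + L * e := by positivity
    linarith

variable {m : ℕ}

theorem ae_of_ae_lineElement {γ : CurveClass m L} (hd : WeaklyDifferentiable L γ)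
    (hne : ∀ᵐ t ∂(sigmaMeasure L), weakDeriv L γ t ≠ 0) {p : ℝ → Prop}
    (h : ∀ᵐ t ∂(lineElement γ), p t) : ∀ᵐ t ∂(sigmaMeasure L), p t := by
  refine (withDensity_absolutelyContinuous' ?_ ?_).ae_le h
  · exact hd.hasWeakDeriv.2.1.1.norm.aemeasurable.ennreal_ofReal
  · filter_upwards [hne] with t ht
    simpa [speed] using ht

theorem LipBV.exp (hL : 0 < L) {S : ℝ → ℝ} {a : ℝ} (hS : LipBV L a S) (ha : a ≤ 1) :
    LipBV L (1 + (1 + L) * 3) fun t => Real.exp (S t) := by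
  have h := (LipBV.const hL 1).add (hS.exp_sub_one hL ha)
  have e1 : (fun t => 1 + (Real.exp (S t) - 1)) = fun t => Real.exp (S t) := by
    funext t; ring
  rw [e1, abs_one] at h
  refine h.mono ?_
  have : (1 + L) * 3 * a ≤ (1 + L) * 3 * 1 := by gcongr
  linarith

/-- `S`, `T` and `Γ` are Lipschitz representatives of the strain, the unit tangent and the curve
itself. -/
structure IsRegularRep (γ : CurveClass m L) (S : ℝ → ℝ) (T Γ : ℝ → EuclideanSpace ℝ (Fin m)) :
    Prop where
  curve : γ =ᵐ[sigmaMeasure L] Γ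
  tangent : unitTangent γ =ᵐ[sigmaMeasure L] T
  speed_eq : speed γ =ᵐ[sigmaMeasure L] fun t => Real.exp (S t)
  lip : ∃ C, LipschitzWith C Γ
  deriv_curve : deriv Γ =ᵐ[sigmaMeasure L] fun t => Real.exp (S t) • T t
  deriv_tangent : deriv T =ᵐ[sigmaMeasure L] fun t => Real.exp (S t) • curvature γ t

/-- The derivative of the tangent is `e^S κ`, where `κ` has sup norm and variation at most `K` and
`e^S` is in `LipBV`, so the product rule applies. The summands of the final bound are `1` for the
unit length, `3 K` for the Lipschitz constant, and the variation of `e^S κ`. -/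
theorem exists_regular_rep (hL : 0 < L) {Λ K η e : ℝ} (hK : 0 ≤ K) (he : 0 ≤ e)
    (he1 : (1 / L + 1 + L) * e ≤ 1) {γ : CurveClass m L} (hγ : γ ∈ restorationPriors m L Λ K η)
    (h : tvNorm L 2 (logStrain γ) ≤ ENNReal.ofReal e) :
    ∃ (S : ℝ → ℝ) (T Γ : ℝ → EuclideanSpace ℝ (Fin m)), IsRegularRep γ S T Γ ∧
      LipBV L ((1 / L + 1 + L) * e) S ∧
      (∀ i, LipBV L (1 + 3 * K + (1 + (1 + L) * 3) * K * (1 + L)) fun t => T t i) ∧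
      ∀ t, ‖T t‖ = 1 := by
  obtain ⟨⟨⟨⟨⟨-, hγd, hγ1⟩, hne, -⟩, -⟩, -, hτ, -⟩, -, htv⟩ := hγ
  obtain ⟨S, hS, hσS⟩ := exists_strain_rep hL he h
  -- the curvature bound
  have hmemτ : MemSobolevAlong γ (2 - 1) ∞ (unitTangent γ) := by
    by_contra hn
    rw [sobolevNormAlong, if_neg hn] at hτ
    exact ENNReal.ofReal_ne_top (top_le_iff.1 hτ)
  rw [sobolevNormAlong, if_pos hmemτ, show (2 - 1 + 1 : ℕ) = 1 + 1 from rfl,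
    Finset.sum_range_succ] at hτ
  obtain ⟨-, hτd, -⟩ := hmemτ
  have hκ : ∀ᵐ t ∂(sigmaMeasure L), ‖curvature γ t‖ ≤ K :=
    ae_of_ae_lineElement hγd hne (ae_norm_le_of_eLpNorm_top_le hK (le_add_self.trans hτ))
  have hκtv : totalVariation L (curvature γ) ≤ ENNReal.ofReal K := htv
  have hspeed : speed γ =ᵐ[sigmaMeasure L] fun t => Real.exp (S t) := by
    filter_upwards [hσS, hne] with t ht htn
    rw [← ht, logStrain, Real.exp_log]
    exact norm_pos_iff.2 htn
  have hexp : ∀ t, Real.exp (S t) ≤ 3 := fun t =>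
    (Real.exp_le_exp.2 ((le_abs_self _).trans ((hS.abs_le t).trans he1))).trans
      (by linarith [Real.exp_one_lt_d9])
  have hτ' : weakDeriv L (unitTangent γ) =ᵐ[sigmaMeasure L]
      fun t => Real.exp (S t) • curvature γ t := by
    filter_upwards [hspeed, hne] with t ht htn
    rw [← ht, curvature, unitSpeedDeriv, smul_inv_smul₀]
    exact norm_ne_zero_iff.2 htn
  have hwτ := hτd.hasWeakDeriv
  obtain ⟨T, hT, hτT, hdT, hTc⟩ := hwτ.exists_lipschitz hL (B := (3 * K).toNNReal) (by
    filter_upwards [hτ', hκ] with t ht htK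
    rw [ht, norm_smul, Real.norm_of_nonneg (Real.exp_pos _).le, Real.coe_toNNReal _ (by positivity)]
    exact mul_le_mul (hexp t) htK (norm_nonneg _) (by norm_num))
  have hdT' := hdT.trans hτ'
  have hT1I : ∀ t ∈ Icc 0 L, ‖T t‖ = 1 := by
    refine eqOn_of_ae_eq_of_continuousOn hL hT.continuous.norm.continuousOn
      (g := fun _ => (1 : ℝ)) continuousOn_const ?_
    filter_upwards [hτT, hne] with t ht htn
    rw [← ht, unitTangent, unitSpeedDeriv, norm_smul, norm_inv, speed, norm_norm,
      inv_mul_cancel₀ (norm_ne_zero_iff.2 htn)]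
  have hT1 : ∀ t, ‖T t‖ = 1 := fun t => by
    rw [← hTc t]
    exact hT1I _ ⟨le_max_left _ _, max_le hL.le (min_le_left _ _)⟩
  have hγ' : weakDeriv L γ =ᵐ[sigmaMeasure L] fun t => Real.exp (S t) • T t := by
    filter_upwards [hspeed, hne, hτT] with t ht htn htT
    rw [← ht, ← htT, unitTangent, unitSpeedDeriv, smul_inv_smul₀]
    exact norm_ne_zero_iff.2 htn
  obtain ⟨Γ, hΓ, hγΓ, hdΓ, -⟩ := hγd.hasWeakDeriv.exists_lipschitz hL (B := 3) (by
    filter_upwards [hγ'] with t ht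
    rw [ht, norm_smul, Real.norm_of_nonneg (Real.exp_pos _).le, hT1, mul_one]
    exact hexp t)
  refine ⟨S, T, Γ, ⟨hγΓ, hτT, hspeed, ⟨3, hΓ⟩, hdΓ.trans hγ', hdT'⟩, hS, fun i => ?_, hT1⟩
  have hE := LipBV.exp hL hS he1
  -- Integrability of the curvature is recovered by multiplying the weak derivative of the tangent
  -- by the bounded function `e^{-S}`.
  have hκint : Integrable (curvature γ) (sigmaMeasure L) := by
    have i1 : Integrable (fun t => Real.exp (-S t) • weakDeriv L (unitTangent γ) t)
        (sigmaMeasure L) := by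
      refine hwτ.2.1.bdd_smul 3
        (show Continuous fun t => Real.exp (-S t) from
          Real.continuous_exp.comp hS.lip.continuous.neg).aestronglyMeasurable
        (Filter.Eventually.of_forall fun t => ?_)
      rw [Real.norm_of_nonneg (Real.exp_pos _).le]
      exact (Real.exp_le_exp.2 ((neg_le_abs _).trans ((hS.abs_le t).trans he1))).trans
        (by linarith [Real.exp_one_lt_d9])
    refine i1.congr ?_
    filter_upwards [hτ'] with t ht
    rw [ht, smul_smul, ← Real.exp_add, neg_add_cancel, Real.exp_zero, one_smul]
  have hκi : Integrable (fun t => curvature γ t i) (sigmaMeasure L) :=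
    (EuclideanSpace.proj (𝕜 := ℝ) i).integrable_comp hκint
  have hdTi : deriv (fun t => T t i) =ᵐ[sigmaMeasure L]
      fun t => Real.exp (S t) * curvature γ t i := by
    filter_upwards [hdT', ae_restrict_of_ae hT.ae_differentiableAt_real] with t ht htd
    have := ((EuclideanSpace.proj (𝕜 := ℝ) i).hasFDerivAt.comp_hasDerivAt t htd.hasDerivAt).deriv
    rw [ht] at this
    exact this
  have hKi : 0 ≤ (1 + (1 + L) * 3) * K * (1 + L) := by positivity
  refine LipBV.of_dist_le (fun t => ?_) (fun s t => ?_) ?_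
  · have := PiLp.norm_apply_le (T t) i
    rw [hT1, Real.norm_eq_abs] at this
    linarith
  · have h1 := PiLp.norm_apply_le (T s - T t) i
    have h2 := hT.dist_le_mul s t
    rw [Real.coe_toNNReal _ (by positivity), dist_eq_norm, Real.dist_eq] at h2
    refine (h1.trans h2).trans ?_
    gcongr
    linarith
  · have h1 := totalVariation_mul_le hL hE.lip hE.abs_le hκi (G := K)
      (hκ.mono fun t ht => (PiLp.norm_apply_le (curvature γ t) i).trans ht) hK
      (totalVariation_component_le hK hκtv i)
    rw [totalVariation_congr hdTi]
    refine h1.trans (ENNReal.ofReal_le_ofReal ?_)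
    rw [Real.coe_toNNReal _ hE.nonneg]
    nlinarith

end Representatives

/-! ### The restored curve -/

section Restoration

open scoped NNReal

variable {m : ℕ} {L : ℝ}

theorem lipschitzWith_of_lipBV_components {a : ℝ} (ha : 0 ≤ a) {T : ℝ → EuclideanSpace ℝ (Fin m)}
    (hT : ∀ i, LipBV L a fun t => T t i) : LipschitzWith (m * a).toNNReal T :=
  LipschitzWith.of_dist_le_mul fun s t => by
    rw [dist_eq_norm, Real.dist_eq, Real.coe_toNNReal _ (by positivity)]
    exact norm_sub_le_of_lipBV_components hT s t

theorem norm_deriv_le_of_lipBV_components {a : ℝ} (ha : 0 ≤ a)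
    {T : ℝ → EuclideanSpace ℝ (Fin m)} (hT : ∀ i, LipBV L a fun t => T t i) (t : ℝ) :
    ‖deriv T t‖ ≤ m * a := by
  have := norm_deriv_le_of_lipschitz (lipschitzWith_of_lipBV_components ha hT) (x₀ := t)
  rwa [Real.coe_toNNReal _ (by positivity)] at this

theorem norm_le_of_lipBV_components {a : ℝ} {T : ℝ → EuclideanSpace ℝ (Fin m)}
    (hT : ∀ i, LipBV L a fun t => T t i) (t : ℝ) : ‖T t‖ ≤ m * a := by
  refine (EuclideanSpace.norm_le_sum_abs (T t)).trans ((Finset.sum_le_sum fun i _ => (hT i).abs_le t).trans (le_of_eq ?_))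
  simp

theorem eLpNorm_one_sigma_le {F : Type*} [NormedAddCommGroup F] {f : ℝ → F} {B : ℝ}
    (hL : 0 < L) (h : ∀ᵐ t ∂(sigmaMeasure L), ‖f t‖ ≤ B) :
    eLpNorm f 1 (sigmaMeasure L) ≤ ENNReal.ofReal (L * B) := by
  refine (eLpNorm_le_of_ae_bound h).trans (le_of_eq ?_)
  rw [ENNReal.ofReal_mul hL.le]
  simp

/-- The class `LipBV` controls `d₁ = Δ'` together with its first derivative and the variation of the
latter, and `Δ` itself follows by integration from `Δ 0`. The four summands are the `L¹` norms of
orders zero to two and the top variation. -/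
theorem tvNorm_three_le (hL : 0 < L) {d Δ d₁ : ℝ → EuclideanSpace ℝ (Fin m)} {C : ℝ≥0} {a b : ℝ}
    (ha : 0 ≤ a) (hb : 0 ≤ b) (hΔ : LipschitzWith C Δ) (hd : d =ᵐ[sigmaMeasure L] Δ)
    (hd₁ : deriv Δ =ᵐ[sigmaMeasure L] d₁) (hlip : ∀ i, LipBV L a fun t => d₁ t i)
    (h0 : ‖Δ 0‖ ≤ b) :
    tvNorm L 3 d ≤ ENNReal.ofReal
      (L * (b + L * (m * a)) + L * (m * a) + L * (m * a) + m * a) := by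
  have hma : 0 ≤ m * a := by positivity
  have hlip₁ := lipschitzWith_of_lipBV_components ha hlip
  have w1 : HasWeakDeriv L d d₁ := (hΔ.hasWeakDeriv hL).congr hd.symm hd₁
  have e1 : weakDeriv L d =ᵐ[sigmaMeasure L] d₁ := w1.weakDeriv_ae_eq
  have w2 : HasWeakDeriv L (weakDeriv L d) (deriv d₁) :=
    (hlip₁.hasWeakDeriv hL).congr e1.symm Filter.EventuallyEq.rfl
  have e2 : weakDeriv L (weakDeriv L d) =ᵐ[sigmaMeasure L] deriv d₁ := w2.weakDeriv_ae_eq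
  have hmem : MemSobolev L 2 1 d :=
    ⟨memLp_one_iff_integrable.2 w1.1, ⟨_, w1⟩, memLp_one_iff_integrable.2 w2.1, ⟨_, w2⟩,
      memLp_one_iff_integrable.2 (w2.2.1.congr e2.symm)⟩
  have hbd : ∀ t ∈ Icc 0 L, ‖Δ t‖ ≤ b + L * (m * a) := by
    intro t ht
    have h1 := hΔ.intervalIntegral_deriv_eq_sub 0 t
    have h2 : ‖∫ s in 0..t, deriv Δ s‖ ≤ m * a * |t - 0| := by
      refine intervalIntegral.norm_integral_le_of_norm_le_const_ae ?_
      filter_upwards [(ae_restrict_iff' measurableSet_Icc).1 hd₁] with s hs hst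
      rw [uIoc_of_le ht.1] at hst
      rw [hs ⟨hst.1.le, hst.2.trans ht.2⟩]
      exact norm_le_of_lipBV_components hlip s
    rw [h1, sub_zero, abs_of_nonneg ht.1] at h2
    have h3 : m * a * t ≤ m * a * L := by gcongr; exact ht.2
    have h4 := norm_le_norm_add_norm_sub' (Δ t) (Δ 0)
    linarith
  have n0 : eLpNorm d 1 (sigmaMeasure L) ≤ ENNReal.ofReal (L * (b + L * (m * a))) := by
    refine eLpNorm_one_sigma_le hL ?_
    filter_upwards [hd, ae_restrict_mem measurableSet_Icc] with t ht htI
    rw [ht]; exact hbd t htI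
  have n1 : eLpNorm (weakDeriv L d) 1 (sigmaMeasure L) ≤ ENNReal.ofReal (L * (m * a)) := by
    refine eLpNorm_one_sigma_le hL ?_
    filter_upwards [e1] with t ht
    rw [ht]; exact norm_le_of_lipBV_components hlip t
  have n2 : eLpNorm (weakDeriv L (weakDeriv L d)) 1 (sigmaMeasure L) ≤
      ENNReal.ofReal (L * (m * a)) := by
    refine eLpNorm_one_sigma_le hL ?_
    filter_upwards [e2] with t ht
    rw [ht]; exact norm_deriv_le_of_lipBV_components ha hlip t
  have n3 : totalVariation L (weakDeriv L (weakDeriv L d)) ≤ ENNReal.ofReal (m * a) := by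
    rw [totalVariation_congr e2]
    have hcomp : ∀ i, (fun t => deriv d₁ t i) =ᵐ[sigmaMeasure L] deriv fun t => d₁ t i := by
      intro i
      filter_upwards [ae_restrict_of_ae hlip₁.ae_differentiableAt_real] with t ht
      exact ((EuclideanSpace.proj (𝕜 := ℝ) i).hasFDerivAt.comp_hasDerivAt t
        ht.hasDerivAt).deriv.symm
    have := totalVariation_le_sum (g := deriv d₁)
      (fun i => (hlip i).integrable_deriv.congr (hcomp i).symm) (V := fun _ => a) (fun _ => ha)
      fun i => by rw [totalVariation_congr (hcomp i)]; exact (hlip i).tv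
    simpa using this
  have hsob : sobolevNorm L (3 - 1) 1 d ≤
      ENNReal.ofReal (L * (b + L * (m * a)) + L * (m * a) + L * (m * a)) := by
    rw [show 3 - 1 = 2 from rfl, sobolevNorm, if_pos hmem, Finset.sum_range_succ,
      Finset.sum_range_succ, Finset.sum_range_one, ENNReal.ofReal_add (by positivity)
      (by positivity), ENNReal.ofReal_add (by positivity) (by positivity)]
    exact add_le_add (add_le_add n0 n1) n2
  rw [tvNorm, ENNReal.ofReal_add (by positivity) (by positivity)]
  exact add_le_add hsob n3

/-- The derivative of `T` is `e^S κ` and the line element is `e^S dt`, so one factor `e^{-S}`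
remains. -/
theorem IsRegularRep.bendingEnergy_eq {γ : CurveClass m L} {S : ℝ → ℝ}
    {T Γ : ℝ → EuclideanSpace ℝ (Fin m)} (h : IsRegularRep γ S T Γ) :
    bendingEnergy γ = 1 / 2 * ∫ t, Real.exp (-S t) * ‖deriv T t‖ ^ 2 ∂(sigmaMeasure L) := by
  rw [bendingEnergy]
  congr 1
  refine integral_congr_ae ?_
  filter_upwards [h.speed_eq, h.deriv_tangent] with t h1 h2
  rw [h1, h2, norm_smul, Real.norm_of_nonneg (Real.exp_pos _).le, Real.exp_neg]
  field_simp

theorem abs_bendingEnergy_sub_le (hL : 0 < L) {γ γ' : CurveClass m L} {S : ℝ → ℝ}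
    {T Γ T' Γ' : ℝ → EuclideanSpace ℝ (Fin m)} (h : IsRegularRep γ S T Γ)
    (h' : IsRegularRep γ' (fun _ => 0) T' Γ') (hSc : Continuous S) {s A b : ℝ} (hs : s ≤ 1)
    (hS : ∀ t, |S t| ≤ s) (hA : ∀ t, ‖deriv T t‖ ≤ A)
    (hb : ∀ᵐ t ∂(sigmaMeasure L), ‖deriv T' t - deriv T t‖ ≤ b) :
    |bendingEnergy γ' - bendingEnergy γ| ≤ 1 / 2 * (L * (b * (2 * A + b) + 2 * s * A ^ 2)) := by
  have hA0 : 0 ≤ A := (norm_nonneg _).trans (hA 0)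
  have hm : ∀ f : ℝ → EuclideanSpace ℝ (Fin m), AEStronglyMeasurable (fun t => ‖deriv f t‖ ^ 2)
      (sigmaMeasure L) := fun f =>
    ((stronglyMeasurable_deriv f).norm.pow 2).aestronglyMeasurable
  have hexp : ∀ t, |Real.exp (-S t) - 1| ≤ 2 * s := fun t => by
    have h1 := Real.abs_exp_sub_one_le (x := -S t) (by rw [abs_neg]; exact (hS t).trans hs)
    rw [abs_neg] at h1
    linarith [hS t]
  have i1 : Integrable (fun t => Real.exp (-(0 : ℝ)) * ‖deriv T' t‖ ^ 2) (sigmaMeasure L) := by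
    refine Integrable.const_mul (Integrable.of_bound (hm T') ((A + b) ^ 2) ?_) _
    filter_upwards [hb] with t ht
    rw [Real.norm_of_nonneg (by positivity)]
    have := norm_le_norm_add_norm_sub' (deriv T' t) (deriv T t)
    gcongr
    linarith [hA t]
  have i2 : Integrable (fun t => Real.exp (-S t) * ‖deriv T t‖ ^ 2) (sigmaMeasure L) := by
    refine (Integrable.of_bound (hm T) (A ^ 2) (Filter.Eventually.of_forall fun t => ?_)).bdd_mul
      (c := 1 + 2 * s) (Real.continuous_exp.comp hSc.neg).aestronglyMeasurable
      (Filter.Eventually.of_forall fun t => ?_)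
    · rw [Real.norm_of_nonneg (by positivity)]
      gcongr
      exact hA t
    · have h1 : Real.exp (-S t) ≤ 1 + 2 * s := by linarith [(abs_le.1 (hexp t)).2]
      simpa [abs_of_pos (Real.exp_pos _)] using h1
  rw [h.bendingEnergy_eq, h'.bendingEnergy_eq, ← mul_sub, ← integral_sub i1 i2, abs_mul,
    abs_of_pos (by norm_num : (0 : ℝ) < 1 / 2)]
  gcongr
  have := norm_integral_le_of_norm_le_const (μ := sigmaMeasure L)
    (C := b * (2 * A + b) + 2 * s * A ^ 2)
    (f := fun t => Real.exp (-(0 : ℝ)) * ‖deriv T' t‖ ^ 2 - Real.exp (-S t) * ‖deriv T t‖ ^ 2) (by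
      filter_upwards [hb] with t ht
      rw [neg_zero, Real.exp_zero, one_mul, Real.norm_eq_abs]
      have hb0 : 0 ≤ b := (norm_nonneg _).trans ht
      -- The first term measures the change of the tangent derivative, the second the deviation of
      -- the original curve from unit speed.
      have e1 : ‖deriv T' t‖ ^ 2 - Real.exp (-S t) * ‖deriv T t‖ ^ 2 =
          (‖deriv T' t‖ - ‖deriv T t‖) * (‖deriv T' t‖ + ‖deriv T t‖) -
            (Real.exp (-S t) - 1) * ‖deriv T t‖ ^ 2 := by ring
      rw [e1]
      refine (abs_sub _ _).trans ?_
      rw [abs_mul, abs_mul]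
      have h1 : |‖deriv T' t‖ - ‖deriv T t‖| ≤ b := (abs_norm_sub_norm_le _ _).trans ht
      have h2 : |‖deriv T' t‖ + ‖deriv T t‖| ≤ 2 * A + b := by
        rw [abs_of_nonneg (by positivity)]
        linarith [hA t, (abs_le.1 h1).2]
      have h3 : |‖deriv T t‖ ^ 2| ≤ A ^ 2 := by
        rw [abs_of_nonneg (by positivity)]
        gcongr
        exact hA t
      exact add_le_add (mul_le_mul h1 h2 (abs_nonneg _) hb0)
        (mul_le_mul (hexp t) h3 (abs_nonneg _) ((abs_nonneg _).trans (hexp t))))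
  rw [show (sigmaMeasure L).real univ = L by simp [Measure.real, hL.le], mul_comm] at this
  exact this

/-- A Lipschitz field of unit vectors with the right boundary values and the right integral is the
tangent field of a feasible curve. -/
theorem exists_feasible (hL : 0 < L) {D₀ D₁ N₀ N₁ : EuclideanSpace ℝ (Fin m)}
    {X : ℝ → EuclideanSpace ℝ (Fin m)} {C : ℝ≥0} (hX : LipschitzWith C X) (hX1 : ∀ t, ‖X t‖ = 1)
    (hX0 : X 0 = N₀) (hXL : X L = N₁) (hXD : ∫ t, X t ∂(sigmaMeasure L) = D₁ - D₀) :
    ∃ (γ : CurveClass m L) (Γ : ℝ → EuclideanSpace ℝ (Fin m)),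
      γ ∈ feasibleSet L ∞ D₀ D₁ N₀ N₁ ∧ IsRegularRep γ (fun _ => 0) X Γ ∧ Γ 0 = D₀ := by
  set Γ : ℝ → EuclideanSpace ℝ (Fin m) := fun t => D₀ + ∫ s in 0..t, X s with hΓ
  have hdΓ : deriv Γ = X := funext fun t =>
    ((hX.continuous.integral_hasStrictDerivAt 0 t).hasDerivAt.const_add D₀).deriv
  have hΓlip : LipschitzWith 1 Γ := by
    have h1 := lipschitzWith_intervalIntegral (B := 1) hX.continuous.locallyIntegrable
      (Filter.Eventually.of_forall fun t => (hX1 t).le) 0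
    refine LipschitzWith.of_dist_le_mul fun s t => ?_
    rw [hΓ, dist_add_left]
    exact h1.dist_le_mul s t
  have hΓ0 : Γ 0 = D₀ := by simp [hΓ]
  have hΓL : Γ L = D₁ := by
    simp only [hΓ]
    rw [intervalIntegral.integral_of_le hL.le, ← integral_Icc_eq_integral_Ioc]
    rw [hXD]; abel
  set γ : CurveClass m L := AEEqFun.mk Γ hΓlip.continuous.aestronglyMeasurable with hγ
  have hγΓ : γ =ᵐ[sigmaMeasure L] Γ := AEEqFun.coeFn_mk _ _
  have w1 : HasWeakDeriv L γ X := by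
    have := hΓlip.hasWeakDeriv hL
    rw [hdΓ] at this
    exact this.congr hγΓ.symm Filter.EventuallyEq.rfl
  have e1 : weakDeriv L γ =ᵐ[sigmaMeasure L] X := w1.weakDeriv_ae_eq
  have wX := hX.hasWeakDeriv hL
  have w2 : HasWeakDeriv L (weakDeriv L γ) (deriv X) := wX.congr e1.symm Filter.EventuallyEq.rfl
  have e2 : weakDeriv L (weakDeriv L γ) =ᵐ[sigmaMeasure L] deriv X := w2.weakDeriv_ae_eq
  have hspeed : speed γ =ᵐ[sigmaMeasure L] fun _ => 1 := by
    filter_upwards [e1] with t ht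
    rw [speed, ht, hX1]
  have htan : unitTangent γ =ᵐ[sigmaMeasure L] X := by
    filter_upwards [e1, hspeed] with t ht hs
    rw [unitTangent, unitSpeedDeriv, hs, ht, inv_one, one_smul]
  have hcurv : curvature γ =ᵐ[sigmaMeasure L] deriv X := by
    have w3 : HasWeakDeriv L (unitTangent γ) (deriv X) :=
      wX.congr htan.symm Filter.EventuallyEq.rfl
    filter_upwards [w3.weakDeriv_ae_eq, hspeed] with t ht hs
    rw [curvature, unitSpeedDeriv, hs, ht, inv_one, one_smul]
  have hstrain : logStrain γ =ᵐ[sigmaMeasure L] 0 := by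
    filter_upwards [hspeed] with t hs
    rw [logStrain, hs, Real.log_one]; rfl
  have m0 : MemLp γ ∞ (sigmaMeasure L) := by
    obtain ⟨B, hB⟩ := (isCompact_Icc (a := (0 : ℝ)) (b := L)).exists_bound_of_continuousOn
      hΓlip.continuous.continuousOn
    refine memLp_top_of_bound w1.1.1 B ?_
    filter_upwards [hγΓ, ae_restrict_mem measurableSet_Icc] with t ht htI
    rw [ht]; exact hB t htI
  have m1 : MemLp (weakDeriv L γ) ∞ (sigmaMeasure L) := by
    refine memLp_top_of_bound w2.1.1 1 ?_
    filter_upwards [e1] with t ht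
    rw [ht, hX1]
  have m2 : MemLp (weakDeriv L (weakDeriv L γ)) ∞ (sigmaMeasure L) := by
    refine memLp_top_of_bound (w2.2.1.congr e2.symm).1 C ?_
    filter_upwards [e2] with t ht
    rw [ht]; exact norm_deriv_le_of_lipschitz hX
  have hne : ∀ᵐ t ∂(sigmaMeasure L), weakDeriv L γ t ≠ 0 := by
    filter_upwards [e1] with t ht h
    have := hX1 t
    rw [← ht, h, norm_zero] at this
    linarith
  have c1 := contRep_eqOn hL hΓlip.continuous.continuousOn hγΓ
  have c2 := contRep_eqOn hL hX.continuous.continuousOn htan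
  have h0 : (0 : ℝ) ∈ Icc 0 L := ⟨le_rfl, hL.le⟩
  have hLm : L ∈ Icc 0 L := ⟨hL.le, le_rfl⟩
  refine ⟨γ, Γ, ⟨⟨⟨⟨m0, ⟨_, w1⟩, m1⟩, hne, ?_⟩, m0, ⟨_, w1⟩, m1, ⟨_, w2⟩, m2⟩, ?_, hstrain⟩,
    ⟨hγΓ, htan, ?_, ⟨1, hΓlip⟩, ?_, ?_⟩, hΓ0⟩
  · exact (memLp_congr_ae hstrain).2 MemLp.zero
  · simp only [constraintMap, c1 h0, c1 hLm, c2 h0, c2 hLm, hΓ0, hΓL, hX0, hXL, sub_self]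
    ext i
    fin_cases i <;> rfl
  · simpa using hspeed
  · rw [hdΓ]; simp
  · filter_upwards [hcurv] with t ht
    rw [ht]; simp

theorem norm_constraintMap_fst_le {D₀ D₁ N₀ N₁ : EuclideanSpace ℝ (Fin m)} (hL : 0 < L)
    {γ : CurveClass m L} {S : ℝ → ℝ} {T Γ : ℝ → EuclideanSpace ℝ (Fin m)}
    (h : IsRegularRep γ S T Γ) (hT : Continuous T) {e : ℝ}
    (he : ‖(constraintMap D₀ D₁ N₀ N₁ γ).1‖ ≤ e) :
    ‖Γ 0 - D₀‖ ≤ e ∧ ‖Γ L - D₁‖ ≤ e ∧ ‖T 0 - N₀‖ ≤ e ∧ ‖T L - N₁‖ ≤ e := by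
  obtain ⟨CΓ, hΓ⟩ := h.lip
  have c1 := contRep_eqOn hL hΓ.continuous.continuousOn h.curve
  have c2 := contRep_eqOn hL hT.continuousOn h.tangent
  have h0 : (0 : ℝ) ∈ Icc 0 L := ⟨le_rfl, hL.le⟩
  have hLm : L ∈ Icc 0 L := ⟨hL.le, le_rfl⟩
  have hi := fun i => (PiLp.norm_apply_le (constraintMap D₀ D₁ N₀ N₁ γ).1 i).trans he
  simp only [constraintMap, c1 h0, c1 hLm, c2 h0, c2 hLm] at hi
  exact ⟨hi 0, hi 1, hi 2, hi 3⟩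

theorem IsRegularRep.integral_exp_smul (hL : 0 < L) {γ : CurveClass m L} {S : ℝ → ℝ}
    {T Γ : ℝ → EuclideanSpace ℝ (Fin m)} (h : IsRegularRep γ S T Γ) :
    ∫ t, Real.exp (S t) • T t ∂(sigmaMeasure L) = Γ L - Γ 0 := by
  obtain ⟨CΓ, hΓ⟩ := h.lip
  rw [← hΓ.intervalIntegral_deriv_eq_sub, intervalIntegral.integral_of_le hL.le,
    ← integral_Icc_eq_integral_Ioc]
  exact integral_congr_ae h.deriv_curve.symm

/-- The chord of the tangent field of a nearly unit speed curve whose length exceeds the distance of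
its end points is shorter than `L`. -/
theorem IsRegularRep.norm_integral_tangent_le (hL : 0 < L) {γ : CurveClass m L} {S : ℝ → ℝ}
    {T Γ : ℝ → EuclideanSpace ℝ (Fin m)} (h : IsRegularRep γ S T Γ) (hS : Continuous S)
    (hT : Continuous T) (hT1 : ∀ t, ‖T t‖ = 1) {η s : ℝ} (hη : 0 < η)
    (hs : ∀ t, |Real.exp (S t) - 1| ≤ s) (hsη : s ≤ η / (4 * (1 + η)))
    (hlen : (1 + η) * ‖contRep L γ L - contRep L γ 0‖ ≤ curveLength γ) :
    ‖∫ t, T t ∂(sigmaMeasure L)‖ ≤ L * (1 - 2 * (η / (4 * (1 + η)))) := by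
  obtain ⟨CΓ, hΓ⟩ := h.lip
  have c1 := contRep_eqOn hL hΓ.continuous.continuousOn h.curve
  rw [c1 ⟨le_rfl, hL.le⟩, c1 ⟨hL.le, le_rfl⟩, ← h.integral_exp_smul hL] at hlen
  have hlen2 : curveLength γ ≤ L * (1 + s) := by
    rw [curveLength, integral_congr_ae h.speed_eq]
    have h1 := integral_mono (μ := sigmaMeasure L) (f := fun t => Real.exp (S t))
      (Real.continuous_exp.comp hS).continuousOn.integrableOn_Icc (integrable_const (1 + s))
      fun t => by
        show Real.exp (S t) ≤ 1 + s
        linarith [(abs_le.1 (hs t)).2]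
    rwa [integral_const, smul_eq_mul,
      show (sigmaMeasure L).real univ = L by simp [Measure.real, hL.le]] at h1
  have hd := norm_integral_exp_smul_sub_le hL hS hT hT1 hs
  have htri := norm_le_norm_add_norm_sub (∫ t, Real.exp (S t) • T t ∂(sigmaMeasure L))
    (∫ t, T t ∂(sigmaMeasure L))
  set I := ‖∫ t, Real.exp (S t) • T t ∂(sigmaMeasure L)‖
  obtain ⟨δ, hδ⟩ : ∃ δ, δ = η / (4 * (1 + η)) := ⟨_, rfl⟩
  rw [← hδ] at hsη ⊢
  have hs0 : 0 ≤ s := (abs_nonneg _).trans (hs 0)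
  -- The choice of `δ` means `1 - 4δ = 1 / (1 + η)`. Half of the slack `4δ` pays for the deviation
  -- from unit speed, which enters twice: in the length and in replacing `e^S T` by `T`.
  have hδ1 : (1 - 4 * δ) * (1 + η) = 1 := by rw [hδ]; field_simp; ring
  have hδ0 : 0 < 1 - 4 * δ := by
    by_contra hcon
    nlinarith
  have hδ' : 0 < δ := by rw [hδ]; positivity
  have hI : I ≤ L * (1 + s) * (1 - 4 * δ) := by
    have := mul_le_mul_of_nonneg_right (hlen.trans hlen2) hδ0.le
    calc I = (1 + η) * I * (1 - 4 * δ) := by linear_combination (-I) * hδ1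
      _ ≤ _ := this
  have hfin : L * (1 + s) * (1 - 4 * δ) + s * L ≤ L * (1 - 2 * δ) := by
    have h1 : 0 ≤ L * (s * δ) := by positivity
    have h2 : L * s ≤ L * δ := by gcongr
    linarith
  linarith

end Restoration

/-! ### Assembly of the restoration operator and its constants -/

theorem mainTheorem7 (m : ℕ) (L : ℝ) (hL : 0 < L)
    (D₀ D₁ N₀ N₁ : EuclideanSpace ℝ (Fin m)) (hN₀ : ‖N₀‖ = 1) (hN₁ : ‖N₁‖ = 1)
    (Λ K η : ℝ) (hΛ : 0 ≤ Λ) (hK : 0 ≤ K) (hη : 0 < η) :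
    ∃ C : ℝ, 0 < C ∧ ∃ ε : ℝ, 0 < ε ∧
      ∃ P : restorationDomain L D₀ D₁ N₀ N₁ Λ K η ε → feasibleSet L ∞ D₀ D₁ N₀ N₁,
        ∀ γ : restorationDomain L D₀ D₁ N₀ N₁ Λ K η ε,
          tvNorm L 3 (((P γ : CurveClass m L) - γ : CurveClass m L) :
              ℝ → EuclideanSpace ℝ (Fin m)) ≤
            ENNReal.ofReal C * constraintNorm D₀ D₁ N₀ N₁ (γ : CurveClass m L) ∧
          ENNReal.ofReal |bendingEnergy (P γ : CurveClass m L) -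
              bendingEnergy (γ : CurveClass m L)| ≤
            ENNReal.ofReal C * constraintNorm D₀ D₁ N₀ N₁ (γ : CurveClass m L) := by
  obtain ⟨M, hM⟩ : ∃ M : ℝ, M = 1 + 3 * K + (1 + (1 + L) * 3) * K * (1 + L) := ⟨_, rfl⟩
  have hM0 : 0 ≤ M := by rw [hM]; positivity
  obtain ⟨δ, hδ⟩ : ∃ δ : ℝ, δ = η / (4 * (1 + η)) := ⟨_, rfl⟩
  have hδ0 : 0 < δ := by rw [hδ]; positivity
  have hδ1 : δ ≤ 1 := by rw [hδ, div_le_one (by positivity)]; linarith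
  obtain ⟨C, e₀, hC, he₀, hcorr⟩ := exists_correction (m := m) hL hδ0 hδ1 hM0
  obtain ⟨c, hc⟩ : ∃ c : ℝ, c = 1 / L + 1 + L := ⟨_, rfl⟩
  have hc0 : 0 < c := by rw [hc]; positivity
  -- The correction is run with defect `(c + 2) e`: the strain contributes `c e`, and the chord
  -- misses `D₁ - D₀` by the sum of two end point errors. The factor `m` passes from components to
  -- norms.
  obtain ⟨B, hB⟩ : ∃ B : ℝ, B = m * (C * (c + 2)) := ⟨_, rfl⟩
  have hB0 : 0 ≤ B := by rw [hB]; positivity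
  obtain ⟨Ct, hCt⟩ : ∃ x : ℝ, x = L * (1 + L * B) + L * B + L * B + B := ⟨_, rfl⟩
  have hCt0 : 0 ≤ Ct := by rw [hCt]; positivity
  obtain ⟨Ce, hCe⟩ : ∃ x : ℝ, x = 1 / 2 * (L * (B * (2 * (m * M) + B) + 2 * c * (m * M) ^ 2)) :=
    ⟨_, rfl⟩
  have hCe0 : 0 ≤ Ce := by rw [hCe]; positivity
  refine ⟨Ct + Ce + 1, by positivity,
    min (min 1 (1 / c)) (min (e₀ / (c + 2)) (δ / ((1 + L) * 3 * c))), by positivity, ?_⟩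
  generalize hε : min (min 1 (1 / c)) (min (e₀ / (c + 2)) (δ / ((1 + L) * 3 * c))) = ε
  -- All constants are fixed before the curve, so the operator arises by choosing a feasible curve
  -- for each argument separately.
  suffices hkey : ∀ γ : restorationDomain L D₀ D₁ N₀ N₁ Λ K η ε,
      ∃ γ' : feasibleSet L ∞ D₀ D₁ N₀ N₁,
        tvNorm L 3 (((γ' : CurveClass m L) - γ : CurveClass m L) :
            ℝ → EuclideanSpace ℝ (Fin m)) ≤
          ENNReal.ofReal (Ct + Ce + 1) * constraintNorm D₀ D₁ N₀ N₁ (γ : CurveClass m L) ∧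
        ENNReal.ofReal |bendingEnergy (γ' : CurveClass m L) -
            bendingEnergy (γ : CurveClass m L)| ≤
          ENNReal.ofReal (Ct + Ce + 1) * constraintNorm D₀ D₁ N₀ N₁ (γ : CurveClass m L) by
    choose P hP using hkey
    exact ⟨P, hP⟩
  rintro ⟨γ, hγ, hγε⟩
  simp only
  obtain ⟨e, he⟩ : ∃ e : ℝ, e = (constraintNorm D₀ D₁ N₀ N₁ γ).toReal := ⟨_, rfl⟩
  have hfin : constraintNorm D₀ D₁ N₀ N₁ γ ≠ ∞ := (hγε.trans ENNReal.ofReal_lt_top).ne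
  have hen : constraintNorm D₀ D₁ N₀ N₁ γ = ENNReal.ofReal e := by
    rw [he, ENNReal.ofReal_toReal hfin]
  have he0 : 0 ≤ e := by rw [he]; exact ENNReal.toReal_nonneg
  have heε : e ≤ ε := by
    rw [hen] at hγε
    exact (ENNReal.ofReal_lt_ofReal_iff_of_nonneg he0).1 hγε |>.le
  rw [← hε] at heε
  have he1 : e ≤ 1 := heε.trans ((min_le_left _ _).trans (min_le_left _ _))
  have hec : c * e ≤ 1 := by
    have := heε.trans ((min_le_left _ _).trans (min_le_right _ _))
    rw [le_div_iff₀ hc0] at this; linarith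
  have hee₀ : (c + 2) * e ≤ e₀ := by
    have := heε.trans ((min_le_right _ _).trans (min_le_left _ _))
    rw [le_div_iff₀ (by positivity)] at this; linarith
  have heδ : (1 + L) * 3 * (c * e) ≤ δ := by
    have := heε.trans ((min_le_right _ _).trans (min_le_right _ _))
    rw [le_div_iff₀ (by positivity)] at this; linarith
  have hfst : ‖(constraintMap D₀ D₁ N₀ N₁ γ).1‖ ≤ e := by
    have h1 : ‖(constraintMap D₀ D₁ N₀ N₁ γ).1‖ₑ ≤ ENNReal.ofReal e := hen ▸ le_self_add
    rwa [← ofReal_norm, ENNReal.ofReal_le_ofReal_iff he0] at h1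
  have hsnd : tvNorm L 2 (logStrain γ) ≤ ENNReal.ofReal e := hen ▸ le_add_self
  obtain ⟨S, T, Γ, hrep, hS, hT, hT1⟩ := exists_regular_rep hL hK he0 (hc ▸ hec) hγ hsnd
  rw [← hc] at hS
  rw [← hM] at hT
  have hTc := continuous_of_lipBV_components hT
  have hE := hS.exp_sub_one hL hec
  obtain ⟨b1, b2, b3, b4⟩ := norm_constraintMap_fst_le hL hrep hTc hfst
  have hmean := hrep.norm_integral_tangent_le hL hS.lip.continuous hTc hT1 hη hE.abs_le
    (hδ ▸ heδ) hγ.1.2.2.2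
  rw [← hδ] at hmean
  have hce : c * e ≤ (c + 2) * e := by gcongr; linarith
  have h1e : e ≤ (c + 2) * e := by nlinarith
  obtain ⟨X, hX1, hX0, hXL, hXD, hXT, hXS⟩ := hcorr S T N₀ N₁ (D₁ - D₀) ((c + 2) * e) hee₀
    (hS.mono hce) hT hT1 hmean hN₀ hN₁ (b3.trans h1e) (b4.trans h1e) (by
      rw [hrep.integral_exp_smul hL]
      have h1 : Γ L - Γ 0 - (D₁ - D₀) = (Γ L - D₁) - (Γ 0 - D₀) := by abel
      rw [h1]
      refine (norm_sub_le _ _).trans ?_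
      have : 0 ≤ c * e := by positivity
      linarith)
  have ha0 : 0 ≤ C * ((c + 2) * e) := by positivity
  have hBe : m * (C * ((c + 2) * e)) = B * e := by rw [hB]; ring
  have hXTlip := lipschitzWith_of_lipBV_components (T := fun t => X t - T t) ha0 hXT
  have hTlip := lipschitzWith_of_lipBV_components hM0 hT
  obtain ⟨CX, hXlip⟩ : ∃ CX, LipschitzWith CX X :=
    ⟨_, by simpa only [sub_add_cancel] using hXTlip.add hTlip⟩
  obtain ⟨γ', Γ', hfeas, hrep', hΓ'0⟩ := exists_feasible hL hXlip hX1 hX0 hXL hXD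
  refine ⟨⟨γ', hfeas⟩, ?_, ?_⟩
  · obtain ⟨C1, hC1⟩ := hrep.lip
    obtain ⟨C2, hC2⟩ := hrep'.lip
    have hΔd : deriv (fun t => Γ' t - Γ t) =ᵐ[sigmaMeasure L]
        fun t => X t - Real.exp (S t) • T t := by
      filter_upwards [hrep.deriv_curve, hrep'.deriv_curve,
        ae_restrict_of_ae hC1.ae_differentiableAt_real,
        ae_restrict_of_ae hC2.ae_differentiableAt_real] with t h1 h2 h3 h4
      have := (h4.hasDerivAt.sub h3.hasDerivAt).deriv
      rw [h1, h2, Real.exp_zero, one_smul] at this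
      exact this
    have htv := tvNorm_three_le hL (d := ((γ' - γ : CurveClass m L) : ℝ → _)) ha0 he0
      (hC2.sub hC1) (by
        filter_upwards [AEEqFun.coeFn_sub γ' γ, hrep.curve, hrep'.curve] with t h1 h2 h3
        rw [h1, Pi.sub_apply, h2, h3]) hΔd hXS (by
        rw [hΓ'0, norm_sub_rev]; exact b1)
    rw [hBe] at htv
    refine htv.trans ?_
    rw [hen, ← ENNReal.ofReal_mul (by positivity)]
    refine ENNReal.ofReal_le_ofReal ?_
    have h1 : L * (e + L * (B * e)) + L * (B * e) + L * (B * e) + B * e = Ct * e := by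
      rw [hCt]; ring
    rw [h1]
    gcongr
    linarith
  · rw [hen, ← ENNReal.ofReal_mul (by positivity)]
    refine ENNReal.ofReal_le_ofReal ?_
    have hen := abs_bendingEnergy_sub_le hL hrep hrep' hS.lip.continuous hec hS.abs_le
      (norm_deriv_le_of_lipBV_components hM0 hT) (b := B * e) (by
        filter_upwards [ae_restrict_of_ae hXlip.ae_differentiableAt_real,
          ae_restrict_of_ae hTlip.ae_differentiableAt_real] with t h1 h2
        have h3 := norm_deriv_le_of_lipBV_components (T := fun t => X t - T t) ha0 hXT t
        rw [hBe] at h3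
        have h4 : deriv (fun t => X t - T t) t = deriv X t - deriv T t :=
          (h1.hasDerivAt.sub h2.hasDerivAt).deriv
        rwa [h4] at h3)
    refine hen.trans ?_
    -- The quadratic term is absorbed by `e ≤ 1`.
    have h1 : B * e * (2 * (m * M) + B * e) ≤ B * e * (2 * (m * M) + B) := by
      gcongr
      nlinarith
    calc 1 / 2 * (L * (B * e * (2 * (m * M) + B * e) + 2 * (c * e) * (m * M) ^ 2))
        ≤ 1 / 2 * (L * (B * e * (2 * (m * M) + B) + 2 * (c * e) * (m * M) ^ 2)) := by gcongr
      _ = Ce * e := by rw [hCe]; ring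
      _ ≤ _ := by gcongr; linarith
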